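/- Let $\delta\ge 2$, $d$ and $r$ be fixed integers with $3\delta+1\le d\le 4\delta$ and $r\ge d-\delta$, and put $R=r+\delta-1$. A linear code $\mathcal C\subseteq\mathbb F_q^n$ has all symbol $(r,\delta)$-locality if every coordinate $i$ lies in a set $S_i$ of at most $R$ coordinates such that the punctured code $\mathcal C|_{S_i}$ has minimum distance at least $\delta$. A linear code of length $n$ (with $R\mid n$), dimension $k$ and minimum distance $d$ with all symbol $(r,\delta)$-locality is called an optimal $[n,k,d;(r,\delta)_a]_q$-LRC if $$d=n-k+1-\Big(\Big\lceil\frac kr\Big\rceil-1\Big)(\delta-1)\ \text{ when } r>d-\delta,\qquad d=n-k+1-\Big\lceil\frac kr\Big\rceil(\delta-1)\ \text{ when } r=d-\delta$$ (when $r=d-\delta$ and $R\mid n$, the first equality cannot hold). Then, for all sufficiently large prime powers $q$, there are explicit optimal $[n,k,d;(r,\delta)_a]_q$-LRCs whose length $n$ is divisible by $R$ and satisfies $$n=\begin{cases}R\,q^{\frac{\delta}{2}+1-o(1)}, & \delta \text{ even},\\ R\,q^{\frac{\delta+1}{2}-o(1)}, & \delta\text{ odd},\end{cases}$$ where the $o(1)$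 tends to $0$ as $q\to\infty$ with $\delta,d,r$ fixed. Here "explicit" means that there is one deterministic algorithm, depending only on $\delta,d,r$, which for every sufficiently large prime power $q$, given $q$ and the addition and multiplication tables of $\mathbb F_q$ (its elements being labelled $0,\dots,q-1$ in any way), outputs a parity-check matrix of such a code of length $n=n(q)$ in time polynomial in $q$. -/

import Mathlib

open Filter Topology

/-! ## Linear codes, locality and optimality

A linear code of length `n` over `F` is a subspace of `Fin n → F`; weights are Hamming weights. -/

section Codes

variable {F : Type*} [Field F] [DecidableEq F] {n : ℕ}

/-- The minimum distance of the linear code `C` equals `d`: some nonzero codeword has Hamming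
weight `d`, and none has smaller weight. -/
def HasMinDist (C : Submodule F (Fin n → F)) (d : ℕ) : Prop :=
  IsLeast {w : ℕ | ∃ c ∈ C, c ≠ 0 ∧ hammingNorm c = w} d

/-- The punctured code on the coordinates in `S`, all other coordinates being deleted. -/
def punctured (C : Submodule F (Fin n → F)) (S : Finset (Fin n)) : Submodule F (S → F) :=
  C.map (LinearMap.funLeft F F (Subtype.val : S → Fin n))

/-- The `i`-th code symbol of `C` has locality `(r, δ)`: it lies in a set of at most `r + δ - 1`
coordinates on which the punctured code has minimum distance at least `δ`. -/
def HasLocalityAt (C : Submodule F (Fin n → F)) (r δ : ℕ) (i : Fin n) : Prop :=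
  ∃ S : Finset (Fin n), i ∈ S ∧ S.card ≤ r + δ - 1 ∧
    ∀ c ∈ punctured C S, c ≠ 0 → δ ≤ hammingNorm c

/-- All symbol `(r, δ)`-locality. -/
def HasAllSymbolLocality (C : Submodule F (Fin n → F)) (r δ : ℕ) : Prop :=
  ∀ i : Fin n, HasLocalityAt C r δ i

/-- `C` is an optimal `[n, k, d; (r, δ)_a]` locally repairable code, `k` being its dimension:
it has minimum distance `d` and all symbol `(r, δ)`-locality, and `d` attains the Singleton-type
bound `d ≤ n - k + 1 - (⌈k/r⌉ - 1)(δ - 1)`. In the case `d = r + δ`, `(r + δ - 1) ∣ n`, where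
this bound is never attained, optimality refers to `d ≤ n - k + 1 - ⌈k/r⌉ (δ - 1)` instead. -/
def IsOptimalLRC (C : Submodule F (Fin n → F)) (d r δ : ℕ) : Prop :=
  HasMinDist C d ∧ HasAllSymbolLocality C r δ ∧
    if d = r + δ ∧ (r + δ - 1) ∣ n then
      (d : ℤ) = (n : ℤ) - (Module.finrank F C : ℤ) + 1
        - ⌈(Module.finrank F C : ℚ) / (r : ℚ)⌉ * ((δ : ℤ) - 1)
    else
      (d : ℤ) = (n : ℤ) - (Module.finrank F C : ℤ) + 1
        - (⌈(Module.finrank F C : ℚ) / (r : ℚ)⌉ - 1) * ((δ : ℤ) - 1)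

/-- The linear code with parity-check matrix `H`. -/
def codeOf {s : ℕ} (H : Matrix (Fin s) (Fin n) F) : Submodule F (Fin n → F) :=
  LinearMap.ker H.mulVecLin

end Codes

/-! ## Random access machine programs with logarithmic cost

Explicit constructions are those carried out by a program of this kind in polynomial time.
Numbers are natural numbers, and every operation is charged the bit length of its operands. -/

/-- Memory: registers and arrays, both indexed by natural numbers. -/
structure RamState where
  reg : ℕ → ℕ
  arr : ℕ → ℕ → ℕ

/-- Arithmetic operations (subtraction is truncated, division is floor division). -/
inductive RamOp
  | add | sub | mul | div | mod

def RamOp.eval : RamOp → ℕ → ℕ → ℕ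
  | .add, a, b => a + b
  | .sub, a, b => a - b
  | .mul, a, b => a * b
  | .div, a, b => a / b
  | .mod, a, b => a % b

/-- Expressions: constants, register contents, array entries, arithmetic. -/
inductive RamExpr
  | lit (c : ℕ)
  | var (x : ℕ)
  | get (a : ℕ) (i : RamExpr)
  | bin (o : RamOp) (e₁ e₂ : RamExpr)

def RamExpr.eval (σ : RamState) : RamExpr → ℕ
  | .lit c => c
  | .var x => σ.reg x
  | .get a i => σ.arr a (i.eval σ)
  | .bin o e₁ e₂ => o.eval (e₁.eval σ) (e₂.eval σ)

/-- Logarithmic cost of evaluating an expression. -/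
def RamExpr.cost (σ : RamState) : RamExpr → ℕ
  | .lit c => 1 + c.size
  | .var x => 1 + (σ.reg x).size
  | .get a i => 1 + i.cost σ + (i.eval σ).size + (σ.arr a (i.eval σ)).size
  | .bin _ e₁ e₂ => 1 + e₁.cost σ + e₂.cost σ + (e₁.eval σ).size + (e₂.eval σ).size

/-- Programs: assignment to a register, assignment to an array entry, sequential composition,
branching on whether an expression is nonzero, and `loop x e p`, which evaluates `e` once to a
number `N` and then runs `p` for `x = 0, 1, …, N - 1`. -/
inductive RamProg
  | skip
  | assign (x : ℕ) (e : RamExpr)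
  | store (a : ℕ) (i e : RamExpr)
  | seq (p₁ p₂ : RamProg)
  | ite (e : RamExpr) (p₁ p₂ : RamProg)
  | loop (x : ℕ) (e : RamExpr) (p : RamProg)

def RamState.setReg (σ : RamState) (x v : ℕ) : RamState :=
  { σ with reg := Function.update σ.reg x v }

def RamState.setArr (σ : RamState) (a i v : ℕ) : RamState :=
  { σ with arr := Function.update σ.arr a (Function.update (σ.arr a) i v) }

/-- Running a program from a state gives the final state and the running time. -/
def RamProg.run : RamProg → RamState → RamState × ℕ
  | .skip, σ => (σ, 1)
  | .assign x e, σ => (σ.setReg x (e.eval σ), 1 + e.cost σ)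
  | .store a i e, σ =>
      (σ.setArr a (i.eval σ) (e.eval σ), 1 + i.cost σ + (i.eval σ).size + e.cost σ)
  | .seq p₁ p₂, σ =>
      ((p₂.run (p₁.run σ).1).1, 1 + (p₁.run σ).2 + (p₂.run (p₁.run σ).1).2)
  | .ite e p₁ p₂, σ =>
      if e.eval σ ≠ 0 then ((p₁.run σ).1, 1 + e.cost σ + (p₁.run σ).2)
      else ((p₂.run σ).1, 1 + e.cost σ + (p₂.run σ).2)
  | .loop x e p, σ =>
      Nat.rec (motive := fun _ => RamState × ℕ) (σ, 1 + e.cost σ)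
        (fun i acc =>
          ((p.run (acc.1.setReg x i)).1, acc.2 + 1 + i.size + (p.run (acc.1.setReg x i)).2))
        (e.eval σ)

/-- The input describing a field with `q` elements, whose elements are labelled `0, …, q - 1`
by `φ`: register `0` holds `q`, entry `a * q + b` of array `0` (of array `1`) holds the label of
the sum (of the product) of the elements labelled `a` and `b`; everything else is zero. -/
def fieldInput {F : Type*} [Field F] {q : ℕ} (φ : F ≃ Fin q) : RamState where
  reg := fun x => if x = 0 then q else 0
  arr := fun t i =>
    if h : i < q * q then
      let a : Fin q := ⟨i / q, Nat.div_lt_of_lt_mul h⟩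
      let b : Fin q := ⟨i % q, Nat.mod_lt _ (by rcases Nat.eq_zero_or_pos q with h0 | h0
                                                · simp [h0] at h
                                                · exact h0)⟩
      if t = 0 then (φ (φ.symm a + φ.symm b) : ℕ)
      else if t = 1 then (φ (φ.symm a * φ.symm b) : ℕ)
      else 0
    else 0

/-- The state `σ` holds the matrix `H`: its numbers of rows and columns in registers `0` and `1`,
and the labels of its entries, row by row, in array `2`. -/
def HoldsMatrix {F : Type*} {q s n : ℕ} (φ : F ≃ Fin q) (σ : RamState)
    (H : Matrix (Fin s) (Fin n) F) : Prop :=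
  σ.reg 0 = s ∧ σ.reg 1 = n ∧
    ∀ (i : Fin s) (j : Fin n), σ.arr 2 ((i : ℕ) * n + (j : ℕ)) = (φ (H i j) : ℕ)

namespace LRC

section Codes

open Polynomial

/-! ### Vandermonde dependences -/

section Vandermonde

variable {F ι : Type*} [Field F]

/-! The columns are grouped into `L` blocks of `R` evaluation points. Points are distinct inside a
block but may recur in other blocks. Each block carries its own Vandermonde checks of exponents
below `δ - 1`, and all columns share checks of exponents below `d - 1`. The first kind gives
locality: a codeword meets every block in either no or at least `δ` nonzero symbols. As `d ≤ 4δ`, a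
nonzero word of weight below `d` touches at most three blocks. By the shared checks, each point in
its support must occur at least twice (`exists_ne_of_hammingNorm_lt`), hence in another touched
block. If two blocks never share more than `δ / 2` points, the only way to cover `δ` positions is a
triangle: three blocks meeting pairwise in exactly `δ / 2` points, the intersections on each block
being disjoint. So minimum distance `d` becomes an extremal problem about set systems
(`le_hammingNorm_of_mem`), in which the field structure plays no role.

Put `t = ⌊δ/2⌋`. Blocks are graphs over `0, …, R - 1` of integer polynomials of degree at most `t`,
so two of them share at most `t` points. In a triangle, the differences `f₁ - f₃` and `f₂ - f₃` are
multiples of products of `t` linear factors. Equating them at a common point of `f₁` and `f₂` gives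
a relation `A (b₁ - b₃) = B (b₂ - b₃)` between leading coefficients, with nonzero integers `A`, `B`
of size at most `R ^ t`. Leading coefficients are taken from a Behrend-type set in which this forces
`b₁ = b₂` (`eq_of_mul_behrend_sub_eq`), and then `f₁ = f₂` (`not_triangle`). The set consists of
digit vectors lifted to a paraboloid and read in a large base: without carries the relation holds
for vectors, and a line meets a paraboloid in at most two points. Lifting, unlike fixing a radius on
a sphere, keeps every vector and is explicit. With `m` digits in base `2 ^ m` there are `2 ^ (m² (t
+ 1))` polynomials, while their values need only `2 ^ (m² + O(m))` labels. This yields `q ^ (t + 1 -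
o(1))` blocks.

Equality in the bound also needs the dimension, computed from independent rows, and a word of weight
exactly `d`. The word is supported on two further blocks, disjoint from each other and from the
graphs. Pigeonhole provides two `(d - δ)`-sets whose vanishing polynomials differ by a constant;
Lagrange weights on them supply the word (`exists_special_blocks`).

For explicitness, these two blocks are found by exhaustive search over a number of candidates
polynomial in `q`, as `R` is constant. Everything else is integer arithmetic. Running time is
bounded syntactically: all stored values and loop lengths are reduced modulo one fixed power of `q`
(`Clamped.run_bound`). Correctness then shows that no reduction changes a value. -/

theorem sum_mul_eval_eq_zero (s : Finset ι) (x c : ι → F) (k : ℕ)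
    (h : ∀ a < k, ∑ j ∈ s, c j * x j ^ a = 0) (p : F[X]) (hp : p.natDegree < k) :
    ∑ j ∈ s, c j * p.eval (x j) = 0 := by
  simp_rw [eval_eq_sum_range, Finset.mul_sum]
  rw [Finset.sum_comm]
  refine Finset.sum_eq_zero fun a ha => ?_
  have := h a (by simp at ha; omega)
  calc _ = p.coeff a * ∑ j ∈ s, c j * x j ^ a := by
        rw [Finset.mul_sum]; exact Finset.sum_congr rfl fun j _ => by ring
    _ = 0 := by rw [this, mul_zero]

/-- Test the relation against the polynomial vanishing at all nodes except one; its degree is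
`s.card - 1 < k`, and only one term survives. -/
theorem eq_zero_of_sum_mul_pow (s : Finset ι) (x c : ι → F) (k : ℕ) (hx : Set.InjOn x s)
    (hs : s.card ≤ k) (h : ∀ a < k, ∑ j ∈ s, c j * x j ^ a = 0) : ∀ j ∈ s, c j = 0 := by
  classical
  intro i hi
  have hp := sum_mul_eval_eq_zero s x c k h (Lagrange.nodal (s.erase i) x) (by
    rw [Lagrange.natDegree_nodal, Finset.card_erase_of_mem hi]
    have := Finset.card_pos.2 ⟨i, hi⟩
    omega)
  rw [Finset.sum_eq_single_of_mem i hi] at hp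
  · refine (mul_eq_zero.1 hp).resolve_right (Lagrange.eval_nodal_not_at_node fun j hj he => ?_)
    rw [Finset.mem_erase] at hj
    exact hj.1 (hx hj.2 hi he.symm)
  · intro j hj hne
    rw [Lagrange.eval_nodal_at_node (Finset.mem_erase.2 ⟨hne, hj⟩), mul_zero]

end Vandermonde

/-! ### Codes from blocks of evaluation points -/

/-- The columns belonging to block `b`. -/
def blockCols (L R b : ℕ) : Finset (Fin (L * R)) :=
  Finset.univ.filter fun j => (j : ℕ) / R = b

theorem injOn_blockCols {α : Type*} {R L : ℕ} {pts : ℕ → ℕ → α}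
    (hinj : ∀ b < L, ∀ p < R, ∀ p' < R, pts b p = pts b p' → p = p')
    {b : ℕ} (hb : b < L) : Set.InjOn
      (fun j : Fin (L * R) => pts ((j : ℕ) / R) ((j : ℕ) % R)) (blockCols L R b) := by
  intro j hj j' hj' h
  simp only [blockCols, Finset.coe_filter, Finset.mem_univ, true_and, Set.mem_ofPred_eq] at hj hj'
  have hR : 0 < R := Nat.pos_of_ne_zero fun h0 => by subst h0; exact absurd j.2 (by simp)
  simp only [hj, hj'] at h
  have := hinj b hb _ (Nat.mod_lt _ hR) _ (Nat.mod_lt _ hR) h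
  ext
  rw [← Nat.div_add_mod (j : ℕ) R, ← Nat.div_add_mod (j' : ℕ) R, hj, hj', this]

theorem card_blockCols {R L : ℕ} (hR : 0 < R) {b : ℕ} (hb : b < L) : (blockCols L R b).card = R := by
  have hlt : ∀ p < R, R * b + p < L * R := fun p hp => by
    calc R * b + p < R * b + R := by omega
      _ = (b + 1) * R := by ring
      _ ≤ L * R := Nat.mul_le_mul_right _ hb
  refine Finset.card_eq_of_bijective (fun p hp => ⟨R * b + p, hlt p hp⟩) ?_ ?_ ?_
  · intro j hj
    simp only [blockCols, Finset.mem_filter, Finset.mem_univ, true_and] at hj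
    exact ⟨(j : ℕ) % R, Nat.mod_lt _ hR, by ext; simp [← hj, Nat.div_add_mod]⟩
  · intro p hp
    simp [blockCols, Nat.mul_add_div hR, Nat.div_eq_of_lt hp]
  · intro p p' hp hp' h
    simpa using h

theorem block_lt {R L : ℕ} (j : Fin (L * R)) : (j : ℕ) / R < L :=
  Nat.div_lt_of_lt_mul (j.2.trans_eq (mul_comm _ _))

section BlockCode

variable {F : Type*} [Field F] [DecidableEq F]

/-- The parity-check matrix attached to blocks `0, …, L - 1` of `R` evaluation points: every block
has its own checks `x ^ a`, `a < δ - 1`, and there are common checks `x ^ a`, `a < d - 1`. -/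
def parityMatrix (R δ d L : ℕ) (pts : ℕ → ℕ → F) :
    Matrix (Fin ((L + 1) * (d - 1))) (Fin (L * R)) F := fun i j =>
  if ((i : ℕ) / (d - 1) = (j : ℕ) / R ∧ (i : ℕ) % (d - 1) < δ - 1) ∨ (i : ℕ) / (d - 1) = L then
    pts ((j : ℕ) / R) ((j : ℕ) % R) ^ ((i : ℕ) % (d - 1))
  else 0

variable {R δ d L : ℕ} {pts : ℕ → ℕ → F}

theorem mem_codeOf_parityMatrix (hδ : δ ≤ d) (hd : 2 ≤ d) (c : Fin (L * R) → F) :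
    c ∈ codeOf (parityMatrix R δ d L pts) ↔
      (∀ b < L, ∀ a < δ - 1, ∑ j ∈ blockCols L R b,
        c j * pts ((j : ℕ) / R) ((j : ℕ) % R) ^ a = 0) ∧
      ∀ a < d - 1, ∑ j, c j * pts ((j : ℕ) / R) ((j : ℕ) % R) ^ a = 0 := by
  have hd1 : 0 < d - 1 := by omega
  -- Row `(d - 1) * b + a` is the check of exponent `a` in group `b`; groups `b < L` belong to
  -- blocks, and group `b = L` holds the common checks.
  have key : c ∈ codeOf (parityMatrix R δ d L pts) ↔ ∀ b < L + 1, ∀ a < d - 1,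
      ∑ j : Fin (L * R), (if (b = (j : ℕ) / R ∧ a < δ - 1) ∨ b = L then
        c j * pts ((j : ℕ) / R) ((j : ℕ) % R) ^ a else 0) = 0 := by
    rw [codeOf, LinearMap.mem_ker, Matrix.mulVecLin_apply, funext_iff]
    have aux : ∀ (b a : ℕ) (h : (d - 1) * b + a < (L + 1) * (d - 1)), a < d - 1 →
        (Matrix.mulVec (parityMatrix R δ d L pts) c ⟨(d - 1) * b + a, h⟩ =
        ∑ j : Fin (L * R), (if (b = (j : ℕ) / R ∧ a < δ - 1) ∨ b = L then
        c j * pts ((j : ℕ) / R) ((j : ℕ) % R) ^ a else 0)) := by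
      intro b a h ha
      rw [Matrix.mulVec, dotProduct]
      refine Finset.sum_congr rfl fun j _ => ?_
      simp only [parityMatrix, Nat.mul_add_mod, Nat.mod_eq_of_lt ha,
        Nat.mul_add_div hd1, Nat.div_eq_of_lt ha, add_zero]
      split_ifs
      · ring
      · ring
    constructor
    · intro h b hb a ha
      have hlt : (d - 1) * b + a < (L + 1) * (d - 1) := by
        calc (d - 1) * b + a < (d - 1) * b + (d - 1) := by omega
          _ = (b + 1) * (d - 1) := by ring
          _ ≤ _ := Nat.mul_le_mul_right _ hb
      rw [← aux b a hlt ha]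
      exact h _
    · intro h i
      have hi : (i : ℕ) / (d - 1) < L + 1 := Nat.div_lt_of_lt_mul (i.2.trans_eq (mul_comm _ _))
      have ha := Nat.mod_lt (i : ℕ) hd1
      have e : i = ⟨(d - 1) * ((i : ℕ) / (d - 1)) + (i : ℕ) % (d - 1),
          by rw [Nat.div_add_mod]; exact i.2⟩ := by
        ext; simp [Nat.div_add_mod]
      rw [e, aux _ _ _ ha]
      exact h _ hi _ ha
  rw [key]
  constructor
  · intro h
    refine ⟨fun b hb a ha => ?_, fun a ha => ?_⟩
    · have := h b (by omega) a (by omega)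
      rw [← this, blockCols, Finset.sum_filter]
      refine Finset.sum_congr rfl fun j _ => if_congr ?_ rfl rfl
      constructor
      · intro h'; exact Or.inl ⟨h'.symm, ha⟩
      · rintro (h' | h')
        · exact h'.1.symm
        · omega
    · have := h L (by omega) a ha
      rw [← this]
      refine Finset.sum_congr rfl fun j _ => ?_
      rw [if_pos (Or.inr rfl)]
  · rintro ⟨h1, h2⟩ b hb a ha
    by_cases hbL : b = L
    · rw [← h2 a ha]
      refine Finset.sum_congr rfl fun j _ => ?_
      rw [if_pos (Or.inr hbL)]
    · by_cases haδ : a < δ - 1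
      · refine Eq.trans ?_ (h1 b (by omega) a haδ)
        rw [blockCols, Finset.sum_filter]
        refine Finset.sum_congr rfl fun j _ => if_congr ?_ rfl rfl
        constructor
        · rintro (h' | h')
          · exact h'.1.symm
          · exact absurd h' hbL
        · intro h'; exact Or.inl ⟨h'.symm, haδ⟩
      · refine Finset.sum_eq_zero fun j _ => if_neg ?_
        tauto

/-- A codeword that does not vanish on a block has at least `δ` nonzero symbols there. -/
theorem le_card_support_block (hδ : δ ≤ d) (hd : 2 ≤ d)
    (hinj : ∀ b < L, ∀ p < R, ∀ p' < R, pts b p = pts b p' → p = p')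
    {c : Fin (L * R) → F} (hc : c ∈ codeOf (parityMatrix R δ d L pts))
    {j : Fin (L * R)} (hj : c j ≠ 0) :
    δ ≤ ((blockCols L R ((j : ℕ) / R)).filter fun i => c i ≠ 0).card := by
  by_contra hlt
  have hb := block_lt j
  set s := (blockCols L R ((j : ℕ) / R)).filter fun i => c i ≠ 0
  -- At most `δ - 1` nonzero symbols at distinct points satisfy `δ - 1` Vandermonde checks, so all
  -- of them vanish.
  refine hj (eq_zero_of_sum_mul_pow s (fun j => pts ((j : ℕ) / R) ((j : ℕ) % R)) c (δ - 1)
    ((injOn_blockCols hinj hb).mono (Finset.coe_subset.2 (Finset.filter_subset _ _)))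
    (by omega) (fun a ha => ?_) j
    (by simp [s, blockCols, hj]))
  rw [← ((mem_codeOf_parityMatrix hδ hd c).1 hc).1 _ hb a ha]
  refine Finset.sum_subset (Finset.filter_subset _ _) fun i hi hi' => ?_
  have : c i = 0 := by
    by_contra h
    exact hi' (Finset.mem_filter.2 ⟨hi, h⟩)
  rw [this, zero_mul]

theorem hasAllSymbolLocality_parityMatrix {r : ℕ} (hδ : δ ≤ d) (hd : 2 ≤ d)
    (hinj : ∀ b < L, ∀ p < R, ∀ p' < R, pts b p = pts b p' → p = p') (hR : R = r + δ - 1) :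
    HasAllSymbolLocality (codeOf (parityMatrix R δ d L pts)) r δ := by
  intro i
  have hR0 : 0 < R := Nat.pos_of_ne_zero fun h0 => by subst h0; exact absurd i.2 (by simp)
  refine ⟨blockCols L R ((i : ℕ) / R), by simp [blockCols], ?_, ?_⟩
  · rw [card_blockCols hR0 (block_lt i), hR]
  · rintro _ ⟨c, hc, rfl⟩ hne
    obtain ⟨j, hj⟩ := Function.ne_iff.1 hne
    simp only [LinearMap.funLeft_apply, Pi.zero_apply] at hj
    have hjb : ((j : Fin (L * R)) : ℕ) / R = (i : ℕ) / R := by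
      have := j.2
      simpa [blockCols] using this
    have h := le_card_support_block hδ hd hinj hc hj
    rw [hjb] at h
    refine h.trans ?_
    rw [hammingNorm]
    refine Finset.card_le_card_of_surjOn (fun k => (k : Fin (L * R))) ?_
    intro k hk
    simp only [Finset.coe_filter, Set.mem_ofPred_eq] at hk
    exact ⟨⟨k, hk.1⟩, Finset.mem_coe.2 (Finset.mem_filter.2 ⟨Finset.mem_univ _, hk.2⟩), rfl⟩

end BlockCode

/-! ### Minimum distance -/

open Classical in
/-- The positions in block `b` whose point also occurs in block `b'`. -/
noncomputable def coincidences {α : Type*} (R : ℕ) (pts : ℕ → ℕ → α) (b b' : ℕ) : Finset ℕ :=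
  (Finset.range R).filter fun p => ∃ p' < R, pts b' p' = pts b p

theorem mem_coincidences {α : Type*} {R : ℕ} {pts : ℕ → ℕ → α} {b b' p : ℕ} :
    p ∈ coincidences R pts b b' ↔ p < R ∧ ∃ p' < R, pts b' p' = pts b p := by
  classical
  simp [coincidences]

section MinDist

variable {F : Type*} [Field F] [DecidableEq F] {R δ d L : ℕ} {pts : ℕ → ℕ → F}

/-- In a codeword of weight below `d`, every point carrying a nonzero symbol carries another one. -/
theorem exists_ne_of_hammingNorm_lt (hδ : δ ≤ d) (hd : 2 ≤ d)
    {c : Fin (L * R) → F} (hc : c ∈ codeOf (parityMatrix R δ d L pts)) (hw : hammingNorm c < d)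
    {j : Fin (L * R)} (hj : c j ≠ 0) : ∃ j', j' ≠ j ∧ c j' ≠ 0 ∧
      pts ((j' : ℕ) / R) ((j' : ℕ) % R) = pts ((j : ℕ) / R) ((j : ℕ) % R) := by
  by_contra! hcon
  set x : Fin (L * R) → F := fun j => pts ((j : ℕ) / R) ((j : ℕ) % R) with hx
  set s : Finset (Fin (L * R)) := Finset.univ.filter fun i => c i ≠ 0 with hs
  have hjs : j ∈ s := by simp [hs, hj]
  -- Merge the symbols lying over the same point. There are at most `d - 1` points and `d - 1`
  -- common checks, so every merged symbol is zero; a point occurring only once would then carry the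
  -- symbol zero.
  have h0 := eq_zero_of_sum_mul_pow (s.image x) id (fun y => ∑ i ∈ s.filter (fun i => x i = y), c i)
    (d - 1) Function.injective_id.injOn
    (by
      have h1 : (s.image x).card ≤ s.card := Finset.card_image_le
      have h2 : s.card = hammingNorm c := rfl
      omega)
    (fun a ha => by
      have h1 := ((mem_codeOf_parityMatrix hδ hd c).1 hc).2 a ha
      calc _ = ∑ y ∈ s.image x, ∑ i ∈ s.filter (fun i => x i = y), c i * x i ^ a := by
            refine Finset.sum_congr rfl fun y _ => ?_
            rw [Finset.sum_mul]
            refine Finset.sum_congr rfl fun i hi => ?_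
            rw [(Finset.mem_filter.1 hi).2]; rfl
        _ = ∑ i ∈ s, c i * x i ^ a :=
            Finset.sum_fiberwise_of_maps_to (fun i hi => Finset.mem_image_of_mem x hi) _
        _ = ∑ i, c i * x i ^ a := by
            refine Finset.sum_subset (Finset.subset_univ _) fun i _ hi => ?_
            have : c i = 0 := by simpa [hs] using hi
            rw [this, zero_mul]
        _ = 0 := h1)
    (x j) (Finset.mem_image_of_mem x hjs)
  rw [Finset.sum_eq_single_of_mem (s := s.filter fun i => x i = x j) j
    (Finset.mem_filter.2 ⟨hjs, rfl⟩)] at h0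
  · exact hj h0
  · intro i hi hij
    rw [Finset.mem_filter] at hi
    by_contra hci
    exact hcon i hij hci hi.2

/-- A light word touches at most three blocks, and its support in each is covered by coincidences
with the other touched blocks. The bound on pairs leaves only a triangle with equality everywhere,
which `htri` forbids. -/
theorem le_hammingNorm_of_mem (hδ0 : 1 ≤ δ) (hδ : δ ≤ d) (hd : 2 ≤ d) (hd4 : d ≤ 4 * δ)
    (hinj : ∀ b < L, ∀ p < R, ∀ p' < R, pts b p = pts b p' → p = p')
    (hpair : ∀ b < L, ∀ b' < L, b ≠ b' → 2 * (coincidences R pts b b').card ≤ δ)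
    (htri : ∀ b₁ < L, ∀ b₂ < L, ∀ b₃ < L, b₁ ≠ b₂ → b₁ ≠ b₃ → b₂ ≠ b₃ →
      2 * (coincidences R pts b₁ b₂).card = δ → 2 * (coincidences R pts b₁ b₃).card = δ →
      2 * (coincidences R pts b₂ b₃).card = δ →
      ¬ Disjoint (coincidences R pts b₁ b₂) (coincidences R pts b₁ b₃))
    {c : Fin (L * R) → F} (hc : c ∈ codeOf (parityMatrix R δ d L pts)) (hne : c ≠ 0) :
    d ≤ hammingNorm c := by
  by_contra! hw
  set s : Finset (Fin (L * R)) := Finset.univ.filter fun i => c i ≠ 0 with hs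
  set B : Finset ℕ := s.image fun j : Fin (L * R) => (j : ℕ) / R with hB
  set S : ℕ → Finset (Fin (L * R)) := fun b => s.filter fun j => (j : ℕ) / R = b with hS
  have hBL : ∀ b ∈ B, b < L := by
    intro b hb
    obtain ⟨j, -, rfl⟩ := Finset.mem_image.1 hb
    exact block_lt j
  have hSδ : ∀ b ∈ B, δ ≤ (S b).card := by
    intro b hb
    obtain ⟨j, hj, rfl⟩ := Finset.mem_image.1 hb
    have h := le_card_support_block hδ hd hinj hc (Finset.mem_filter.1 hj).2
    refine h.trans (Finset.card_le_card fun i hi => ?_)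
    simpa [hS, hs, blockCols, and_comm] using hi
  have hcard : s.card = ∑ b ∈ B, (S b).card :=
    Finset.card_eq_sum_card_image (fun j : Fin (L * R) => (j : ℕ) / R) s
  have hBcard : B.card ≤ 3 := by
    by_contra h4
    have h1 : B.card * δ ≤ s.card := by
      rw [hcard, ← smul_eq_mul]
      exact Finset.card_nsmul_le_sum _ _ _ hSδ
    have h2 : s.card = hammingNorm c := rfl
    have h3 : 4 * δ ≤ B.card * δ := Nat.mul_le_mul_right _ (by omega)
    omega
  have hBne : B.Nonempty := by
    obtain ⟨j, hj⟩ := Function.ne_iff.1 hne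
    exact ⟨_, Finset.mem_image_of_mem _ (Finset.mem_filter.2 ⟨Finset.mem_univ j, hj⟩)⟩
  -- The second occurrence of a support point cannot lie in the same block, where points are
  -- distinct.
  have hcov : ∀ b ∈ B, δ ≤ ((B.erase b).biUnion fun b' => coincidences R pts b b').card := by
    intro b hb
    refine (hSδ b hb).trans ?_
    refine Finset.card_le_card_of_injOn (fun j : Fin (L * R) => (j : ℕ) % R) ?_ ?_
    · intro j hj
      have hj' := Finset.mem_filter.1 (Finset.mem_coe.1 hj)
      have hR : 0 < R := Nat.pos_of_ne_zero fun h0 => by subst h0; exact absurd j.2 (by simp)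
      obtain ⟨i, hij, hi, hxi⟩ := exists_ne_of_hammingNorm_lt hδ hd hc hw
        (Finset.mem_filter.1 hj'.1).2
      have hiB : (i : ℕ) / R ∈ B :=
        Finset.mem_image_of_mem _ (Finset.mem_filter.2 ⟨Finset.mem_univ i, hi⟩)
      have hib : (i : ℕ) / R ≠ b := by
        intro hib
        refine hij (injOn_blockCols hinj (hBL b hb) (x₁ := i) (x₂ := j) ?_ ?_ hxi)
        · simp [blockCols, hib]
        · simp [blockCols, hj'.2]
      refine Finset.mem_coe.2 (Finset.mem_biUnion.2 ⟨_, Finset.mem_erase.2 ⟨hib, hiB⟩, ?_⟩)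
      refine mem_coincidences.2 ⟨Nat.mod_lt _ hR, _, Nat.mod_lt (i : ℕ) hR, ?_⟩
      rw [hxi, hj'.2]
    · intro j hj j' hj' h
      have h1 := (Finset.mem_filter.1 (Finset.mem_coe.1 hj)).2
      have h2 := (Finset.mem_filter.1 (Finset.mem_coe.1 hj')).2
      ext
      simp only at h
      rw [← Nat.div_add_mod (j : ℕ) R, ← Nat.div_add_mod (j' : ℕ) R, h1, h2, h]
  -- Each other block covers at most half of the required `δ` positions, so at least two others are
  -- needed.
  have h2cov : ∀ b ∈ B, 2 * δ ≤ (B.card - 1) * δ := by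
    intro b hb
    calc 2 * δ ≤ 2 * ∑ b' ∈ B.erase b, (coincidences R pts b b').card :=
          Nat.mul_le_mul_left _ ((hcov b hb).trans Finset.card_biUnion_le)
      _ = ∑ b' ∈ B.erase b, 2 * (coincidences R pts b b').card := Finset.mul_sum _ _ _
      _ ≤ ∑ _b' ∈ B.erase b, δ := Finset.sum_le_sum fun b' hb' =>
          hpair b (hBL b hb) b' (hBL b' (Finset.mem_erase.1 hb').2) (Finset.mem_erase.1 hb').1.symm
      _ = (B.card - 1) * δ := by rw [Finset.sum_const, Finset.card_erase_of_mem hb, smul_eq_mul]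
  have hB3 : B.card = 3 := by
    obtain ⟨b, hb⟩ := hBne
    have := Nat.le_of_mul_le_mul_right (h2cov b hb) hδ0
    omega
  obtain ⟨b₁, b₂, b₃, h12, h13, h23, hBeq⟩ := Finset.card_eq_three.1 hB3
  have hm1 : b₁ ∈ B := by simp [hBeq]
  have hm2 : b₂ ∈ B := by simp [hBeq]
  have hm3 : b₃ ∈ B := by simp [hBeq]
  -- Two sets of size at most `δ / 2` whose union has at least `δ` elements have size exactly `δ /
  -- 2` and are disjoint.
  have key : ∀ x ∈ B, ∀ y ∈ B, ∀ z ∈ B, x ≠ y → x ≠ z → y ≠ z → B.erase x = {y, z} →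
      2 * (coincidences R pts x y).card = δ ∧ 2 * (coincidences R pts x z).card = δ ∧
      Disjoint (coincidences R pts x y) (coincidences R pts x z) := by
    intro x hx y hy z hz hxy hxz hyz he
    have h1 := hcov x hx
    rw [he, Finset.biUnion_insert, Finset.singleton_biUnion] at h1
    have h2 := hpair x (hBL x hx) y (hBL y hy) hxy
    have h3 := hpair x (hBL x hx) z (hBL z hz) hxz
    have h4 := Finset.card_union_add_card_inter (coincidences R pts x y) (coincidences R pts x z)
    refine ⟨by omega, by omega, ?_⟩
    rw [Finset.disjoint_iff_inter_eq_empty, ← Finset.card_eq_zero]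
    omega
  have k1 := key b₁ hm1 b₂ hm2 b₃ hm3 h12 h13 h23 (by
    rw [hBeq]; ext; simp; grind)
  have k2 := key b₂ hm2 b₁ hm1 b₃ hm3 h12.symm h23 h13 (by
    rw [hBeq]; ext; simp; grind)
  exact htri b₁ (hBL _ hm1) b₂ (hBL _ hm2) b₃ (hBL _ hm3) h12 h13 h23 k1.1 k1.2.1 k2.2.1 k1.2.2

end MinDist

/-! ### Dimension -/

section Dimension

variable {F : Type*} [Field F] [DecidableEq F] {R δ d L : ℕ} {pts : ℕ → ℕ → F}

/-- The parity-check matrix without redundant rows. -/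
def reducedParityMatrix (R δ d L : ℕ) (pts : ℕ → ℕ → F) :
    Matrix ((Fin L × Fin (δ - 1)) ⊕ Fin (d - δ)) (Fin (L * R)) F := fun i j =>
  match i with
  | .inl (b, a) => if (j : ℕ) / R = b then pts ((j : ℕ) / R) ((j : ℕ) % R) ^ (a : ℕ) else 0
  | .inr a => pts ((j : ℕ) / R) ((j : ℕ) % R) ^ (δ - 1 + a : ℕ)

/-- On a single block, a relation between rows is a polynomial of degree below `d - 1` vanishing at
`R ≥ d - 1` distinct points, hence zero. Its coefficients below `δ - 1` belong to that block and the
higher ones to the common checks, so they separate. -/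
theorem linearIndependent_reducedParityMatrix (hδ0 : 1 ≤ δ) (hδ : δ ≤ d) (hL : 0 < L)
    (hR : d - 1 ≤ R) (hR0 : 0 < R)
    (hinj : ∀ b < L, ∀ p < R, ∀ p' < R, pts b p = pts b p' → p = p') :
    LinearIndependent F (reducedParityMatrix R δ d L pts).row := by
  classical
  rw [Fintype.linearIndependent_iff]
  intro g hg
  have hcol : ∀ j : Fin (L * R), ∑ i, g i * reducedParityMatrix R δ d L pts i j = 0 := by
    intro j
    have := congrFun hg j
    simpa [Finset.sum_apply, Matrix.row] using this
  have main : ∀ b : Fin L, (∀ a, g (.inl (b, a)) = 0) ∧ ∀ a, g (.inr a) = 0 := by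
    intro b
    set p : F[X] := ∑ a : Fin (δ - 1), monomial (a : ℕ) (g (.inl (b, a))) +
      ∑ a : Fin (d - δ), monomial (δ - 1 + a : ℕ) (g (.inr a)) with hp
    have hp0 : p = 0 := by
      by_contra hp0
      have hdeg : p.degree < ((d - 1 : ℕ) : WithBot ℕ) := by
        rw [hp]
        refine (degree_add_le _ _).trans_lt (max_lt ?_ ?_)
        · refine (degree_sum_le _ _).trans_lt ?_
          rw [Finset.sup_lt_iff (WithBot.bot_lt_coe _)]
          intro a _
          exact (degree_monomial_le _ _).trans_lt (by have := a.2; norm_cast; omega)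
        · refine (degree_sum_le _ _).trans_lt ?_
          rw [Finset.sup_lt_iff (WithBot.bot_lt_coe _)]
          intro a _
          exact (degree_monomial_le _ _).trans_lt (by have := a.2; norm_cast; omega)
      refine hp0 (eq_zero_of_degree_lt_of_eval_index_eq_zero
        (v := fun j : Fin (L * R) => pts ((j : ℕ) / R) ((j : ℕ) % R)) (s := blockCols L R b)
        (injOn_blockCols hinj b.2) ?_ ?_)
      · rw [card_blockCols hR0 b.2]
        exact hdeg.trans_le (by exact_mod_cast hR)
      · intro j hj
        have hjb : (j : ℕ) / R = b := by simpa [blockCols] using hj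
        rw [← hcol j, Fintype.sum_sum_type, hp, eval_add, eval_finsetSum, eval_finsetSum]
        congr 1
        · rw [Fintype.sum_prod_type, Finset.sum_eq_single b]
          · simp [reducedParityMatrix, hjb]
          · intro b' _ hb'
            refine Finset.sum_eq_zero fun a _ => ?_
            have : ¬ (j : ℕ) / R = b' := by rw [hjb]; exact fun h => hb' (Fin.ext h.symm)
            simp [reducedParityMatrix, this]
          · simp
        · simp [reducedParityMatrix]
    constructor
    · intro a
      have h := congrArg (fun P => P.coeff (a : ℕ)) hp0
      simp only [hp, coeff_add, finsetSum_coeff, coeff_monomial, coeff_zero] at h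
      rw [Finset.sum_eq_single a, Finset.sum_eq_zero] at h
      · simpa using h
      · intro a' _
        rw [if_neg]; have := a.2; omega
      · intro a' _ ha'
        rw [if_neg]; exact fun h => ha' (Fin.ext h)
      · simp
    · intro a
      have h := congrArg (fun P => P.coeff (δ - 1 + a : ℕ)) hp0
      simp only [hp, coeff_add, finsetSum_coeff, coeff_monomial, coeff_zero] at h
      rw [Finset.sum_eq_zero, Finset.sum_eq_single a] at h
      · simpa using h
      · intro a' _ ha'
        rw [if_neg]; exact fun h => ha' (Fin.ext (by omega))
      · simp
      · intro a' _
        rw [if_neg]; have := a'.2; omega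
  rintro (⟨b, a⟩ | a)
  · exact (main b).1 a
  · exact (main ⟨0, hL⟩).2 a

/-- Common checks of exponent below `δ - 1` are sums of block checks, hence redundant. -/
theorem codeOf_reducedParityMatrix (hδ0 : 1 ≤ δ) (hδ : δ ≤ d) (hd : 2 ≤ d) :
    LinearMap.ker (reducedParityMatrix R δ d L pts).mulVecLin =
      codeOf (parityMatrix R δ d L pts) := by
  ext c
  rw [mem_codeOf_parityMatrix hδ hd, LinearMap.mem_ker, Matrix.mulVecLin_apply, funext_iff]
  have hl : ∀ (b : Fin L) (a : Fin (δ - 1)),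
      Matrix.mulVec (reducedParityMatrix R δ d L pts) c (.inl (b, a)) =
      ∑ j ∈ blockCols L R b, c j * pts ((j : ℕ) / R) ((j : ℕ) % R) ^ (a : ℕ) := by
    intro b a
    rw [Matrix.mulVec, dotProduct, blockCols, Finset.sum_filter]
    refine Finset.sum_congr rfl fun j _ => ?_
    simp only [reducedParityMatrix]
    split_ifs <;> ring
  have hr : ∀ a : Fin (d - δ), Matrix.mulVec (reducedParityMatrix R δ d L pts) c (.inr a) =
      ∑ j, c j * pts ((j : ℕ) / R) ((j : ℕ) % R) ^ (δ - 1 + a : ℕ) := by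
    intro a
    rw [Matrix.mulVec, dotProduct]
    refine Finset.sum_congr rfl fun j _ => ?_
    simp only [reducedParityMatrix]
    ring
  constructor
  · intro h
    have h1 : ∀ b < L, ∀ a < δ - 1, ∑ j ∈ blockCols L R b,
        c j * pts ((j : ℕ) / R) ((j : ℕ) % R) ^ a = 0 := fun b hb a ha => by
      rw [← hl ⟨b, hb⟩ ⟨a, ha⟩]; exact h _
    refine ⟨h1, fun a ha => ?_⟩
    by_cases haδ : a < δ - 1
    · rw [← Finset.sum_fiberwise_of_maps_to (t := Finset.range L)
        (g := fun j : Fin (L * R) => (j : ℕ) / R) fun j _ => Finset.mem_range.2 (block_lt j)]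
      exact Finset.sum_eq_zero fun b hb => h1 b (Finset.mem_range.1 hb) a haδ
    · have := hr ⟨a - (δ - 1), by omega⟩
      rw [h] at this
      rw [Pi.zero_apply] at this
      rw [this]
      simp only
      rw [Nat.add_sub_cancel' (by omega)]
  · rintro ⟨h1, h2⟩ (⟨b, a⟩ | a)
    · rw [hl, h1 b b.2 a a.2]; rfl
    · rw [hr, h2 _ (by have := a.2; omega)]; rfl

theorem finrank_codeOf_parityMatrix (hδ0 : 1 ≤ δ) (hδ : δ ≤ d) (hd : 2 ≤ d) (hL : 0 < L)
    (hR : d - 1 ≤ R) (hinj : ∀ b < L, ∀ p < R, ∀ p' < R, pts b p = pts b p' → p = p') :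
    L * (δ - 1) + (d - δ) + Module.finrank F (codeOf (parityMatrix R δ d L pts)) = L * R := by
  have h1 := (linearIndependent_reducedParityMatrix hδ0 hδ hL hR (by omega) hinj).rank_matrix
  have h2 := LinearMap.finrank_range_add_finrank_ker (reducedParityMatrix R δ d L pts).mulVecLin
  rw [codeOf_reducedParityMatrix hδ0 hδ hd] at h2
  rw [Matrix.rank] at h1
  rw [h1] at h2
  simpa using h2

end Dimension

/-! ### Optimality of the parameters and the word attaining the distance -/

section Optimal

variable {F : Type*} [Field F] [DecidableEq F] {R δ d r L : ℕ} {pts : ℕ → ℕ → F}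

/-- The dimension is `k = L r - (d - δ)` with `0 < d - δ ≤ r`. Hence `⌈k / r⌉` is `L` when `d - δ <
r` and `L - 1` when `d - δ = r`; the length is always a multiple of `R`, so these are exactly the
two cases of the definition. -/
theorem isOptimalLRC_parityMatrix (hδ : 2 ≤ δ) (hd₁ : 3 * δ + 1 ≤ d) (hd₂ : d ≤ 4 * δ)
    (hr : d ≤ r + δ) (hR : R = r + δ - 1) (hL : 2 ≤ L)
    (hinj : ∀ b < L, ∀ p < R, ∀ p' < R, pts b p = pts b p' → p = p')
    (hpair : ∀ b < L, ∀ b' < L, b ≠ b' → 2 * (coincidences R pts b b').card ≤ δ)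
    (htri : ∀ b₁ < L, ∀ b₂ < L, ∀ b₃ < L, b₁ ≠ b₂ → b₁ ≠ b₃ → b₂ ≠ b₃ →
      2 * (coincidences R pts b₁ b₂).card = δ → 2 * (coincidences R pts b₁ b₃).card = δ →
      2 * (coincidences R pts b₂ b₃).card = δ →
      ¬ Disjoint (coincidences R pts b₁ b₂) (coincidences R pts b₁ b₃))
    (hword : ∃ c ∈ codeOf (parityMatrix R δ d L pts), c ≠ 0 ∧ hammingNorm c ≤ d) :
    IsOptimalLRC (codeOf (parityMatrix R δ d L pts)) d r δ := by
  have hmin : ∀ c ∈ codeOf (parityMatrix R δ d L pts), c ≠ 0 → d ≤ hammingNorm c :=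
    fun c hc hne => le_hammingNorm_of_mem (by omega) (by omega) (by omega) hd₂ hinj hpair htri hc hne
  refine ⟨⟨?_, ?_⟩, hasAllSymbolLocality_parityMatrix (by omega) (by omega) hinj hR, ?_⟩
  · obtain ⟨c, hc, hne, hle⟩ := hword
    exact ⟨c, hc, hne, le_antisymm hle (hmin c hc hne)⟩
  · rintro w ⟨c, hc, hne, rfl⟩
    exact hmin c hc hne
  · have hk := finrank_codeOf_parityMatrix (F := F) (R := R) (δ := δ) (d := d) (L := L) (pts := pts)
      (by omega) (by omega) (by omega) (by omega) (by omega) hinj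
    set k := Module.finrank F (codeOf (parityMatrix R δ d L pts)) with hkdef
    have hr0 : (0 : ℚ) < r := by exact_mod_cast (by omega : 0 < r)
    have hRz : (R : ℤ) = r + δ - 1 := by omega
    have hkz : (k : ℤ) = L * r - (d - δ) := by
      have : ((L * (δ - 1) + (d - δ) + k : ℕ) : ℤ) = ((L * R : ℕ) : ℤ) := by exact_mod_cast hk
      push_cast [Nat.cast_sub (show 1 ≤ δ by omega), Nat.cast_sub (show δ ≤ d by omega)] at this
      rw [hRz] at this
      linarith
    have hkq : (k : ℚ) = L * r - (d - δ) := by exact_mod_cast hkz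
    have hnz : ((L * R : ℕ) : ℤ) = L * (r + δ - 1) := by rw [Nat.cast_mul, hRz]
    split_ifs with h
    · have hc : ⌈(k : ℚ) / (r : ℚ)⌉ = (L : ℤ) - 1 := by
        have hdq : (d : ℚ) = r + δ := by exact_mod_cast h.1
        have : (k : ℚ) / (r : ℚ) = ((L - 1 : ℤ) : ℚ) := by
          rw [div_eq_iff hr0.ne', hkq, hdq]; push_cast; ring
        rw [this, Int.ceil_intCast]
      have hdz : (d : ℤ) = r + δ := by exact_mod_cast h.1
      rw [hc, hkz, hnz, hdz]
      ring
    · have hlt : d < r + δ := lt_of_le_of_ne hr fun he => h ⟨he, by rw [← hR]; exact dvd_mul_left _ _⟩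
      have hc : ⌈(k : ℚ) / (r : ℚ)⌉ = (L : ℤ) := by
        rw [Int.ceil_eq_iff]
        have h1 : (d : ℚ) < r + δ := by exact_mod_cast hlt
        have h2 : (δ : ℚ) < d := by exact_mod_cast (by omega : δ < d)
        constructor
        · rw [lt_div_iff₀ hr0, hkq]; push_cast; linarith
        · rw [div_le_iff₀ hr0, hkq]; push_cast; linarith
      rw [hc, hkz, hnz]
      ring

/-- A dependence between the points of the last two blocks gives a codeword. -/
theorem exists_codeword_of_last_blocks {N : ℕ} (hδ : δ ≤ d) (hd : 2 ≤ d) (hR : 0 < R)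
    (y c : ℕ → F)
    (hpts : ∀ k < 2 * R, pts ((N * R + k) / R) ((N * R + k) % R) = y k)
    (hloc : ∀ a < δ - 1, ∑ j ∈ Finset.range R, c j * y j ^ a = 0)
    (hglob : ∀ a < d - 1, ∑ j ∈ Finset.range (2 * R), c j * y j ^ a = 0)
    (hle : ((Finset.range (2 * R)).filter fun j => c j ≠ 0).card ≤ d)
    (hne : 1 ≤ ((Finset.range (2 * R)).filter fun j => c j ≠ 0).card) :
    ∃ v ∈ codeOf (parityMatrix R δ d (N + 2) pts), v ≠ 0 ∧ hammingNorm v ≤ d := by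
  -- The dependence is extended by zero to the first `N` blocks.
  set w : ℕ → F := fun j => if N * R ≤ j then c (j - N * R) else 0 with hw
  have hNR : (N + 2) * R = N * R + 2 * R := by ring
  have hw0 : ∀ j < N * R, w j = 0 := fun j hj => if_neg (by omega)
  have hw1 : ∀ k, w (N * R + k) = c k := fun k => by simp [hw]
  have hsum : ∀ (P : ℕ → Prop) [DecidablePred P] (a : ℕ),
      ∑ j : Fin ((N + 2) * R), (if P ((j : ℕ) / R) then
        w j * pts ((j : ℕ) / R) ((j : ℕ) % R) ^ a else 0) =
      ∑ k ∈ Finset.range (2 * R), if P (N + k / R) then c k * y k ^ a else 0 := by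
    intro P _ a
    rw [Fin.sum_univ_eq_sum_range (fun j => if P (j / R) then w j * pts (j / R) (j % R) ^ a else 0),
      hNR, Finset.sum_range_add, Finset.sum_eq_zero, zero_add]
    · refine Finset.sum_congr rfl fun k hk => ?_
      rw [hw1, hpts k (Finset.mem_range.1 hk), add_comm (N * R), Nat.add_mul_div_right _ _ hR,
        add_comm]
    · intro j hj
      rw [hw0 j (Finset.mem_range.1 hj)]; simp
  have hglob' : ∀ a < d - 1, ∑ j : Fin ((N + 2) * R),
      w j * pts ((j : ℕ) / R) ((j : ℕ) % R) ^ a = 0 := fun a ha => by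
    have := hsum (fun _ => True) a
    simp only [if_true] at this
    rw [this, hglob a ha]
  have hdiv : ∀ k ∈ Finset.range (2 * R), k / R = 0 ↔ k < R := fun k _ => by
    rw [Nat.div_eq_zero_iff]; omega
  have hfst : ∀ a < δ - 1,
      ∑ k ∈ Finset.range (2 * R), (if N + k / R = N then c k * y k ^ a else 0) = 0 := by
    intro a ha
    refine Eq.trans ?_ (hloc a ha)
    rw [two_mul, Finset.sum_range_add]
    rw [Finset.sum_congr rfl (g := fun k => c k * y k ^ a), add_eq_left]
    · refine Finset.sum_eq_zero fun k _ => ?_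
      rw [if_neg]
      rw [Nat.add_div_left _ hR]
      generalize k / R = i
      omega
    · intro k hk
      rw [if_pos]
      rw [Nat.div_eq_of_lt (Finset.mem_range.1 hk), add_zero]
  refine ⟨fun j => w j, (mem_codeOf_parityMatrix hδ hd _).2 ⟨fun b hb a ha => ?_, hglob'⟩, ?_, ?_⟩
  · rw [blockCols, Finset.sum_filter, hsum (fun b' => b' = b) a]
    rcases lt_trichotomy b N with h | rfl | h
    · exact Finset.sum_eq_zero fun k _ => if_neg (by generalize k / R = i; omega)
    · exact hfst a ha
    -- The checks of the last block need no hypothesis of their own: they are common checks minus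
    -- the checks of block `N`.
    · have hb : b = N + 1 := by omega
      have h1 := hglob a (by omega)
      have h2 := hfst a ha
      refine Eq.trans ?_ h1
      calc _ = (∑ k ∈ Finset.range (2 * R), if N + k / R = N then c k * y k ^ a else 0) +
            ∑ k ∈ Finset.range (2 * R), (if N + k / R = b then c k * y k ^ a else 0) := by
              rw [h2, zero_add]
        _ = _ := by
          rw [← Finset.sum_add_distrib]
          refine Finset.sum_congr rfl fun k hk => ?_
          have hk2 : k / R < 2 := Nat.div_lt_of_lt_mul (by
            have := Finset.mem_range.1 hk; linarith)
          generalize k / R = i at hk2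
          interval_cases i
          · rw [if_pos (by omega), if_neg (by omega), add_zero]
          · rw [if_neg (by omega), if_pos (by omega), zero_add]
  · obtain ⟨k, hk⟩ := Finset.card_pos.1 hne
    rw [Finset.mem_filter, Finset.mem_range] at hk
    intro h0
    have := congrFun h0 ⟨N * R + k, by omega⟩
    simp only [hw1] at this
    exact hk.2 this
  · refine le_trans ?_ hle
    rw [hammingNorm]
    refine Finset.card_le_card_of_injOn (fun j => (j : ℕ) - N * R) ?_ ?_
    · intro j hj
      simp only [Finset.coe_filter, Finset.mem_univ, true_and, Set.mem_ofPred_eq] at hj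
      have hjN : N * R ≤ (j : ℕ) := by
        by_contra hlt
        exact hj (hw0 j (by omega))
      have := j.2
      simp only [Finset.coe_filter, Finset.mem_range, Set.mem_ofPred_eq]
      refine ⟨by omega, ?_⟩
      rw [← hw1]
      rwa [Nat.add_sub_cancel' hjN]
    · intro j hj j' hj' h
      simp only [Finset.coe_filter, Finset.mem_univ, true_and, Set.mem_ofPred_eq] at hj hj'
      have h1 : N * R ≤ (j : ℕ) := by
        by_contra hlt
        exact hj (hw0 j (by omega))
      have h2 : N * R ≤ (j' : ℕ) := by
        by_contra hlt
        exact hj' (hw0 j' (by omega))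
      ext
      simp only at h
      omega

end Optimal

/-! ### Two blocks with a codeword of weight `d` -/

section Special

variable {F : Type*} [Field F]

theorem eval_nodal_id_of_mem {S : Finset F} {x : F} (hx : x ∈ S) :
    (Lagrange.nodal S id).eval x = 0 :=
  Lagrange.eval_nodal_at_node (v := (id : F → F)) hx

/-- Among sufficiently many `w`-sets two have vanishing polynomials differing by a constant. -/
theorem exists_nodal_sub_eq_C [Fintype F] (X : Finset F) (w : ℕ) (hw : 1 ≤ w)
    (hX : Fintype.card F ^ (w - 1) < X.card.choose w) :
    ∃ S ⊆ X, ∃ T ⊆ X, S.card = w ∧ T.card = w ∧ ∃ e : F, e ≠ 0 ∧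
      Lagrange.nodal S id = Lagrange.nodal T id + C e := by
  -- The polynomials are monic of degree `w`. Leaving out the constant term, `w - 1` coefficients
  -- remain, so there are `q ^ (w - 1)` pigeonholes.
  obtain ⟨S, hS, T, hT, hne, heq⟩ := Finset.exists_ne_map_eq_of_card_lt_of_maps_to
    (s := X.powersetCard w) (t := (Finset.univ : Finset (Fin (w - 1) → F)))
    (f := fun S i => (Lagrange.nodal S id).coeff (i + 1 : ℕ))
    (by rw [Finset.card_powersetCard, Finset.card_univ, Fintype.card_fun, Fintype.card_fin]; exact hX)
    (fun _ _ => Finset.mem_coe.2 (Finset.mem_univ _))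
  rw [Finset.mem_powersetCard] at hS hT
  have hC : Lagrange.nodal S id - Lagrange.nodal T id =
      C ((Lagrange.nodal S id - Lagrange.nodal T id).coeff 0) := by
    refine Polynomial.ext fun n => ?_
    rw [coeff_C]
    split_ifs with hn
    · rw [hn]
    · rw [coeff_sub, sub_eq_zero]
      rcases lt_trichotomy n w with h | h | h
      · have := congrFun heq ⟨n - 1, by omega⟩
        simp only at this
        rwa [Nat.sub_add_cancel (by omega)] at this
      · have h1 : (Lagrange.nodal S (id : F → F)).coeff n = 1 := by
          have := Lagrange.nodal_monic (s := S) (v := (id : F → F))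
          rwa [Monic, leadingCoeff, Lagrange.natDegree_nodal, hS.2, ← h] at this
        have h2 : (Lagrange.nodal T (id : F → F)).coeff n = 1 := by
          have := Lagrange.nodal_monic (s := T) (v := (id : F → F))
          rwa [Monic, leadingCoeff, Lagrange.natDegree_nodal, hT.2, ← h] at this
        rw [h1, h2]
      · rw [coeff_eq_zero_of_natDegree_lt, coeff_eq_zero_of_natDegree_lt]
        · rw [Lagrange.natDegree_nodal]; omega
        · rw [Lagrange.natDegree_nodal]; omega
  set e := (Lagrange.nodal S id - Lagrange.nodal T id).coeff 0 with he
  refine ⟨S, hS.1, T, hT.1, hS.2, hT.2, e, ?_, by rw [← hC]; ring⟩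
  intro he0
  rw [he0, C_0, sub_eq_zero] at hC
  apply hne
  ext x
  have hroot : ∀ U : Finset F, x ∈ U ↔ (Lagrange.nodal U (id : F → F)).eval x = 0 := by
    intro U
    rw [Lagrange.eval_nodal, Finset.prod_eq_zero_iff]
    simp [sub_eq_zero]
  rw [hroot S, hroot T, hC]

/-- By Lagrange interpolation the sum is the coefficient of `p` in degree `S.card - 1`. -/
theorem sum_nodalWeight_eq_zero [DecidableEq F] (S : Finset F) (p : F[X]) (hp : p.natDegree + 1 < S.card) :
    ∑ x ∈ S, p.eval x / ∏ y ∈ S.erase x, (x - y) = 0 := by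
  have h := Lagrange.coeff_eq_sum (s := S) (v := (id : F → F)) Function.injective_id.injOn (P := p)
    (degree_le_natDegree.trans_lt (by exact_mod_cast (by omega : p.natDegree < S.card)))
  simp only [id] at h
  rw [← h]
  exact coeff_eq_zero_of_natDegree_lt (by omega)

/-- Divide `p` by the vanishing polynomial of `S`, with quotient `h` and remainder `ρ`. On `S` one
has `p = ρ`, and on `T` one has `p = ρ + e h`. As `h` has degree below `S.card - 1`, both
interpolants have the same coefficient in degree `S.card - 1`, and these coefficients are the two
sums. -/
theorem sum_nodalWeight_eq [DecidableEq F] (S T : Finset F) (hST : S.card = T.card) (hS2 : 2 ≤ S.card) (e : F)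
    (he : Lagrange.nodal S id = Lagrange.nodal T id + C e) (p : F[X])
    (hp : p.natDegree + 1 < 2 * S.card) :
    ∑ x ∈ S, p.eval x / ∏ y ∈ S.erase x, (x - y) =
      ∑ x ∈ T, p.eval x / ∏ y ∈ T.erase x, (x - y) := by
  set ω := Lagrange.nodal S (id : F → F) with hω
  have hmon : ω.Monic := Lagrange.nodal_monic
  have hdeg : ω.natDegree = S.card := Lagrange.natDegree_nodal
  have hmod : (p %ₘ ω).degree < S.card := by
    rw [← hdeg, ← degree_eq_natDegree hmon.ne_zero]
    exact degree_modByMonic_lt _ hmon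
  have hdiv : (p /ₘ ω).natDegree + 1 < S.card := by
    rw [natDegree_divByMonic _ hmon, hdeg]; omega
  have hdec : ∀ x, p.eval x = (p %ₘ ω).eval x + ω.eval x * (p /ₘ ω).eval x := fun x => by
    conv_lhs => rw [← modByMonic_add_div p ω]
    rw [eval_add, eval_mul]
  have hS : ∀ x ∈ S, p.eval x = (p %ₘ ω).eval x := fun x hx => by
    rw [hdec, hω, eval_nodal_id_of_mem hx, zero_mul, add_zero]
  have hT : ∀ x ∈ T, p.eval x = (p %ₘ ω + C e * (p /ₘ ω)).eval x := fun x hx => by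
    rw [hdec, eval_add, eval_mul, eval_C, he, eval_add (p := Lagrange.nodal T id),
      eval_nodal_id_of_mem hx, eval_C, zero_add]
  have hCe : (C e * (p /ₘ ω)).natDegree + 1 < S.card :=
    (Nat.add_le_add_right (natDegree_C_mul_le _ _) 1).trans_lt hdiv
  have hCe' : (C e * (p /ₘ ω)).degree < S.card :=
    degree_le_natDegree.trans_lt (by exact_mod_cast (by omega))
  have h1 := Lagrange.coeff_eq_sum (s := S) (v := (id : F → F)) Function.injective_id.injOn hmod
  have h2 := Lagrange.coeff_eq_sum (s := T) (v := (id : F → F)) Function.injective_id.injOn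
    (P := p %ₘ ω + C e * (p /ₘ ω)) (by
      rw [← hST]; exact (degree_add_le _ _).trans_lt (max_lt hmod hCe'))
  simp only [id] at h1 h2
  rw [Finset.sum_congr rfl fun x hx => by rw [hS x hx], ← h1,
    Finset.sum_congr rfl fun x hx => by rw [hT x hx], ← h2, coeff_add, ← hST,
    coeff_eq_zero_of_natDegree_lt (p := C e * (p /ₘ ω)) (by omega), add_zero]

/-- The word takes the values of a polynomial `κ` times the Lagrange weights of `S`, and minus those
of `T`. The block `S` then satisfies its local checks alone, and the two contributions to each
common check cancel. -/
theorem exists_special_blocks [DecidableEq F] [Fintype F] {δ d R : ℕ} (hδ : 1 ≤ δ) (hd : 2 * δ + 1 ≤ d) (hR : d ≤ R + 1)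
    (Y : Finset F) (hY : 2 * R ≤ Y.card)
    (hY' : Fintype.card F ^ (d - δ - 1) < Y.card.choose (d - δ)) :
    ∃ y c : ℕ → F, (∀ j < 2 * R, y j ∈ Y) ∧
      (∀ j < 2 * R, ∀ k < 2 * R, y j = y k → j = k) ∧
      (∀ a < δ - 1, ∑ j ∈ Finset.range R, c j * y j ^ a = 0) ∧
      (∀ a < d - 1, ∑ j ∈ Finset.range (2 * R), c j * y j ^ a = 0) ∧
      ((Finset.range (2 * R)).filter fun j => c j ≠ 0).card ≤ d ∧
      1 ≤ ((Finset.range (2 * R)).filter fun j => c j ≠ 0).card := by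
  obtain ⟨S, hSX, T, hTX, hS, hT, e, he0, he⟩ := exists_nodal_sub_eq_C Y (d - δ) (by omega) hY'
  have hdisj : Disjoint S T := by
    rw [Finset.disjoint_left]
    intro x hxS hxT
    have := congrArg (eval x) he
    rw [eval_add, eval_nodal_id_of_mem hxS,
      eval_nodal_id_of_mem hxT, eval_C, zero_add] at this
    exact he0 this.symm
  -- The zeros `K` of `κ` reduce the support to `S \ K`, of size `δ`, together with `T`, of size `d
  -- - δ`. Degree `d - 2 * δ` is also small enough for the exponents `a < δ - 1` on `S` and `a < d -
  -- 1` on both sets.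
  obtain ⟨K, hKS, hK⟩ := Finset.exists_subset_card_eq (s := S) (n := d - 2 * δ) (by omega)
  set κ := Lagrange.nodal K (id : F → F) with hκ
  have hκd : κ.natDegree = d - 2 * δ := by rw [hκ, Lagrange.natDegree_nodal, hK]
  -- the word supported on `(S \ K) ∪ T`
  set g : F → F := fun x => if x ∈ S then κ.eval x / ∏ y ∈ S.erase x, (x - y)
    else if x ∈ T then - (κ.eval x / ∏ y ∈ T.erase x, (x - y)) else 0 with hg
  have hgS : ∀ x ∈ S, g x = κ.eval x / ∏ y ∈ S.erase x, (x - y) := fun x hx => if_pos hx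
  have hgT : ∀ x ∈ T, g x = - (κ.eval x / ∏ y ∈ T.erase x, (x - y)) := fun x hx => by
    rw [hg]; simp only; rw [if_neg (Finset.disjoint_right.1 hdisj hx), if_pos hx]
  have hg0 : ∀ x, x ∉ S → x ∉ T → g x = 0 := fun x h1 h2 => by
    rw [hg]; simp only; rw [if_neg h1, if_neg h2]
  have hXdeg : ∀ a, (κ * X ^ a : F[X]).natDegree ≤ d - 2 * δ + a := fun a => by
    refine natDegree_mul_le.trans ?_
    rw [hκd, natDegree_X_pow]
  have hsumS : ∀ a, ∑ x ∈ S, g x * x ^ a =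
      ∑ x ∈ S, (κ * X ^ a : F[X]).eval x / ∏ y ∈ S.erase x, (x - y) := fun a => by
    refine Finset.sum_congr rfl fun x hx => ?_
    rw [hgS x hx, eval_mul, eval_pow, eval_X]; ring
  have hsumT : ∀ a, ∑ x ∈ T, g x * x ^ a =
      - ∑ x ∈ T, (κ * X ^ a : F[X]).eval x / ∏ y ∈ T.erase x, (x - y) := fun a => by
    rw [← Finset.sum_neg_distrib]
    refine Finset.sum_congr rfl fun x hx => ?_
    rw [hgT x hx, eval_mul, eval_pow, eval_X]; ring
  have hlocS : ∀ a < δ - 1, ∑ x ∈ S, g x * x ^ a = 0 := fun a ha => by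
    rw [hsumS, sum_nodalWeight_eq_zero]
    have := hXdeg a
    omega
  have hglobST : ∀ a < d - 1, ∑ x ∈ S, g x * x ^ a + ∑ x ∈ T, g x * x ^ a = 0 := fun a ha => by
    rw [hsumS, hsumT, sum_nodalWeight_eq S T (by omega) (by omega) e he, add_neg_cancel]
    have := hXdeg a
    omega
  -- the two blocks
  obtain ⟨U, hU1, hUX, hU⟩ := Finset.exists_subsuperset_card_eq (Finset.union_subset hSX hTX)
    (n := 2 * R) (by rw [Finset.card_union_of_disjoint hdisj]; omega) hY
  have hSU : S ⊆ U := Finset.subset_union_left.trans hU1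
  have hTU : T ⊆ U := Finset.subset_union_right.trans hU1
  -- Padding to full blocks: `A` contains `S` and avoids `T`, so its complement in `U` is the block
  -- containing `T`.
  obtain ⟨A, hSA, hAU, hA⟩ := Finset.exists_subsuperset_card_eq (s := S) (t := U \ T) (n := R)
    (fun x hx => Finset.mem_sdiff.2 ⟨hSU hx, Finset.disjoint_left.1 hdisj hx⟩) (by omega)
    (by rw [Finset.card_sdiff_of_subset hTU]; omega)
  have hAU' : A ⊆ U := hAU.trans Finset.sdiff_subset
  have hTB : T ⊆ U \ A := fun x hx => Finset.mem_sdiff.2 ⟨hTU hx, fun hxA =>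
    (Finset.mem_sdiff.1 (hAU hxA)).2 hx⟩
  have hB : (U \ A).card = R := by rw [Finset.card_sdiff_of_subset hAU']; omega
  set eA := A.equivFinOfCardEq hA
  set eB := (U \ A).equivFinOfCardEq hB
  set y : ℕ → F := fun j => if h : j < R then eA.symm ⟨j, h⟩ else
    if h : j - R < R then eB.symm ⟨j - R, h⟩ else 0 with hy
  have hyA : ∀ j (h : j < R), y j = eA.symm ⟨j, h⟩ := fun j h => dif_pos h
  have hyB : ∀ j (h : j < R), y (R + j) = eB.symm ⟨j, h⟩ := fun j h => by
    have h1 : R + j - R = j := by omega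
    simp only [hy, h1, h, dif_pos]
    rw [dif_neg (by omega)]
  have hyA' : ∀ j < R, y j ∈ A := fun j h => by rw [hyA j h]; exact (eA.symm _).2
  have hyB' : ∀ j < R, y (R + j) ∈ U \ A := fun j h => by rw [hyB j h]; exact (eB.symm _).2
  have hyB'' : ∀ j < 2 * R, R ≤ j → y j ∈ U \ A := fun j h h' => by
    have := hyB' (j - R) (by omega)
    rwa [Nat.add_sub_cancel' h'] at this
  have hyU : ∀ j < 2 * R, y j ∈ U := fun j h => by
    rcases lt_or_ge j R with h' | h'
    · exact hAU' (hyA' j h')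
    · exact (Finset.mem_sdiff.1 (hyB'' j h h')).1
  have hyinj : ∀ j < 2 * R, ∀ k < 2 * R, y j = y k → j = k := by
    intro j hj k hk h
    rcases lt_or_ge j R with h1 | h1 <;> rcases lt_or_ge k R with h2 | h2
    · rw [hyA j h1, hyA k h2] at h
      simpa using eA.symm.injective (Subtype.ext h)
    · exact absurd (h ▸ hyA' j h1) (Finset.mem_sdiff.1 (hyB'' k hk h2)).2
    · exact absurd (h ▸ hyA' k h2) (Finset.mem_sdiff.1 (hyB'' j hj h1)).2
    · obtain ⟨j, rfl⟩ := Nat.exists_eq_add_of_le h1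
      obtain ⟨k, rfl⟩ := Nat.exists_eq_add_of_le h2
      rw [hyB j (by omega), hyB k (by omega)] at h
      simpa using eB.symm.injective (Subtype.ext h)
  have hsumA : ∀ f : F → F, ∑ j ∈ Finset.range R, f (y j) = ∑ x ∈ A, f x := fun f => by
    rw [Finset.sum_range, ← Finset.sum_coe_sort A, ← Equiv.sum_comp eA.symm]
    exact Finset.sum_congr rfl fun j _ => by rw [hyA j j.2]
  have hsumB : ∀ f : F → F, ∑ j ∈ Finset.range R, f (y (R + j)) = ∑ x ∈ U \ A, f x := fun f => by
    rw [Finset.sum_range, ← Finset.sum_coe_sort (U \ A), ← Equiv.sum_comp eB.symm]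
    exact Finset.sum_congr rfl fun j _ => by rw [hyB j j.2]
  have hAS : ∀ a, ∑ x ∈ A, g x * x ^ a = ∑ x ∈ S, g x * x ^ a := fun a => by
    refine (Finset.sum_subset hSA fun x hx hxS => ?_).symm
    rw [hg0 x hxS (Finset.mem_sdiff.1 (hAU hx)).2, zero_mul]
  have hBT : ∀ a, ∑ x ∈ U \ A, g x * x ^ a = ∑ x ∈ T, g x * x ^ a := fun a => by
    refine (Finset.sum_subset hTB fun x hx hxT => ?_).symm
    rw [hg0 x (fun hxS => (Finset.mem_sdiff.1 hx).2 (hSA hxS)) hxT, zero_mul]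
  refine ⟨y, fun j => g (y j), fun j hj => hUX (hyU j hj), hyinj, ?_, ?_, ?_, ?_⟩
  · intro a ha
    rw [hsumA (fun x => g x * x ^ a), hAS, hlocS a ha]
  · intro a ha
    rw [two_mul, Finset.sum_range_add, hsumA (fun x => g x * x ^ a),
      hsumB (fun x => g x * x ^ a), hAS, hBT, hglobST a ha]
  · calc _ ≤ ((S \ K) ∪ T).card := by
          refine Finset.card_le_card_of_injOn y ?_ ?_
          · intro j hj
            simp only [Finset.coe_filter, Finset.mem_range, Set.mem_ofPred_eq] at hj
            rw [Finset.mem_coe, Finset.mem_union, Finset.mem_sdiff]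
            by_contra hcon
            push Not at hcon
            by_cases hjS : y j ∈ S
            · refine hj.2 ?_
              rw [hgS _ hjS, hκ, eval_nodal_id_of_mem (hcon.1 hjS),
                zero_div]
            · exact hj.2 (hg0 _ hjS hcon.2)
          · intro j hj k hk h
            simp only [Finset.coe_filter, Finset.mem_range, Set.mem_ofPred_eq] at hj hk
            exact hyinj j hj.1 k hk.1 h
      _ ≤ (S \ K).card + T.card := Finset.card_union_le _ _
      _ ≤ d := by rw [Finset.card_sdiff_of_subset hKS]; omega
  · obtain ⟨x, hx⟩ := Finset.card_pos.1 (by omega : 0 < T.card)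
    have hgx : g x ≠ 0 := by
      rw [hgT x hx, neg_ne_zero]
      refine div_ne_zero ?_ ?_
      · rw [hκ]
        refine Lagrange.eval_nodal_not_at_node fun i hi h => ?_
        have h : x = i := h
        exact Finset.disjoint_left.1 hdisj (hKS hi) (h ▸ hx)
      · rw [Finset.prod_ne_zero_iff]
        intro i hi
        rw [sub_ne_zero]
        exact (Finset.mem_erase.1 hi).1.symm
    have hi := (eB ⟨x, hTB hx⟩).2
    refine Finset.card_pos.2 ⟨R + (eB ⟨x, hTB hx⟩ : ℕ), ?_⟩
    rw [Finset.mem_filter, Finset.mem_range]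
    refine ⟨by omega, ?_⟩
    simp only [hyB _ hi]
    simpa using hgx

end Special

/-! ### Digits and a Behrend-type set -/

/-- The `i`-th digit of `e` in base `b`. -/
def digit (b i e : ℕ) : ℕ := e / b ^ i % b

theorem digit_lt {b : ℕ} (hb : 0 < b) (i e : ℕ) : digit b i e < b := Nat.mod_lt _ hb

theorem eq_of_digit_eq {b k e e' : ℕ} (he : e < b ^ k) (he' : e' < b ^ k)
    (h : ∀ i < k, digit b i e = digit b i e') : e = e' := by
  have : finFunctionFinEquiv.symm (⟨e, he⟩ : Fin (b ^ k)) =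
      finFunctionFinEquiv.symm (⟨e', he'⟩ : Fin (b ^ k)) := by
    funext i
    ext
    exact h i i.2
  simpa using finFunctionFinEquiv.symm.injective this

theorem exists_digit_eq {b k : ℕ} (v : ℕ → ℕ) (hv : ∀ i < k, v i < b) :
    ∃ e < b ^ k, ∀ i < k, digit b i e = v i := by
  let f : Fin k → Fin b := fun i => ⟨v i, hv i i.2⟩
  refine ⟨finFunctionFinEquiv f, (finFunctionFinEquiv f).2, fun i hi => ?_⟩
  have := congrFun (finFunctionFinEquiv.symm_apply_apply f) ⟨i, hi⟩
  exact congrArg Fin.val this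

/-- The digits of `β` in base `D`, read in base `W`. -/
def rebase (m D W β : ℕ) : ℕ := ∑ i ∈ Finset.range m, digit D i β * W ^ i

/-- The sum of the squares of the digits of `β` in base `D`. -/
def digitNorm (m D β : ℕ) : ℕ := ∑ i ∈ Finset.range m, digit D i β ^ 2

/-- Digit vectors in base `D` lifted to a paraboloid and read in base `W`. -/
def behrend (m D W β : ℕ) : ℕ := rebase m D W β + digitNorm m D β * W ^ m

/-- Absence of carries: the lowest coefficient is divisible by `W` and smaller than `W` in absolute
value, so it vanishes and one divides by `W`. The top coefficient `T` needs no bound. -/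
theorem eq_zero_of_sum_mul_pow_eq_zero (W : ℤ) (a : ℕ → ℤ) (T : ℤ) (m : ℕ)
    (ha : ∀ i < m, |a i| < W)
    (h : ∑ i ∈ Finset.range m, a i * W ^ i + T * W ^ m = 0) : (∀ i < m, a i = 0) ∧ T = 0 := by
  induction m generalizing a with
  | zero => simpa using h
  | succ m ih =>
    have hW : 0 < W := (abs_nonneg _).trans_lt (ha 0 (by omega))
    have e : ∑ i ∈ Finset.range (m + 1), a i * W ^ i + T * W ^ (m + 1) =
        a 0 + W * (∑ i ∈ Finset.range m, a (i + 1) * W ^ i + T * W ^ m) := by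
      rw [Finset.sum_range_succ', mul_add, Finset.mul_sum]
      have : ∀ i ∈ Finset.range m, a (i + 1) * W ^ (i + 1) = W * (a (i + 1) * W ^ i) :=
        fun i _ => by ring
      rw [Finset.sum_congr rfl this]
      ring
    rw [e] at h
    have h0 : a 0 = 0 := Int.eq_zero_of_abs_lt_dvd
      (Dvd.intro (-(∑ i ∈ Finset.range m, a (i + 1) * W ^ i + T * W ^ m)) (by linarith))
      (ha 0 (by omega))
    rw [h0, zero_add] at h
    have h1 := (mul_eq_zero.1 h).resolve_left hW.ne'
    obtain ⟨h2, h3⟩ := ih (fun i => a (i + 1)) (fun i hi => ha _ (by omega)) h1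
    refine ⟨fun i hi => ?_, h3⟩
    rcases i with _ | i
    · exact h0
    · exact h2 i (by omega)

/-- On the Behrend-type set, a relation `A (b₁ - b₃) = B (b₂ - b₃)` forces `b₁ = b₂`. -/
theorem eq_of_mul_behrend_sub_eq {m D W Λ β₁ β₂ β₃ : ℕ} (hD : 0 < D) (hΛ : 0 < Λ)
    (hW : 2 * Λ * D ≤ W) (h₁ : β₁ < D ^ m) (h₂ : β₂ < D ^ m) {A B : ℤ} (hA0 : A ≠ 0)
    (hB0 : B ≠ 0) (hA : |A| ≤ Λ) (hB : |B| ≤ Λ)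
    (h : A * ((behrend m D W β₁ : ℤ) - behrend m D W β₃) =
      B * ((behrend m D W β₂ : ℤ) - behrend m D W β₃)) : β₁ = β₂ := by
  set x : ℕ → ℕ → ℤ := fun β i => (digit D i β : ℤ) with hx
  have hxb : ∀ β β' i, |x β i - x β' i| ≤ D - 1 := fun β β' i => by
    have h1 := digit_lt hD i β
    have h2 := digit_lt hD i β'
    rw [abs_le]
    simp only [hx]
    omega
  have hb : ∀ β, (behrend m D W β : ℤ) =
      ∑ i ∈ Finset.range m, x β i * (W : ℤ) ^ i + (digitNorm m D β : ℤ) * (W : ℤ) ^ m := fun β => by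
    simp [behrend, rebase, hx]
  have hn : ∀ β, (digitNorm m D β : ℤ) = ∑ i ∈ Finset.range m, x β i ^ 2 := fun β => by
    simp [digitNorm, hx]
  -- The coefficients are at most `2 Λ (D - 1) < W` in absolute value, so the relation holds digit
  -- by digit and also for the sums of squares.
  obtain ⟨k1, k2⟩ := eq_zero_of_sum_mul_pow_eq_zero W
    (fun i => A * (x β₁ i - x β₃ i) - B * (x β₂ i - x β₃ i))
    (A * ((digitNorm m D β₁ : ℤ) - digitNorm m D β₃) -
      B * ((digitNorm m D β₂ : ℤ) - digitNorm m D β₃)) m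
    (fun i _ => by
      have e1 : |A * (x β₁ i - x β₃ i)| ≤ Λ * (D - 1) := by
        rw [abs_mul]
        exact mul_le_mul hA (hxb _ _ _) (abs_nonneg _) (by positivity)
      have e2 : |B * (x β₂ i - x β₃ i)| ≤ Λ * (D - 1) := by
        rw [abs_mul]
        exact mul_le_mul hB (hxb _ _ _) (abs_nonneg _) (by positivity)
      have e3 := abs_sub (A * (x β₁ i - x β₃ i)) (B * (x β₂ i - x β₃ i))
      have e4 : (2 * Λ * D : ℤ) ≤ W := by exact_mod_cast hW
      have e5 : (0 : ℤ) < Λ := by exact_mod_cast hΛ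
      linarith)
    (by
      rw [hb, hb, hb] at h
      have : ∑ i ∈ Finset.range m, (A * (x β₁ i - x β₃ i) - B * (x β₂ i - x β₃ i)) * (W : ℤ) ^ i =
          A * (∑ i ∈ Finset.range m, x β₁ i * (W : ℤ) ^ i - ∑ i ∈ Finset.range m, x β₃ i * (W : ℤ) ^ i)
          - B * (∑ i ∈ Finset.range m, x β₂ i * (W : ℤ) ^ i -
            ∑ i ∈ Finset.range m, x β₃ i * (W : ℤ) ^ i) := by
        rw [← Finset.sum_sub_distrib, ← Finset.sum_sub_distrib, Finset.mul_sum, Finset.mul_sum,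
          ← Finset.sum_sub_distrib]
        exact Finset.sum_congr rfl fun i _ => by ring
      rw [this]
      linear_combination h)
  -- Write `u`, `v` for the digit vectors of `β₁`, `β₂` minus that of `β₃`. Removing the linear part
  -- from the relation between norms leaves `A |u|² = B |v|²`. Multiplying by `A` and using `A u = B
  -- v` gives `(A - B) B |v|² = 0`: either `A = B`, so `u = v`, or `v = 0`, so `u = 0` as well.
  have hsq : (A - B) * B * ∑ i ∈ Finset.range m, (x β₂ i - x β₃ i) ^ 2 = 0 := by
    have e1 : ∀ β, (digitNorm m D β : ℤ) - digitNorm m D β₃ =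
        ∑ i ∈ Finset.range m, ((x β i - x β₃ i) ^ 2 + 2 * (x β i - x β₃ i) * x β₃ i) := fun β => by
      rw [hn, hn, ← Finset.sum_sub_distrib]
      exact Finset.sum_congr rfl fun i _ => by ring
    rw [e1, e1, Finset.mul_sum, Finset.mul_sum, ← Finset.sum_sub_distrib] at k2
    rw [Finset.mul_sum]
    have : ∀ i ∈ Finset.range m, (A - B) * B * (x β₂ i - x β₃ i) ^ 2 = -(A *
        (A * ((x β₁ i - x β₃ i) ^ 2 + 2 * (x β₁ i - x β₃ i) * x β₃ i) -
          B * ((x β₂ i - x β₃ i) ^ 2 + 2 * (x β₂ i - x β₃ i) * x β₃ i))) := fun i hi => by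
      have := k1 i (Finset.mem_range.1 hi)
      linear_combination (A * (x β₁ i - x β₃ i) + B * (x β₂ i - x β₃ i) + 2 * A * x β₃ i) * this
    rw [Finset.sum_congr rfl this, Finset.sum_neg_distrib, ← Finset.mul_sum, k2, mul_zero, neg_zero]
  refine eq_of_digit_eq h₁ h₂ fun i hi => ?_
  have hki := k1 i hi
  have hgoal : x β₁ i = x β₂ i := by
    rcases mul_eq_zero.1 hsq with h0 | h0
    · have hAB : A = B := sub_eq_zero.1 ((mul_eq_zero.1 h0).resolve_right hB0)
      rw [hAB, ← mul_sub, mul_eq_zero] at hki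
      have := hki.resolve_left hB0
      linarith
    · have h1 := (Finset.sum_eq_zero_iff_of_nonneg fun i _ => sq_nonneg _).1 h0 i
        (Finset.mem_range.2 hi)
      have h2 : x β₂ i - x β₃ i = 0 := pow_eq_zero_iff (two_ne_zero) |>.1 h1
      rw [h2, mul_zero, sub_zero, mul_eq_zero] at hki
      have := hki.resolve_left hA0
      linarith
  simp only [hx] at hgoal
  exact_mod_cast hgoal

theorem sum_digits_lt_pow {W : ℕ} (a : ℕ → ℕ) (m : ℕ) (ha : ∀ i < m, a i < W) :
    ∑ i ∈ Finset.range m, a i * W ^ i < W ^ m := by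
  induction m with
  | zero => simp
  | succ m ih =>
    rw [Finset.sum_range_succ]
    have h1 := ih fun i hi => ha i (by omega)
    have h2 : (a m + 1) * W ^ m ≤ W * W ^ m := Nat.mul_le_mul_right _ (ha m (by omega))
    rw [pow_succ']
    linarith

theorem rebase_lt {m D W : ℕ} (hD : 0 < D) (hDW : D ≤ W) (β : ℕ) : rebase m D W β < W ^ m :=
  sum_digits_lt_pow _ _ fun i _ => (digit_lt hD i β).trans_le hDW

theorem digitNorm_le {m D : ℕ} (hD : 0 < D) (hm : m ≤ D) (β : ℕ) : digitNorm m D β ≤ D ^ 3 := by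
  calc digitNorm m D β ≤ ∑ _i ∈ Finset.range m, D ^ 2 :=
        Finset.sum_le_sum fun i _ => Nat.pow_le_pow_left (digit_lt hD i β).le 2
    _ = m * D ^ 2 := by simp
    _ ≤ D * D ^ 2 := Nat.mul_le_mul_right _ hm
    _ = D ^ 3 := by ring

/-! ### Blocks as graphs of integer polynomials -/

/-- The value at `p` of the polynomial of degree at most `t` numbered `e`. -/
def blockValue (t m D W e p : ℕ) : ℕ :=
  behrend m D W (digit (D ^ m) 0 e) * p ^ t +
    ∑ j ∈ Finset.range t, digit (D ^ m) (j + 1) e * p ^ j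

/-- The polynomial numbered `e`. -/
noncomputable def blockPoly (t m D W e : ℕ) : ℤ[X] :=
  C (behrend m D W (digit (D ^ m) 0 e) : ℤ) * X ^ t +
    ∑ j ∈ Finset.range t, C (digit (D ^ m) (j + 1) e : ℤ) * X ^ j

theorem eval_blockPoly (t m D W e p : ℕ) :
    (blockPoly t m D W e).eval (p : ℤ) = blockValue t m D W e p := by
  simp [blockPoly, blockValue, eval_finsetSum]

theorem degree_sum_lt {R : Type*} [Semiring R] (t : ℕ) (c : ℕ → R) :
    (∑ j ∈ Finset.range t, C (c j) * X ^ j).degree < (t : WithBot ℕ) := by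
  refine (degree_sum_le _ _).trans_lt ((Finset.sup_lt_iff (WithBot.bot_lt_coe _)).2 fun j hj => ?_)
  exact (degree_C_mul_X_pow_le _ _).trans_lt (by exact_mod_cast Finset.mem_range.1 hj)

theorem coeff_sum_C_mul_X_pow {R : Type*} [Semiring R] (t : ℕ) (c : ℕ → R) {j : ℕ} (hj : j < t) :
    (∑ j ∈ Finset.range t, C (c j) * X ^ j).coeff j = c j := by
  rw [finsetSum_coeff, Finset.sum_eq_single j]
  · simp
  · intro i _ hij
    rw [coeff_C_mul_X_pow, if_neg (Ne.symm hij)]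
  · intro h
    exact absurd (Finset.mem_range.2 hj) h

theorem degree_blockPoly_sub (t m D W e e' : ℕ) :
    (blockPoly t m D W e - blockPoly t m D W e' -
      C ((behrend m D W (digit (D ^ m) 0 e) : ℤ) - behrend m D W (digit (D ^ m) 0 e')) *
        X ^ t).degree < (t : WithBot ℕ) := by
  have : blockPoly t m D W e - blockPoly t m D W e' -
      C ((behrend m D W (digit (D ^ m) 0 e) : ℤ) - behrend m D W (digit (D ^ m) 0 e')) * X ^ t =
      ∑ j ∈ Finset.range t, C (digit (D ^ m) (j + 1) e : ℤ) * X ^ j -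
      ∑ j ∈ Finset.range t, C (digit (D ^ m) (j + 1) e' : ℤ) * X ^ j := by
    rw [blockPoly, blockPoly, C_sub]; ring
  rw [this]
  exact (degree_sub_le _ _).trans_lt (max_lt (degree_sum_lt _ _) (degree_sum_lt _ _))

theorem degree_blockPoly_sub_lt (t m D W e e' : ℕ) :
    (blockPoly t m D W e - blockPoly t m D W e').degree < (t + 1 : ℕ) := by
  rw [← sub_add_cancel (blockPoly t m D W e - blockPoly t m D W e')
    (C ((behrend m D W (digit (D ^ m) 0 e) : ℤ) - behrend m D W (digit (D ^ m) 0 e')) * X ^ t)]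
  refine (degree_add_le _ _).trans_lt (max_lt ((degree_blockPoly_sub ..).trans ?_) ?_)
  · exact WithBot.coe_lt_coe.2 (Nat.lt_succ_self t)
  · exact (degree_C_mul_X_pow_le _ _).trans_lt (WithBot.coe_lt_coe.2 (Nat.lt_succ_self t))

section Blocks

variable {t m D W Λ : ℕ}

theorem eq_of_blockPoly_eq (hD : 0 < D) (hΛ : 0 < Λ) (hW : 2 * Λ * D ≤ W) {e e' : ℕ}
    (he : e < (D ^ m) ^ (t + 1)) (he' : e' < (D ^ m) ^ (t + 1))
    (h : blockPoly t m D W e = blockPoly t m D W e') : e = e' := by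
  have hDm : 0 < D ^ m := pow_pos hD m
  have hlow : ∀ e, ∀ j < t, (blockPoly t m D W e).coeff j = digit (D ^ m) (j + 1) e :=
    fun e j hj => by
      rw [blockPoly, coeff_add, coeff_C_mul_X_pow, if_neg hj.ne, zero_add,
        coeff_sum_C_mul_X_pow t (fun j => (digit (D ^ m) (j + 1) e : ℤ)) hj]
  have htop : ∀ e, (blockPoly t m D W e).coeff t = behrend m D W (digit (D ^ m) 0 e) := fun e => by
    rw [blockPoly, coeff_add, coeff_C_mul_X_pow, if_pos rfl, coeff_eq_zero_of_degree_lt, add_zero]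
    exact degree_sum_lt t fun j => (digit (D ^ m) (j + 1) e : ℤ)
  refine eq_of_digit_eq he he' fun i hi => ?_
  rcases i with _ | i
  · refine eq_of_mul_behrend_sub_eq (β₃ := 0) (A := 1) (B := 1) hD hΛ hW (digit_lt hDm _ _)
      (digit_lt hDm _ _) one_ne_zero one_ne_zero (by simpa using Nat.succ_le_of_lt hΛ)
      (by simpa using Nat.succ_le_of_lt hΛ) ?_
    rw [← htop e, ← htop e', h]
  · have := hlow e i (by omega)
    rw [h, hlow e' i (by omega)] at this
    exact_mod_cast this.symm

/-- After subtracting a multiple of the monic polynomial with roots `Z`, the difference has degree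
below `t` and vanishes at `t` points. A `t`-point intersection is thus governed by the leading
coefficients alone. -/
theorem blockPoly_sub_eq (Z : Finset ℕ) (hZ : Z.card = t) {e e' : ℕ}
    (h : ∀ p ∈ Z, blockValue t m D W e p = blockValue t m D W e' p) :
    blockPoly t m D W e - blockPoly t m D W e' =
      C ((behrend m D W (digit (D ^ m) 0 e) : ℤ) - behrend m D W (digit (D ^ m) 0 e')) *
        Lagrange.nodal Z (fun p : ℕ => (p : ℤ)) := by
  set b := (behrend m D W (digit (D ^ m) 0 e) : ℤ) - behrend m D W (digit (D ^ m) 0 e')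
  have hinj : Set.InjOn (fun p : ℕ => (p : ℤ)) Z := Nat.cast_injective.injOn
  rw [← sub_eq_zero]
  refine eq_zero_of_degree_lt_of_eval_index_eq_zero (v := fun p : ℕ => (p : ℤ)) Z hinj ?_ ?_
  · rw [hZ]
    have e1 : blockPoly t m D W e - blockPoly t m D W e' -
        C b * Lagrange.nodal Z (fun p : ℕ => (p : ℤ)) =
        (blockPoly t m D W e - blockPoly t m D W e' - C b * X ^ t) +
        C b * (X ^ t - Lagrange.nodal Z (fun p : ℕ => (p : ℤ))) := by ring
    rw [e1]
    refine (degree_add_le _ _).trans_lt (max_lt (degree_blockPoly_sub ..) ?_)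
    rw [← smul_eq_C_mul]
    refine (degree_smul_le _ _).trans_lt ?_
    have := degree_sub_lt_left (p := (X : ℤ[X]) ^ t) (q := Lagrange.nodal Z (fun p : ℕ => (p : ℤ)))
      (by rw [degree_X_pow, Lagrange.degree_nodal, hZ]) (pow_ne_zero _ X_ne_zero)
      (by rw [(monic_X_pow t).leadingCoeff, (Lagrange.nodal_monic).leadingCoeff])
    rwa [degree_X_pow] at this
  · intro p hp
    rw [eval_sub, eval_sub, eval_mul, eval_blockPoly, eval_blockPoly, h p hp,
      Lagrange.eval_nodal_at_node (v := fun p : ℕ => (p : ℤ)) hp]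
    ring

theorem card_le_of_blockValue_eq (hD : 0 < D) (hΛ : 0 < Λ) (hW : 2 * Λ * D ≤ W) {e e' : ℕ}
    (he : e < (D ^ m) ^ (t + 1)) (he' : e' < (D ^ m) ^ (t + 1)) (hne : e ≠ e') (Z : Finset ℕ)
    (h : ∀ p ∈ Z, blockValue t m D W e p = blockValue t m D W e' p) : Z.card ≤ t := by
  by_contra! hZ
  refine hne (eq_of_blockPoly_eq hD hΛ hW he he' (sub_eq_zero.1 ?_))
  refine eq_zero_of_degree_lt_of_eval_index_eq_zero (v := fun p : ℕ => (p : ℤ)) Z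
    Nat.cast_injective.injOn ((degree_blockPoly_sub_lt ..).trans_le (by exact_mod_cast hZ)) ?_
  intro p hp
  rw [eval_sub, eval_blockPoly, eval_blockPoly, h p hp, sub_self]

theorem abs_eval_nodal_le {R : ℕ} (Z : Finset ℕ) (hZ : Z.card = t) (hZR : ∀ p ∈ Z, p < R) {p : ℕ}
    (hp : p < R) : |(Lagrange.nodal Z (fun p : ℕ => (p : ℤ))).eval (p : ℤ)| ≤ (R ^ t : ℕ) := by
  rw [Lagrange.eval_nodal, Finset.abs_prod]
  refine (Finset.prod_le_prod (g := fun _ => (R : ℤ)) (fun _ _ => abs_nonneg _)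
    fun i hi => ?_).trans ?_
  · have := hZR i hi
    rw [abs_le]
    omega
  · simp [hZ]

/-- No three of the graphs form a triangle with `t`-point sides. -/
theorem not_triangle {R : ℕ} (ht : 0 < t) (hD : 0 < D) (hW : 2 * R ^ t * D ≤ W)
    {e₁ e₂ e₃ : ℕ} (h₁ : e₁ < (D ^ m) ^ (t + 1)) (h₂ : e₂ < (D ^ m) ^ (t + 1)) (h12 : e₁ ≠ e₂)
    (Z₁₂ Z₁₃ Z₂₃ : Finset ℕ) (c12 : Z₁₂.card = t) (c13 : Z₁₃.card = t) (c23 : Z₂₃.card = t)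
    (m12 : ∀ p, p ∈ Z₁₂ ↔ p < R ∧ blockValue t m D W e₁ p = blockValue t m D W e₂ p)
    (m13 : ∀ p, p ∈ Z₁₃ ↔ p < R ∧ blockValue t m D W e₁ p = blockValue t m D W e₃ p)
    (m23 : ∀ p, p ∈ Z₂₃ ↔ p < R ∧ blockValue t m D W e₂ p = blockValue t m D W e₃ p) :
    ¬ Disjoint Z₁₂ Z₁₃ := by
  intro hdis
  obtain ⟨p, hp⟩ := Finset.card_pos.1 (c12 ▸ ht)
  obtain ⟨hpR, hpv⟩ := (m12 p).1 hp
  have hR : 0 < R := by omega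
  have hp13 : p ∉ Z₁₃ := Finset.disjoint_left.1 hdis hp
  have hp23 : p ∉ Z₂₃ := fun h => hp13 ((m13 p).2 ⟨hpR, hpv.trans ((m23 p).1 h).2⟩)
  have k13 := congrArg (eval (p : ℤ)) (blockPoly_sub_eq Z₁₃ c13 fun p hp => ((m13 p).1 hp).2)
  have k23 := congrArg (eval (p : ℤ)) (blockPoly_sub_eq Z₂₃ c23 fun p hp => ((m23 p).1 hp).2)
  rw [eval_sub, eval_blockPoly, eval_blockPoly, eval_mul, eval_C] at k13 k23
  rw [hpv] at k13
  have hnz : ∀ Z : Finset ℕ, p ∉ Z →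
      (Lagrange.nodal Z (fun p : ℕ => (p : ℤ))).eval (p : ℤ) ≠ 0 := fun Z hZ =>
    Lagrange.eval_nodal_not_at_node fun i hi h => hZ (by
      have : p = i := by exact_mod_cast h
      rwa [this])
  have hDm : 0 < D ^ m := pow_pos hD m
  -- At `p` the first two polynomials agree, so their differences with the third are equal there.
  -- The two nodal values at `p` are nonzero because `p` lies on neither of the other sides, and
  -- they serve as `A` and `B`.
  have hlead : digit (D ^ m) 0 e₁ = digit (D ^ m) 0 e₂ :=
    eq_of_mul_behrend_sub_eq (β₃ := digit (D ^ m) 0 e₃) hD (pow_pos hR t) hW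
      (digit_lt hDm _ _) (digit_lt hDm _ _) (hnz _ hp13) (hnz _ hp23)
      (abs_eval_nodal_le Z₁₃ c13 (fun i hi => ((m13 i).1 hi).1) hpR)
      (abs_eval_nodal_le Z₂₃ c23 (fun i hi => ((m23 i).1 hi).1) hpR)
      (by rw [mul_comm, ← k13, mul_comm, ← k23])
  have k12 := blockPoly_sub_eq Z₁₂ c12 fun p hp => ((m12 p).1 hp).2
  rw [hlead, sub_self, C_0, zero_mul, sub_eq_zero] at k12
  exact h12 (eq_of_blockPoly_eq hD (pow_pos hR t) hW h₁ h₂ k12)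

/-- The factor `D ^ 3` is the price of the paraboloid lift: the sum of squares is at most `m D² ≤
D³`. It is negligible against `W ^ m`. -/
theorem blockValue_lt {R : ℕ} (hD : 0 < D) (hm : m ≤ D) (hDW : D ≤ W) {e p : ℕ} (hp : p < R) :
    blockValue t m D W e p < (t + 2) * R ^ t * W ^ m * D ^ 3 := by
  have hDm : 0 < D ^ m := pow_pos hD m
  have hR : 0 < R := by omega
  have hD3 : 1 ≤ D ^ 3 := Nat.one_le_pow _ _ hD
  have hRt : 0 < R ^ t := pow_pos hR t
  have hpt : p ^ t ≤ R ^ t := Nat.pow_le_pow_left hp.le t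
  have h1 : behrend m D W (digit (D ^ m) 0 e) < 2 * (W ^ m * D ^ 3) := by
    have a1 := rebase_lt (m := m) hD hDW (digit (D ^ m) 0 e)
    have a2 := Nat.mul_le_mul_right (W ^ m) (digitNorm_le hD hm (digit (D ^ m) 0 e))
    have a3 := Nat.mul_le_mul_left (W ^ m) hD3
    rw [behrend]
    linarith
  have h2 : ∑ j ∈ Finset.range t, digit (D ^ m) (j + 1) e * p ^ j ≤ t * (W ^ m * D ^ 3) * R ^ t := by
    calc _ ≤ ∑ _j ∈ Finset.range t, W ^ m * D ^ 3 * R ^ t := by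
          refine Finset.sum_le_sum fun j hj => Nat.mul_le_mul ?_ ?_
          · calc digit (D ^ m) (j + 1) e ≤ D ^ m := (digit_lt hDm _ _).le
              _ ≤ W ^ m := Nat.pow_le_pow_left hDW m
              _ ≤ W ^ m * D ^ 3 := Nat.le_mul_of_pos_right _ hD3
          · exact (Nat.pow_le_pow_left hp.le j).trans
              (Nat.pow_le_pow_right hR (Finset.mem_range.1 hj).le)
      _ = _ := by rw [Finset.sum_const, Finset.card_range, smul_eq_mul]; ring
  calc blockValue t m D W e p
      ≤ behrend m D W (digit (D ^ m) 0 e) * R ^ t + t * (W ^ m * D ^ 3) * R ^ t :=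
        Nat.add_le_add (Nat.mul_le_mul_left _ hpt) h2
    _ < 2 * (W ^ m * D ^ 3) * R ^ t + t * (W ^ m * D ^ 3) * R ^ t :=
        Nat.add_lt_add_right (Nat.mul_lt_mul_of_pos_right h1 hRt) _
    _ = _ := by ring

end Blocks

/-! ### The block labels -/

/-- The labels of the points of the blocks: the first `(D ^ m) ^ (t + 1)` blocks are graphs of
polynomials, further blocks are read off from `y`. -/
def blockLabel (R t m D W M : ℕ) (y : ℕ → ℕ) (b p : ℕ) : ℕ :=
  if b < (D ^ m) ^ (t + 1) then p * M + blockValue t m D W b p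
  else y ((b - (D ^ m) ^ (t + 1)) * R + p)

theorem eq_of_mul_add_eq {M p p' v v' : ℕ} (hv : v < M) (hv' : v' < M)
    (h : p * M + v = p' * M + v') : p = p' ∧ v = v' := by
  have hM : 0 < M := by omega
  have h1 := congrArg (· / M) h
  have h2 := congrArg (· % M) h
  simp only [mul_comm _ M, Nat.mul_add_div hM, Nat.mul_add_mod, Nat.div_eq_of_lt hv,
    Nat.div_eq_of_lt hv', Nat.mod_eq_of_lt hv, Nat.mod_eq_of_lt hv'] at h1 h2
  exact ⟨by omega, h2⟩

section Labels

variable {R t m D W M : ℕ} {y : ℕ → ℕ}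

theorem blockLabel_of_lt {b : ℕ} (hb : b < (D ^ m) ^ (t + 1)) (p : ℕ) :
    blockLabel R t m D W M y b p = p * M + blockValue t m D W b p := if_pos hb

theorem blockLabel_add (i p : ℕ) :
    blockLabel R t m D W M y ((D ^ m) ^ (t + 1) + i) p = y (i * R + p) := by
  rw [blockLabel, if_neg (by omega), Nat.add_sub_cancel_left]

theorem blockLabel_lt (hM : ∀ e, ∀ p < R, blockValue t m D W e p < M) {b p : ℕ} (hp : p < R)
    (hb : b < (D ^ m) ^ (t + 1)) : blockLabel R t m D W M y b p < R * M := by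
  rw [blockLabel_of_lt hb]
  calc _ < p * M + M := Nat.add_lt_add_left (hM b p hp) _
    _ = (p + 1) * M := by ring
    _ ≤ R * M := Nat.mul_le_mul_right _ hp

theorem mul_add_lt_two_mul {i p : ℕ} (hi : i < 2) (hp : p < R) : i * R + p < 2 * R := by
  interval_cases i <;> omega

theorem injective_blockLabel (hM : ∀ e, ∀ p < R, blockValue t m D W e p < M)
    (hy : ∀ j < 2 * R, ∀ k < 2 * R, y j = y k → j = k) :
    ∀ b < (D ^ m) ^ (t + 1) + 2, ∀ p < R, ∀ p' < R,
      blockLabel R t m D W M y b p = blockLabel R t m D W M y b p' → p = p' := by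
  intro b hb p hp p' hp' h
  rcases lt_or_ge b ((D ^ m) ^ (t + 1)) with hlt | hge
  · rw [blockLabel_of_lt hlt, blockLabel_of_lt hlt] at h
    exact (eq_of_mul_add_eq (hM _ _ hp) (hM _ _ hp') h).1
  · obtain ⟨i, rfl⟩ := Nat.exists_eq_add_of_le hge
    rw [blockLabel_add, blockLabel_add] at h
    have := hy _ (mul_add_lt_two_mul (by omega) hp) _ (mul_add_lt_two_mul (by omega) hp') h
    omega

theorem mem_coincidences_blockLabel (hM : ∀ e, ∀ p < R, blockValue t m D W e p < M) {b b' : ℕ}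
    (hb : b < (D ^ m) ^ (t + 1)) (hb' : b' < (D ^ m) ^ (t + 1)) (p : ℕ) :
    p ∈ coincidences R (blockLabel R t m D W M y) b b' ↔
      p < R ∧ blockValue t m D W b p = blockValue t m D W b' p := by
  rw [mem_coincidences]
  refine and_congr_right fun hp => ⟨?_, fun h => ⟨p, hp, ?_⟩⟩
  · rintro ⟨p', hp', h⟩
    rw [blockLabel_of_lt hb, blockLabel_of_lt hb'] at h
    obtain ⟨rfl, h⟩ := eq_of_mul_add_eq (hM _ _ hp') (hM _ _ hp) h
    exact h.symm
  · rw [blockLabel_of_lt hb, blockLabel_of_lt hb', h]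

/-- Graph labels are below `R * M`, while the special labels are at least `R * M` and pairwise
distinct. -/
theorem coincidences_blockLabel_eq_empty (hM : ∀ e, ∀ p < R, blockValue t m D W e p < M)
    (hy : ∀ j < 2 * R, ∀ k < 2 * R, y j = y k → j = k) (hyM : ∀ j < 2 * R, R * M ≤ y j)
    {b b' : ℕ} (hb : b < (D ^ m) ^ (t + 1) + 2) (hb' : b' < (D ^ m) ^ (t + 1) + 2)
    (hne : b ≠ b') (h : ¬ (b < (D ^ m) ^ (t + 1) ∧ b' < (D ^ m) ^ (t + 1))) :
    coincidences R (blockLabel R t m D W M y) b b' = ∅ := by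
  rw [Finset.eq_empty_iff_forall_notMem]
  intro p hmem
  obtain ⟨hp, p', hp', he⟩ := mem_coincidences.1 hmem
  rcases lt_or_ge b ((D ^ m) ^ (t + 1)) with hlt | hge
  · have h1 := blockLabel_lt (y := y) hM hp hlt
    obtain ⟨i, rfl⟩ := Nat.exists_eq_add_of_le (not_lt.1 fun h' => h ⟨hlt, h'⟩)
    rw [← he, blockLabel_add] at h1
    exact absurd (hyM _ (mul_add_lt_two_mul (i := i) (by omega) hp')) (by omega)
  · obtain ⟨i, rfl⟩ := Nat.exists_eq_add_of_le hge
    rw [blockLabel_add] at he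
    have hk := mul_add_lt_two_mul (i := i) (by omega) hp
    rcases lt_or_ge b' ((D ^ m) ^ (t + 1)) with hlt' | hge'
    · have h1 := blockLabel_lt (y := y) hM hp' hlt'
      rw [he] at h1
      exact absurd (hyM _ hk) (by omega)
    · obtain ⟨i', rfl⟩ := Nat.exists_eq_add_of_le hge'
      rw [blockLabel_add] at he
      have := hy _ (mul_add_lt_two_mul (i := i') (by omega) hp') _ hk he
      have h2 : i < 2 := by omega
      have h3 : i' < 2 := by omega
      interval_cases i <;> interval_cases i' <;> omega

theorem card_coincidences_blockLabel_le (hR : 0 < R) (hD : 0 < D) (hW : 2 * R ^ t * D ≤ W)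
    (hM : ∀ e, ∀ p < R, blockValue t m D W e p < M)
    (hy : ∀ j < 2 * R, ∀ k < 2 * R, y j = y k → j = k) (hyM : ∀ j < 2 * R, R * M ≤ y j)
    {b b' : ℕ} (hb : b < (D ^ m) ^ (t + 1) + 2) (hb' : b' < (D ^ m) ^ (t + 1) + 2)
    (hne : b ≠ b') : (coincidences R (blockLabel R t m D W M y) b b').card ≤ t := by
  by_cases h : b < (D ^ m) ^ (t + 1) ∧ b' < (D ^ m) ^ (t + 1)
  · exact card_le_of_blockValue_eq hD (pow_pos hR t) hW h.1 h.2 hne _ fun p hp =>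
      ((mem_coincidences_blockLabel hM h.1 h.2 p).1 hp).2
  · rw [coincidences_blockLabel_eq_empty hM hy hyM hb hb' hne h]
    simp

/-- A side with `t > 0` points cannot involve a special block, so all three blocks are graphs. -/
theorem not_disjoint_coincidences_blockLabel (ht : 0 < t) (hD : 0 < D)
    (hW : 2 * R ^ t * D ≤ W) (hM : ∀ e, ∀ p < R, blockValue t m D W e p < M)
    (hy : ∀ j < 2 * R, ∀ k < 2 * R, y j = y k → j = k) (hyM : ∀ j < 2 * R, R * M ≤ y j)
    {b₁ b₂ b₃ : ℕ} (h₁ : b₁ < (D ^ m) ^ (t + 1) + 2) (h₂ : b₂ < (D ^ m) ^ (t + 1) + 2)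
    (h₃ : b₃ < (D ^ m) ^ (t + 1) + 2) (h12 : b₁ ≠ b₂) (h13 : b₁ ≠ b₃)
    (c12 : (coincidences R (blockLabel R t m D W M y) b₁ b₂).card = t)
    (c13 : (coincidences R (blockLabel R t m D W M y) b₁ b₃).card = t)
    (c23 : (coincidences R (blockLabel R t m D W M y) b₂ b₃).card = t) :
    ¬ Disjoint (coincidences R (blockLabel R t m D W M y) b₁ b₂)
      (coincidences R (blockLabel R t m D W M y) b₁ b₃) := by
  have hreg : ∀ b < (D ^ m) ^ (t + 1) + 2, ∀ b' < (D ^ m) ^ (t + 1) + 2, b ≠ b' →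
      (coincidences R (blockLabel R t m D W M y) b b').card = t →
      b < (D ^ m) ^ (t + 1) ∧ b' < (D ^ m) ^ (t + 1) := by
    intro b hb b' hb' hne hc
    by_contra h
    rw [coincidences_blockLabel_eq_empty hM hy hyM hb hb' hne h, Finset.card_empty] at hc
    omega
  obtain ⟨k1, k2⟩ := hreg b₁ h₁ b₂ h₂ h12 c12
  obtain ⟨-, k3⟩ := hreg b₁ h₁ b₃ h₃ h13 c13
  exact not_triangle ht hD hW k1 k2 h12 _ _ _ c12 c13 c23
    (mem_coincidences_blockLabel hM k1 k2) (mem_coincidences_blockLabel hM k1 k3)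
    (mem_coincidences_blockLabel hM k2 k3)

end Labels

/-- Only equality of points matters, so the combinatorics of integer labels passes to the field
under any labelling of its elements. -/
theorem coincidences_comp {α : Type*} {R q : ℕ} {lab : ℕ → ℕ → ℕ} {f : ℕ → α}
    (hf : ∀ i < q, ∀ j < q, f i = f j → i = j) {b b' : ℕ} (hb : ∀ p < R, lab b p < q)
    (hb' : ∀ p < R, lab b' p < q) :
    coincidences R (fun b p => f (lab b p)) b b' = coincidences R lab b b' := by
  ext p
  rw [mem_coincidences, mem_coincidences]
  refine and_congr_right fun hp => exists_congr fun p' => and_congr_right fun hp' => ?_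
  exact ⟨fun h => hf _ (hb' p' hp') _ (hb p hp) h, fun h => by rw [h]⟩

end Codes

/-! ### Polynomial running times -/

/-- All numbers in memory are at most `V`. -/
def MemBounded (V : ℕ) (σ : RamState) : Prop :=
  (∀ x, σ.reg x ≤ V) ∧ ∀ a i, σ.arr a i ≤ V

/-- A quantity bounded by a fixed power of any bound on the memory. -/
def PolyBounded (f : ℕ → RamState → ℕ) : Prop :=
  ∃ K, ∀ V, 2 ≤ V → ∀ σ, MemBounded V σ → f V σ ≤ V ^ K

theorem PolyBounded.mono {f g : ℕ → RamState → ℕ} (hg : PolyBounded g)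
    (h : ∀ V, 2 ≤ V → ∀ σ, MemBounded V σ → f V σ ≤ g V σ) : PolyBounded f := by
  obtain ⟨K, hK⟩ := hg
  exact ⟨K, fun V hV σ hσ => (h V hV σ hσ).trans (hK V hV σ hσ)⟩

theorem polyBounded_const (c : ℕ) : PolyBounded fun _ _ => c :=
  ⟨c, fun _ hV _ _ => (Nat.lt_two_pow_self).le.trans (Nat.pow_le_pow_left hV c)⟩

theorem polyBounded_id : PolyBounded fun V _ => V := ⟨1, fun V _ _ _ => by simp⟩

theorem polyBounded_pow (K : ℕ) : PolyBounded fun V _ => V ^ K := ⟨K, fun _ _ _ _ => le_rfl⟩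

theorem PolyBounded.add {f g : ℕ → RamState → ℕ} (hf : PolyBounded f) (hg : PolyBounded g) :
    PolyBounded fun V σ => f V σ + g V σ := by
  obtain ⟨K, hK⟩ := hf
  obtain ⟨K', hK'⟩ := hg
  refine ⟨K + K' + 1, fun V hV σ hσ => ?_⟩
  have h1 : V ^ K ≤ V ^ (K + K') := Nat.pow_le_pow_right (by omega) (by omega)
  have h2 : V ^ K' ≤ V ^ (K + K') := Nat.pow_le_pow_right (by omega) (by omega)
  have h3 : 2 * V ^ (K + K') ≤ V ^ (K + K' + 1) := by
    rw [pow_succ']; exact Nat.mul_le_mul_right _ hV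
  have := hK V hV σ hσ
  have := hK' V hV σ hσ
  show f V σ + g V σ ≤ _
  omega

theorem PolyBounded.mul {f g : ℕ → RamState → ℕ} (hf : PolyBounded f) (hg : PolyBounded g) :
    PolyBounded fun V σ => f V σ * g V σ := by
  obtain ⟨K, hK⟩ := hf
  obtain ⟨K', hK'⟩ := hg
  refine ⟨K + K', fun V hV σ hσ => ?_⟩
  rw [pow_add]
  exact Nat.mul_le_mul (hK V hV σ hσ) (hK' V hV σ hσ)

theorem size_le_self (n : ℕ) : n.size ≤ n := Nat.size_le.2 Nat.lt_two_pow_self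

theorem PolyBounded.size {f : ℕ → RamState → ℕ} (hf : PolyBounded f) :
    PolyBounded fun V σ => (f V σ).size := hf.mono fun _ _ _ _ => size_le_self _

/-- An expression is a fixed tree, so its nested multiplications raise the memory bound to a fixed
power. -/
theorem polyBounded_eval (e : RamExpr) : PolyBounded fun _ σ => e.eval σ := by
  induction e with
  | lit c => exact polyBounded_const c
  | var x => exact polyBounded_id.mono fun V _ σ hσ => hσ.1 x
  | get a i _ => exact polyBounded_id.mono fun V _ σ hσ => hσ.2 a _
  | bin o e₁ e₂ h₁ h₂ =>
    refine ((h₁.add h₂).add (h₁.mul h₂)).mono fun V _ σ _ => ?_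
    cases o with
    | add => exact Nat.le_add_right _ _
    | sub => exact (Nat.sub_le _ _).trans ((Nat.le_add_right _ _).trans (Nat.le_add_right _ _))
    | mul => exact Nat.le_add_left _ _
    | div => exact (Nat.div_le_self _ _).trans ((Nat.le_add_right _ _).trans (Nat.le_add_right _ _))
    | mod => exact (Nat.mod_le _ _).trans ((Nat.le_add_right _ _).trans (Nat.le_add_right _ _))

theorem polyBounded_cost (e : RamExpr) : PolyBounded fun _ σ => e.cost σ := by
  induction e with
  | lit c => exact polyBounded_const (1 + c.size)
  | var x => exact (polyBounded_const 1).add (polyBounded_eval (.var x)).size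
  | get a i h =>
    exact (((polyBounded_const 1).add h).add (polyBounded_eval i).size).add
      (polyBounded_eval (.get a i)).size
  | bin o e₁ e₂ h₁ h₂ =>
    exact ((((polyBounded_const 1).add h₁).add h₂).add (polyBounded_eval e₁).size).add
      (polyBounded_eval e₂).size

/-! ### Programs whose numbers are reduced modulo register `2` -/

instance : Add RamExpr := ⟨.bin .add⟩
instance : Sub RamExpr := ⟨.bin .sub⟩
instance : Mul RamExpr := ⟨.bin .mul⟩
instance : Div RamExpr := ⟨.bin .div⟩
instance : Mod RamExpr := ⟨.bin .mod⟩
instance (n : ℕ) : OfNat RamExpr n := ⟨.lit n⟩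

section Eval

variable (σ : RamState) (a b : RamExpr) (n x : ℕ)

@[simp] theorem eval_add : (a + b).eval σ = a.eval σ + b.eval σ := rfl
@[simp] theorem eval_sub : (a - b).eval σ = a.eval σ - b.eval σ := rfl
@[simp] theorem eval_mul : (a * b).eval σ = a.eval σ * b.eval σ := rfl
@[simp] theorem eval_div : (a / b).eval σ = a.eval σ / b.eval σ := rfl
@[simp] theorem eval_mod : (a % b).eval σ = a.eval σ % b.eval σ := rfl
@[simp] theorem eval_lit : (RamExpr.lit n).eval σ = n := rfl
@[simp] theorem eval_one : (1 : RamExpr).eval σ = 1 := rfl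
@[simp] theorem eval_var : (RamExpr.var x).eval σ = σ.reg x := rfl
@[simp] theorem eval_get : (RamExpr.get n a).eval σ = σ.arr n (a.eval σ) := rfl

end Eval

/-- All assigned values and loop lengths are reduced modulo register `2`, which is never changed. -/
inductive Clamped : RamProg → Prop
  | skip : Clamped .skip
  | assign (x : ℕ) (e : RamExpr) (hx : x ≠ 2) : Clamped (.assign x (e % .var 2))
  | store (a : ℕ) (i e : RamExpr) : Clamped (.store a i (e % .var 2))
  | seq {p₁ p₂ : RamProg} (h₁ : Clamped p₁) (h₂ : Clamped p₂) : Clamped (.seq p₁ p₂)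
  | ite (e : RamExpr) {p₁ p₂ : RamProg} (h₁ : Clamped p₁) (h₂ : Clamped p₂) :
      Clamped (.ite e p₁ p₂)
  | loop (x : ℕ) (e : RamExpr) {p : RamProg} (hx : x ≠ 2) (h : Clamped p) :
      Clamped (.loop x (e % .var 2) p)

theorem MemBounded.setReg {V : ℕ} {σ : RamState} (h : MemBounded V σ) (x : ℕ) {v : ℕ}
    (hv : v ≤ V) : MemBounded V (σ.setReg x v) := by
  refine ⟨fun y => ?_, h.2⟩
  by_cases hy : y = x
  · subst hy; simpa [RamState.setReg] using hv
  · simpa [RamState.setReg, hy] using h.1 y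

theorem MemBounded.setArr {V : ℕ} {σ : RamState} (h : MemBounded V σ) (a i : ℕ) {v : ℕ}
    (hv : v ≤ V) : MemBounded V (σ.setArr a i v) := by
  refine ⟨h.1, fun b j => ?_⟩
  by_cases hb : b = a
  · subst hb
    by_cases hj : j = i
    · subst hj; simpa [RamState.setArr] using hv
    · simpa [RamState.setArr, hj] using h.2 b j
  · simpa [RamState.setArr, hb] using h.2 b j

theorem setReg_reg_of_ne (σ : RamState) {x y : ℕ} (v : ℕ) (h : y ≠ x) :
    (σ.setReg x v).reg y = σ.reg y := by simp [RamState.setReg, h]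

@[simp] theorem setReg_reg_self (σ : RamState) (x v : ℕ) : (σ.setReg x v).reg x = v := by
  simp [RamState.setReg]

@[simp] theorem setReg_arr (σ : RamState) (x v : ℕ) : (σ.setReg x v).arr = σ.arr := rfl

@[simp] theorem setArr_reg (σ : RamState) (a i v : ℕ) : (σ.setArr a i v).reg = σ.reg := rfl

theorem setArr_arr_of_ne (σ : RamState) {a b : ℕ} (i v : ℕ) (h : b ≠ a) :
    (σ.setArr a i v).arr b = σ.arr b := by simp [RamState.setArr, h]

/-- A clamped program runs in time polynomial in register `2`. -/
theorem Clamped.run_bound {p : RamProg} (hp : Clamped p) : ∃ K, ∀ V, 2 ≤ V → ∀ σ, MemBounded V σ →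
    σ.reg 2 = V → MemBounded V (p.run σ).1 ∧ (p.run σ).1.reg 2 = V ∧ (p.run σ).2 ≤ V ^ K := by
  have hclamp : ∀ (e : RamExpr) V, 2 ≤ V → ∀ σ : RamState, σ.reg 2 = V →
      (e % .var 2).eval σ ≤ V := fun e V hV σ h2 => by
    rw [eval_mod, eval_var, h2]
    exact (Nat.mod_lt _ (by omega)).le
  induction hp with
  | skip =>
    obtain ⟨K, hK⟩ := polyBounded_const 1
    exact ⟨K, fun V hV σ hσ h2 => ⟨hσ, h2, hK V hV σ hσ⟩⟩
  | assign x e hx =>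
    obtain ⟨K, hK⟩ := (polyBounded_const 1).add (polyBounded_cost (e % .var 2))
    refine ⟨K, fun V hV σ hσ h2 => ⟨hσ.setReg x (hclamp e V hV σ h2), ?_, hK V hV σ hσ⟩⟩
    exact (setReg_reg_of_ne σ _ hx.symm).trans h2
  | store a i e =>
    obtain ⟨K, hK⟩ := (((polyBounded_const 1).add (polyBounded_cost i)).add
      (polyBounded_eval i).size).add (polyBounded_cost (e % .var 2))
    exact ⟨K, fun V hV σ hσ h2 =>
      ⟨hσ.setArr a _ (hclamp e V hV σ h2), h2, hK V hV σ hσ⟩⟩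
  | seq _ _ ih₁ ih₂ =>
    obtain ⟨K₁, h₁⟩ := ih₁
    obtain ⟨K₂, h₂⟩ := ih₂
    obtain ⟨K, hK⟩ := ((polyBounded_const 1).add (polyBounded_pow K₁)).add (polyBounded_pow K₂)
    refine ⟨K, fun V hV σ hσ h2 => ?_⟩
    obtain ⟨a1, a2, a3⟩ := h₁ V hV σ hσ h2
    obtain ⟨b1, b2, b3⟩ := h₂ V hV _ a1 a2
    exact ⟨b1, b2, le_trans (by simp only [RamProg.run]; omega) (hK V hV σ hσ)⟩
  | @ite e p₁ p₂ _ _ ih₁ ih₂ =>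
    obtain ⟨K₁, h₁⟩ := ih₁
    obtain ⟨K₂, h₂⟩ := ih₂
    obtain ⟨K, hK⟩ := (((polyBounded_const 1).add (polyBounded_cost e)).add
      (polyBounded_pow K₁)).add (polyBounded_pow K₂)
    refine ⟨K, fun V hV σ hσ h2 => ?_⟩
    have hKσ : 1 + e.cost σ + V ^ K₁ + V ^ K₂ ≤ V ^ K := hK V hV σ hσ
    obtain ⟨a1, a2, a3⟩ := h₁ V hV σ hσ h2
    obtain ⟨b1, b2, b3⟩ := h₂ V hV σ hσ h2
    by_cases he : e.eval σ ≠ 0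
    · simp only [RamProg.run, if_pos he]
      exact ⟨a1, a2, by omega⟩
    · simp only [RamProg.run, if_neg he]
      exact ⟨b1, b2, by omega⟩
  | @loop x e p hx _ ih =>
    obtain ⟨K₁, h₁⟩ := ih
    obtain ⟨K, hK⟩ := ((polyBounded_const 1).add (polyBounded_cost (e % .var 2))).add
      (polyBounded_id.mul (((polyBounded_const 1).add polyBounded_id).add (polyBounded_pow K₁)))
    refine ⟨K, fun V hV σ hσ h2 => ?_⟩
    set N := (e % .var 2).eval σ with hN
    -- The loop length is clamped as well, so a loop multiplies the bound for its body by at most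
    -- `V`.
    have hNV : N ≤ V := hclamp e V hV σ h2
    have main : ∀ i ≤ N,
        let acc : RamState × ℕ := Nat.rec (motive := fun _ => RamState × ℕ)
          (σ, 1 + (e % .var 2).cost σ)
          (fun i acc => ((p.run (acc.1.setReg x i)).1,
            acc.2 + 1 + i.size + (p.run (acc.1.setReg x i)).2)) i
        MemBounded V acc.1 ∧ acc.1.reg 2 = V ∧
          acc.2 ≤ 1 + (e % .var 2).cost σ + i * (1 + V + V ^ K₁) := by
      intro i
      induction i with
      | zero => exact fun _ => ⟨hσ, h2, by simp⟩
      | succ i ihi =>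
        intro hi
        obtain ⟨a1, a2, a3⟩ := ihi (by omega)
        obtain ⟨b1, b2, b3⟩ := h₁ V hV _ (a1.setReg x (v := i) (by omega))
          ((setReg_reg_of_ne _ _ hx.symm).trans a2)
        refine ⟨b1, b2, ?_⟩
        have hs := size_le_self i
        simp only at a3 ⊢
        rw [add_mul, one_mul]
        omega
    obtain ⟨a1, a2, a3⟩ := main N le_rfl
    refine ⟨a1, a2, le_trans (a3.trans ?_) (hK V hV σ hσ)⟩
    exact Nat.add_le_add_left (Nat.mul_le_mul_right _ hNV) _

/-- Invariants of loops. -/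
theorem loop_invariant (I : ℕ → RamState → Prop) {x : ℕ} {e : RamExpr} {p : RamProg}
    {σ : RamState} {N : ℕ} (hN : e.eval σ = N) (h0 : I 0 σ)
    (hs : ∀ i < N, ∀ τ, I i τ → I (i + 1) (p.run (τ.setReg x i)).1) :
    I N ((RamProg.loop x e p).run σ).1 := by
  subst hN
  have main : ∀ i ≤ e.eval σ, I i (Nat.rec (motive := fun _ => RamState × ℕ)
      (σ, 1 + e.cost σ) (fun i acc => ((p.run (acc.1.setReg x i)).1,
        acc.2 + 1 + i.size + (p.run (acc.1.setReg x i)).2)) i : RamState × ℕ).1 := by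
    intro i
    induction i with
    | zero => exact fun _ => h0
    | succ i ih => exact fun hi => hs i (by omega) _ (ih (by omega))
  exact main _ le_rfl

/-! ### A library of expressions -/

def sumX : ℕ → (ℕ → RamExpr) → RamExpr
  | 0, _ => 0
  | k + 1, f => sumX k f + f k

@[simp] theorem eval_sumX (σ : RamState) (k : ℕ) (f : ℕ → RamExpr) :
    (sumX k f).eval σ = ∑ i ∈ Finset.range k, (f i).eval σ := by
  induction k with
  | zero => rfl
  | succ k ih => rw [sumX, eval_add, ih, Finset.sum_range_succ]

def powX (e : RamExpr) : ℕ → RamExpr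
  | 0 => 1
  | k + 1 => powX e k * e

@[simp] theorem eval_powX (σ : RamState) (e : RamExpr) (k : ℕ) :
    (powX e k).eval σ = e.eval σ ^ k := by
  induction k with
  | zero => rfl
  | succ k ih => rw [powX, eval_mul, ih, pow_succ]

/-- Zero precisely if the values agree. -/
def neX (a b : RamExpr) : RamExpr := (a - b) + (b - a)

theorem eval_neX_eq_zero (σ : RamState) (a b : RamExpr) :
    (neX a b).eval σ = 0 ↔ a.eval σ = b.eval σ := by
  simp only [neX, eval_add, eval_sub]
  omega

/-- Truncated subtraction makes this an indicator: any positive discrepancy gives `0`. -/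
def eqX (a b : RamExpr) : RamExpr := 1 - neX a b

@[simp] theorem eval_eqX (σ : RamState) (a b : RamExpr) :
    (eqX a b).eval σ = if a.eval σ = b.eval σ then 1 else 0 := by
  simp only [eqX, neX, eval_add, eval_sub, eval_one]
  split_ifs <;> omega

def ltX (a b : RamExpr) : RamExpr := 1 - (a + 1 - b)

@[simp] theorem eval_ltX (σ : RamState) (a b : RamExpr) :
    (ltX a b).eval σ = if a.eval σ < b.eval σ then 1 else 0 := by
  simp only [ltX, eval_add, eval_sub, eval_one]
  split_ifs <;> omega

/-- The `i`-th of the expressions `f 0, …, f (k - 1)`. -/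
def selX (k : ℕ) (i : RamExpr) (f : ℕ → RamExpr) : RamExpr :=
  sumX k fun j => eqX i (.lit j) * f j

theorem eval_selX (σ : RamState) {k : ℕ} {i : RamExpr} (f : ℕ → RamExpr) (hi : i.eval σ < k) :
    (selX k i f).eval σ = (f (i.eval σ)).eval σ := by
  rw [selX, eval_sumX, Finset.sum_eq_single (i.eval σ)]
  · simp
  · intro j _ hj
    simp [Ne.symm hj]
  · intro h
    exact absurd (Finset.mem_range.2 hi) h

def digX (b : RamExpr) (i : ℕ) (e : RamExpr) : RamExpr := e / powX b i % b

@[simp] theorem eval_digX (σ : RamState) (b : RamExpr) (i : ℕ) (e : RamExpr) :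
    (digX b i e).eval σ = digit (b.eval σ) i (e.eval σ) := by
  simp [digX, digit]

/-! ### Arithmetic in the field -/

section FieldTables

variable {F : Type*} [Field F] {q : ℕ}

/-- Memory with the field tables, `q` in register `0` and `V` in register `2`. -/
structure HasTables (φ : F ≃ Fin q) (V : ℕ) (σ : RamState) : Prop where
  reg_zero : σ.reg 0 = q
  reg_two : σ.reg 2 = V
  add : ∀ a b : F, σ.arr 0 (φ a * q + φ b) = φ (a + b)
  mul : ∀ a b : F, σ.arr 1 (φ a * q + φ b) = φ (a * b)

variable {φ : F ≃ Fin q} {V : ℕ} {σ : RamState}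

theorem HasTables.setReg (h : HasTables φ V σ) {x v : ℕ} (h0 : x ≠ 0) (h2 : x ≠ 2) :
    HasTables φ V (σ.setReg x v) :=
  ⟨(setReg_reg_of_ne _ _ h0.symm).trans h.1, (setReg_reg_of_ne _ _ h2.symm).trans h.2, h.3, h.4⟩

theorem HasTables.setArr (h : HasTables φ V σ) {a i v : ℕ} (h2 : 2 ≤ a) :
    HasTables φ V (σ.setArr a i v) :=
  ⟨h.1, h.2, by rw [setArr_arr_of_ne _ _ _ (by omega)]; exact h.3,
    by rw [setArr_arr_of_ne _ _ _ (by omega)]; exact h.4⟩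

theorem hasTables_fieldInput (φ : F ≃ Fin q) (V : ℕ) :
    HasTables φ V ((fieldInput φ).setReg 2 V) := by
  have aux : ∀ (a b : F) (t : ℕ), (fieldInput φ).arr t (φ a * q + φ b) =
      if t = 0 then (φ (a + b) : ℕ) else if t = 1 then (φ (a * b) : ℕ) else 0 := by
    intro a b t
    have ha := (φ a).2
    have hb := (φ b).2
    have hq : 0 < q := by omega
    have hlt : (φ a : ℕ) * q + φ b < q * q := by
      calc (φ a : ℕ) * q + φ b < φ a * q + q := by omega
        _ = (φ a + 1) * q := by ring
        _ ≤ q * q := Nat.mul_le_mul_right _ ha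
    have e1 : ((φ a : ℕ) * q + φ b) / q = φ a := by
      rw [mul_comm, Nat.mul_add_div hq, Nat.div_eq_of_lt hb, add_zero]
    have e2 : ((φ a : ℕ) * q + φ b) % q = φ b := by
      rw [mul_comm, Nat.mul_add_mod, Nat.mod_eq_of_lt hb]
    simp only [fieldInput, hlt, dif_pos, e1, e2, Fin.eta, Equiv.symm_apply_apply]
  refine ⟨?_, by simp, fun a b => ?_, fun a b => ?_⟩
  · rw [setReg_reg_of_ne _ _ (by omega)]; rfl
  · rw [setReg_arr, aux]; rfl
  · rw [setReg_arr, aux]; rfl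

def faddX (a b : RamExpr) : RamExpr := .get 0 (a * .var 0 + b)

def fmulX (a b : RamExpr) : RamExpr := .get 1 (a * .var 0 + b)

/-- `z + f 0 + … + f (k - 1)` in the field. -/
def fsumX (z : RamExpr) : ℕ → (ℕ → RamExpr) → RamExpr
  | 0, _ => z
  | k + 1, f => faddX (fsumX z k f) (f k)

/-- `u * e ^ k` in the field. -/
def fpowX (u e : RamExpr) : ℕ → RamExpr
  | 0 => u
  | k + 1 => fmulX (fpowX u e k) e

theorem HasTables.eval_faddX (h : HasTables φ V σ) {a b : RamExpr} {x y : F}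
    (ha : a.eval σ = φ x) (hb : b.eval σ = φ y) : (faddX a b).eval σ = φ (x + y) := by
  rw [faddX, eval_get, eval_add, eval_mul, eval_var, h.reg_zero, ha, hb, h.add]

theorem HasTables.eval_fmulX (h : HasTables φ V σ) {a b : RamExpr} {x y : F}
    (ha : a.eval σ = φ x) (hb : b.eval σ = φ y) : (fmulX a b).eval σ = φ (x * y) := by
  rw [fmulX, eval_get, eval_add, eval_mul, eval_var, h.reg_zero, ha, hb, h.mul]

theorem HasTables.eval_fsumX (h : HasTables φ V σ) {z : RamExpr} {ζ : F} (hz : z.eval σ = φ ζ)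
    {k : ℕ} {f : ℕ → RamExpr} {x : ℕ → F} (hf : ∀ i < k, (f i).eval σ = φ (x i)) :
    (fsumX z k f).eval σ = φ (ζ + ∑ i ∈ Finset.range k, x i) := by
  induction k with
  | zero => simpa [fsumX] using hz
  | succ k ih =>
    rw [fsumX, h.eval_faddX (ih fun i hi => hf i (by omega)) (hf k (by omega)),
      Finset.sum_range_succ, add_assoc]

theorem HasTables.eval_fpowX (h : HasTables φ V σ) {u e : RamExpr} {ω x : F}
    (hu : u.eval σ = φ ω) (he : e.eval σ = φ x) (k : ℕ) :
    (fpowX u e k).eval σ = φ (ω * x ^ k) := by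
  induction k with
  | zero => simpa [fpowX] using hu
  | succ k ih => rw [fpowX, h.eval_fmulX ih he, pow_succ, mul_assoc]

/-- The field element with a given label. -/
def decode (φ : F ≃ Fin q) (k : ℕ) : F := if h : k < q then φ.symm ⟨k, h⟩ else 0

theorem val_decode {k : ℕ} (hk : k < q) : (φ (decode φ k) : ℕ) = k := by
  simp [decode, hk]

@[simp] theorem decode_val (x : F) : decode φ (φ x) = x := by
  simp [decode]

theorem decode_injOn : ∀ i < q, ∀ j < q, decode φ i = decode φ j → i = j := by
  intro i hi j hj h
  rw [← val_decode (φ := φ) hi, h, val_decode hj]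

end FieldTables

/-! ### Parameters of the construction -/

/-- The base in which the digits of level `m` are read. -/
def levelBase (R t m : ℕ) : ℕ := 2 * R ^ t * 2 ^ m

/-- The number of values of the polynomials of level `m`. -/
def levelWidth (R t m : ℕ) : ℕ := (t + 2) * R ^ t * levelBase R t m ^ m * (2 ^ m) ^ 3

/-- The level reached by `i` attempts to increase it, within `q` labels. -/
def level (R t q : ℕ) : ℕ → ℕ
  | 0 => 0
  | i + 1 => if 2 * (R * levelWidth R t (level R t q i + 1)) ≤ q then level R t q i + 1
      else level R t q i

/-- The number of polynomials of level `m`. -/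
def levelBlocks (t m : ℕ) : ℕ := ((2 ^ m) ^ m) ^ (t + 1)

/-- With `two_pow_pow_succ`, this lets the program pass to the next level by multiplying registers
by constants and `2 ^ m`, without a variable exponent. -/
theorem levelBase_pow_succ (R t m : ℕ) : levelBase R t (m + 1) ^ (m + 1) =
    4 * R ^ t * levelBase R t m ^ m * 2 ^ m * 2 ^ m := by
  have h : levelBase R t (m + 1) = 2 * levelBase R t m := by
    simp only [levelBase, pow_succ]; ring
  rw [h, mul_pow, pow_succ (levelBase R t m), pow_succ 2 m]
  nth_rewrite 2 [levelBase]
  ring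

theorem two_pow_pow_succ (m : ℕ) : (2 ^ (m + 1)) ^ (m + 1) = 2 * (2 ^ m) ^ m * 2 ^ m * 2 ^ m := by
  simp only [← pow_mul, ← pow_add, ← pow_succ']
  congr 1
  ring

section Level

variable {R t q m : ℕ}

theorem two_pow_le_levelBase (hR : 0 < R) : 2 ^ m ≤ levelBase R t m := by
  have : 0 < R ^ t := pow_pos hR t
  exact Nat.le_mul_of_pos_left _ (by omega)

theorem levelBase_pow_le_width (hR : 0 < R) : levelBase R t m ^ m ≤ levelWidth R t m := by
  have h1 : 0 < R ^ t := pow_pos hR t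
  have h2 : 0 < (2 ^ m) ^ 3 := by positivity
  rw [levelWidth]
  calc levelBase R t m ^ m ≤ (t + 2) * R ^ t * levelBase R t m ^ m :=
        Nat.le_mul_of_pos_left _ (by positivity)
    _ ≤ _ := Nat.le_mul_of_pos_right _ h2

theorem two_pow_cube_le_width (hR : 0 < R) : (2 ^ m) ^ 3 ≤ levelWidth R t m := by
  have h1 : 0 < R ^ t := pow_pos hR t
  have h2 : 0 < levelBase R t m := (Nat.two_pow_pos m).trans_le (two_pow_le_levelBase hR)
  exact Nat.le_mul_of_pos_left _ (by positivity)

theorem levelWidth_lt (hR : 0 < R) (hq : 2 * (R * levelWidth R t m) ≤ q) :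
    levelWidth R t m < q := by
  have h1 : levelWidth R t m ≤ R * levelWidth R t m := Nat.le_mul_of_pos_left _ hR
  have h2 : 0 < levelWidth R t m :=
    (show 0 < (2 ^ m) ^ 3 by positivity).trans_le (two_pow_cube_le_width hR)
  omega

theorem two_pow_pow_le_width (hR : 0 < R) : (2 ^ m) ^ m ≤ levelWidth R t m :=
  (Nat.pow_le_pow_left (two_pow_le_levelBase hR) m).trans (levelBase_pow_le_width hR)

theorem two_pow_le_width (hR : 0 < R) : 2 ^ m ≤ levelWidth R t m :=
  (Nat.le_self_pow (by omega) _).trans (two_pow_cube_le_width hR)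

theorem level_spec (h0 : 2 * (R * levelWidth R t 0) ≤ q) (i : ℕ) :
    2 * (R * levelWidth R t (level R t q i)) ≤ q := by
  induction i with
  | zero => exact h0
  | succ i ih =>
    rw [level]
    split_ifs with h
    · exact h
    · exact ih

/-- If every one of the `q` attempts succeeded, the level would be `q`, and the next width is at
least `2 ^ (q + 1) > q`. After a failed attempt the level stays fixed and the failed inequality
persists. -/
theorem lt_level_succ (hR : 0 < R) (q : ℕ) :
    q < 2 * (R * levelWidth R t (level R t q q + 1)) := by
  have main : ∀ i, level R t q i = i ∨ q < 2 * (R * levelWidth R t (level R t q i + 1)) := by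
    intro i
    induction i with
    | zero => exact Or.inl rfl
    | succ i ih =>
      rw [level]
      split_ifs with h
      · rcases ih with ih | ih
        · left; omega
        · omega
      · exact Or.inr (by omega)
  rcases main q with h | h
  · rw [h]
    have h1 : q + 1 < 2 ^ (q + 1) := Nat.lt_two_pow_self
    have h2 := two_pow_le_width (R := R) (t := t) (m := q + 1) hR
    have h3 : levelWidth R t (q + 1) ≤ R * levelWidth R t (q + 1) := Nat.le_mul_of_pos_left _ hR
    omega
  · exact h

end Level

/-! ### Assignments -/

def asg (x : ℕ) (e : RamExpr) : RamProg := .assign x (e % .var 2)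

def sto (a : ℕ) (i e : RamExpr) : RamProg := .store a i (e % .var 2)

def lp (x : ℕ) (e : RamExpr) (p : RamProg) : RamProg := .loop x (e % .var 2) p

theorem setReg_reg (σ : RamState) (x v y : ℕ) :
    (σ.setReg x v).reg y = if y = x then v else σ.reg y := by
  simp [RamState.setReg, Function.update_apply]

theorem setArr_arr (σ : RamState) (a i v b j : ℕ) :
    (σ.setArr a i v).arr b j = if b = a ∧ j = i then v else σ.arr b j := by
  by_cases hb : b = a
  · subst hb; simp [RamState.setArr, Function.update_apply]
  · simp [RamState.setArr, hb]

theorem run_seq (p₁ p₂ : RamProg) (σ : RamState) :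
    ((RamProg.seq p₁ p₂).run σ).1 = (p₂.run (p₁.run σ).1).1 := rfl

theorem run_ite (e : RamExpr) (p₁ p₂ : RamProg) (σ : RamState) :
    ((RamProg.ite e p₁ p₂).run σ).1 = if e.eval σ ≠ 0 then (p₁.run σ).1 else (p₂.run σ).1 := by
  rw [RamProg.run]
  split_ifs <;> rfl

section Run

variable {F : Type*} [Field F] {q : ℕ} {φ : F ≃ Fin q} {V : ℕ} {σ : RamState}

theorem HasTables.run_asg (h : HasTables φ V σ) (x : ℕ) {e : RamExpr} {v : ℕ}
    (he : e.eval σ = v) (hv : v < V) : ((asg x e).run σ).1 = σ.setReg x v := by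
  rw [asg, RamProg.run, eval_mod, eval_var, h.reg_two, he, Nat.mod_eq_of_lt hv]

theorem HasTables.run_sto (h : HasTables φ V σ) (a : ℕ) {i e : RamExpr} {v j : ℕ}
    (hi : i.eval σ = j) (he : e.eval σ = v) (hv : v < V) :
    ((sto a i e).run σ).1 = σ.setArr a j v := by
  rw [sto, RamProg.run, eval_mod, eval_var, h.reg_two, he, Nat.mod_eq_of_lt hv, hi]

theorem HasTables.run_lp (h : HasTables φ V σ) (I : ℕ → RamState → Prop) {x : ℕ} {e : RamExpr}
    {p : RamProg} {N : ℕ} (he : e.eval σ = N) (hN : N < V) (h0 : I 0 σ)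
    (hs : ∀ i < N, ∀ τ, I i τ → I (i + 1) (p.run (τ.setReg x i)).1) :
    I N ((lp x e p).run σ).1 :=
  loop_invariant I (by rw [eval_mod, eval_var, h.reg_two, he, Nat.mod_eq_of_lt hN]) h0 hs

end Run

/-! ### Finding the level -/

section LevelProg

variable (R t : ℕ)

def nextPowX : RamExpr := .lit (4 * R ^ t) * .var 5 * .var 3 * .var 3

def nextSizeX : RamExpr :=
  .lit (2 * (R * ((t + 2) * R ^ t))) * nextPowX R t * powX (.lit 2 * .var 3) 3

/-- Puts `2 ^ m`, `(2 ^ m) ^ m` and `levelBase R t m ^ m` into registers `3`, `4`, `5`, where `m`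
is the greatest level that fits. -/
def levelProg : RamProg :=
  .seq (asg 3 1) <| .seq (asg 4 1) <| .seq (asg 5 1) <| lp 6 (.var 0) <|
    .ite (.var 0 + 1 - nextSizeX R t)
      (.seq (asg 4 (.lit 2 * .var 4 * .var 3 * .var 3)) <|
        .seq (asg 5 (nextPowX R t)) (asg 3 (.lit 2 * .var 3)))
      .skip

variable {F : Type*} [Field F] {q : ℕ}

structure LevelState (φ : F ≃ Fin q) (V m : ℕ) (σ : RamState) : Prop
    extends HasTables φ V σ where
  reg_three : σ.reg 3 = 2 ^ m
  reg_four : σ.reg 4 = (2 ^ m) ^ m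
  reg_five : σ.reg 5 = levelBase R t m ^ m

variable {R t} {φ : F ≃ Fin q} {V m : ℕ} {σ : RamState}

theorem LevelState.setReg (h : LevelState R t φ V m σ) {x v : ℕ} (hx : 6 ≤ x) :
    LevelState R t φ V m (σ.setReg x v) := by
  refine ⟨h.1.setReg (by omega) (by omega), ?_, ?_, ?_⟩ <;> rw [setReg_reg_of_ne _ _ (by omega)]
  exacts [h.2, h.3, h.4]

theorem LevelState.setArr (h : LevelState R t φ V m σ) {a i v : ℕ} (ha : 2 ≤ a) :
    LevelState R t φ V m (σ.setArr a i v) :=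
  ⟨h.1.setArr ha, h.2, h.3, h.4⟩

theorem levelProg_run (hR : 0 < R) (hσ : HasTables φ V σ) (hV : q < V)
    (h0 : 2 * (R * levelWidth R t 0) ≤ q) (h3 : σ.arr 3 0 = 0) (h4 : σ.arr 4 0 = 0) :
    LevelState R t φ V (level R t q q) ((levelProg R t).run σ).1 ∧
      ((levelProg R t).run σ).1.arr 3 0 = 0 ∧ ((levelProg R t).run σ).1.arr 4 0 = 0 := by
  have hq1 : 1 < V := by
    have := levelWidth_lt hR h0
    omega
  rw [levelProg, run_seq, hσ.run_asg 3 (eval_one _) hq1]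
  have k1 : HasTables φ V (σ.setReg 3 1) := hσ.setReg (by omega) (by omega)
  rw [run_seq, k1.run_asg 4 (eval_one _) hq1]
  have k2 : HasTables φ V ((σ.setReg 3 1).setReg 4 1) := k1.setReg (by omega) (by omega)
  rw [run_seq, k2.run_asg 5 (eval_one _) hq1]
  have k3 : HasTables φ V (((σ.setReg 3 1).setReg 4 1).setReg 5 1) :=
    k2.setReg (by omega) (by omega)
  refine k3.run_lp (fun i τ => LevelState R t φ V (level R t q i) τ ∧ τ.arr 3 0 = 0 ∧
    τ.arr 4 0 = 0) k3.reg_zero hV ⟨⟨k3, ?_, ?_, ?_⟩, h3, h4⟩ ?_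
  · simp [setReg_reg, level]
  · simp [setReg_reg, level]
  · simp [level]
  · rintro i hi τ' ⟨hτ', h3', h4'⟩
    have hτ := hτ'.setReg (x := 6) (v := i) le_rfl
    set τ := τ'.setReg 6 i with hτdef
    have h3τ : τ.arr 3 0 = 0 := h3'
    have h4τ : τ.arr 4 0 = 0 := h4'
    set l := level R t q i with hl
    have hpow : (nextPowX R t).eval τ = levelBase R t (l + 1) ^ (l + 1) := by
      rw [levelBase_pow_succ, nextPowX, eval_mul, eval_mul, eval_mul, eval_lit, eval_var, eval_var,
        hτ.reg_three, hτ.reg_five]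
    have hsize : (nextSizeX R t).eval τ = 2 * (R * levelWidth R t (l + 1)) := by
      rw [nextSizeX, eval_mul, eval_mul, eval_lit, hpow, eval_powX, eval_mul, eval_lit, eval_var,
        hτ.reg_three, levelWidth, pow_succ' 2 l]
      ring
    have hcond : (RamExpr.var 0 + 1 - nextSizeX R t).eval τ ≠ 0 ↔
        2 * (R * levelWidth R t (l + 1)) ≤ q := by
      rw [eval_sub, hsize, eval_add, eval_var, hτ.reg_zero, eval_one]
      omega
    rw [run_ite]
    by_cases hle : 2 * (R * levelWidth R t (l + 1)) ≤ q
    · have hw := (levelWidth_lt hR hle).trans hV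
      -- Registers `4` and `5` are updated from the old value of `2 ^ m`, so register `3` changes
      -- last.
      rw [if_pos (hcond.2 hle), level, ← hl, if_pos hle, run_seq,
        hτ.run_asg 4 (v := (2 ^ (l + 1)) ^ (l + 1)) ?_ ((two_pow_pow_le_width hR).trans_lt hw)]
      · have m1 : HasTables φ V (τ.setReg 4 ((2 ^ (l + 1)) ^ (l + 1))) :=
          hτ.1.setReg (by omega) (by omega)
        rw [run_seq, m1.run_asg 5 (v := levelBase R t (l + 1) ^ (l + 1)) ?_
          ((levelBase_pow_le_width hR).trans_lt hw)]
        · have m2 := m1.setReg (x := 5) (v := levelBase R t (l + 1) ^ (l + 1)) (by omega) (by omega)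
          rw [m2.run_asg 3 (v := 2 ^ (l + 1)) ?_ ((two_pow_le_width hR).trans_lt hw)]
          · refine ⟨⟨m2.setReg (by omega) (by omega), ?_, ?_, ?_⟩, h3τ, h4τ⟩
            · simp
            · simp [setReg_reg]
            · simp [setReg_reg]
          · rw [eval_mul, eval_lit, eval_var, setReg_reg_of_ne _ _ (by omega),
              setReg_reg_of_ne _ _ (by omega), hτ.reg_three, pow_succ']
        · rw [← hpow]
          simp [nextPowX, setReg_reg]
      · rw [two_pow_pow_succ, eval_mul, eval_mul, eval_mul, eval_lit, eval_var, eval_var,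
          hτ.reg_three, hτ.reg_four]
    · rw [if_neg (fun h => hle (hcond.1 h)), level, ← hl, if_neg hle]
      exact ⟨hτ, h3τ, h4τ⟩

theorem clamped_levelProg : Clamped (levelProg R t) :=
  .seq (.assign _ _ (by omega)) <| .seq (.assign _ _ (by omega)) <|
    .seq (.assign _ _ (by omega)) <| .loop _ _ (by omega) <| .ite _
      (.seq (.assign _ _ (by omega)) <| .seq (.assign _ _ (by omega)) (.assign _ _ (by omega))) .skip

end LevelProg

/-! ### Tabulating the Behrend-type set -/

section Tables

theorem digit_succ (D i β : ℕ) : digit D (i + 1) β = digit D i (β / D) := by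
  rw [digit, digit, Nat.div_div_eq_div_mul, pow_succ']

theorem digit_eq_zero {D m β : ℕ} (h : β < D ^ m) : digit D m β = 0 := by
  rw [digit, Nat.div_eq_of_lt h, Nat.zero_mod]

/-- Horner's rule: the entry for `β` depends only on the entry for `β / D` and the last digit. Since
`β < D ^ m`, the digit shifted in at the top is zero, so the same `m` serves on both sides. -/
theorem rebase_div {m D W β : ℕ} (h : β < D ^ m) :
    rebase m D W β = rebase m D W (β / D) * W + β % D := by
  have h1 : rebase m D W β = ∑ i ∈ Finset.range (m + 1), digit D i β * W ^ i := by
    rw [Finset.sum_range_succ, digit_eq_zero h, zero_mul, add_zero, rebase]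
  rw [h1, Finset.sum_range_succ', rebase, Finset.sum_mul]
  congr 1
  · exact Finset.sum_congr rfl fun i _ => by rw [digit_succ, pow_succ, mul_assoc]
  · simp [digit]

theorem digitNorm_div {m D β : ℕ} (h : β < D ^ m) :
    digitNorm m D β = digitNorm m D (β / D) + (β % D) ^ 2 := by
  have h1 : digitNorm m D β = ∑ i ∈ Finset.range (m + 1), digit D i β ^ 2 := by
    rw [Finset.sum_range_succ, digit_eq_zero h, zero_pow two_ne_zero, add_zero, digitNorm]
  rw [h1, Finset.sum_range_succ', digitNorm]
  congr 1
  · exact Finset.sum_congr rfl fun i _ => by rw [digit_succ]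
  · simp [digit]

theorem digit_zero (D i : ℕ) : digit D i 0 = 0 := by simp [digit]

theorem rebase_zero (m D W : ℕ) : rebase m D W 0 = 0 := by simp [rebase, digit_zero]

theorem digitNorm_zero (m D : ℕ) : digitNorm m D 0 = 0 := by simp [digitNorm, digit_zero]

variable (R t : ℕ)

/-- Tabulates `rebase` and `digitNorm` in the arrays `3` and `4`. -/
def tableProg : RamProg :=
  lp 6 (.var 4) <|
    .seq (sto 3 (.var 6) (.get 3 (.var 6 / .var 3) * (.lit (2 * R ^ t) * .var 3) + .var 6 % .var 3))
      (sto 4 (.var 6) (.get 4 (.var 6 / .var 3) + powX (.var 6 % .var 3) 2))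

theorem clamped_tableProg : Clamped (tableProg R t) :=
  .loop _ _ (by omega) <| .seq (.store _ _ _) (.store _ _ _)

variable {F : Type*} [Field F] {q : ℕ}

structure TableState (φ : F ≃ Fin q) (V m : ℕ) (σ : RamState) : Prop
    extends LevelState R t φ V m σ where
  arr_three : ∀ β < (2 ^ m) ^ m, σ.arr 3 β = rebase m (2 ^ m) (levelBase R t m) β
  arr_four : ∀ β < (2 ^ m) ^ m, σ.arr 4 β = digitNorm m (2 ^ m) β

variable {R t} {φ : F ≃ Fin q} {V m : ℕ} {σ : RamState}

theorem TableState.setReg (h : TableState R t φ V m σ) {x v : ℕ} (hx : 6 ≤ x) :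
    TableState R t φ V m (σ.setReg x v) := ⟨h.1.setReg hx, h.2, h.3⟩

theorem TableState.setArr (h : TableState R t φ V m σ) {i v : ℕ} :
    TableState R t φ V m (σ.setArr 2 i v) :=
  ⟨h.1.setArr le_rfl, by rw [setArr_arr_of_ne _ _ _ (by omega)]; exact h.2,
    by rw [setArr_arr_of_ne _ _ _ (by omega)]; exact h.3⟩

theorem tableProg_run (hR : 0 < R) (hσ : LevelState R t φ V m σ) (hV : q < V)
    (hm : 2 * (R * levelWidth R t m) ≤ q) (h3 : σ.arr 3 0 = 0) (h4 : σ.arr 4 0 = 0) :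
    TableState R t φ V m ((tableProg R t).run σ).1 := by
  have hw := (levelWidth_lt hR hm).trans hV
  have hD : 0 < 2 ^ m := Nat.two_pow_pos m
  have h := hσ.run_lp (fun i τ => LevelState R t φ V m τ ∧ τ.arr 3 0 = 0 ∧ τ.arr 4 0 = 0 ∧
    (∀ β < i, τ.arr 3 β = rebase m (2 ^ m) (levelBase R t m) β) ∧
    (∀ β < i, τ.arr 4 β = digitNorm m (2 ^ m) β)) (x := 6) (e := .var 4)
    (p := .seq (sto 3 (.var 6)
      (.get 3 (.var 6 / .var 3) * (.lit (2 * R ^ t) * .var 3) + .var 6 % .var 3))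
      (sto 4 (.var 6) (.get 4 (.var 6 / .var 3) + powX (.var 6 % .var 3) 2)))
    hσ.reg_four ((two_pow_pow_le_width hR).trans_lt hw)
    ⟨hσ, h3, h4, fun _ h => absurd h (Nat.not_lt_zero _), fun _ h => absurd h (Nat.not_lt_zero _)⟩ ?_
  · exact ⟨h.1, h.2.2.2.1, h.2.2.2.2⟩
  · rintro i hi τ' ⟨hτ', h30, h40, h3', h4'⟩
    have hτ := hτ'.setReg (x := 6) (v := i) le_rfl
    have hτ6 : (τ'.setReg 6 i).reg 6 = i := by simp
    set τ := τ'.setReg 6 i with hτdef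
    -- For `i = 0` the table refers to the entry being written, whose initial value zero is already
    -- correct. This is why the invariant keeps track of entry `0`.
    have hdiv : i / 2 ^ m < i ∨ i = 0 := by
      rcases Nat.eq_zero_or_pos i with h0 | h0
      · exact Or.inr h0
      · refine Or.inl (Nat.div_lt_self h0 ?_)
        have hm0 : m ≠ 0 := by
          rintro rfl
          simp at hi
          omega
        exact Nat.one_lt_two_pow hm0
    have v3 : τ.arr 3 (i / 2 ^ m) = rebase m (2 ^ m) (levelBase R t m) (i / 2 ^ m) := by
      rcases hdiv with h | h
      · exact h3' _ h
      · rw [h, Nat.zero_div, rebase_zero]; exact h30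
    have v4 : τ.arr 4 (i / 2 ^ m) = digitNorm m (2 ^ m) (i / 2 ^ m) := by
      rcases hdiv with h | h
      · exact h4' _ h
      · rw [h, Nat.zero_div, digitNorm_zero]; exact h40
    rw [run_seq, hτ.run_sto 3 (j := i) (v := rebase m (2 ^ m) (levelBase R t m) i)]
    · have k1 := hτ.setArr (a := 3) (i := i) (v := rebase m (2 ^ m) (levelBase R t m) i) (by omega)
      rw [k1.run_sto 4 (j := i) (v := digitNorm m (2 ^ m) i)]
      · refine ⟨k1.setArr (by omega), ?_, ?_, ?_, ?_⟩
        · rw [setArr_arr_of_ne _ _ _ (by omega), setArr_arr]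
          split_ifs with h
          · rw [← h.2, rebase_zero]
          · exact h30
        · rw [setArr_arr]
          split_ifs with h
          · rw [← h.2, digitNorm_zero]
          · exact h40
        · intro β hβ
          rw [setArr_arr_of_ne _ _ _ (by omega), setArr_arr]
          split_ifs with h
          · rw [h.2]
          · exact h3' β (by omega)
        · intro β hβ
          rw [setArr_arr]
          split_ifs with h
          · rw [h.2]
          · exact h4' β (by omega)
      · exact hτ6
      · simp only [eval_add, eval_get, eval_div, eval_var, eval_powX, eval_mod, setArr_reg, hτ6,
          hτ.reg_three]
        rw [setArr_arr_of_ne _ _ _ (by omega), v4, ← digitNorm_div hi]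
      · exact (digitNorm_le hD Nat.lt_two_pow_self.le i).trans_lt
          ((two_pow_cube_le_width hR).trans_lt hw)
    · exact hτ6
    · simp only [eval_add, eval_get, eval_div, eval_var, eval_mul, eval_lit, eval_mod, hτ6,
        hτ.reg_three]
      rw [v3, rebase_div hi]
      rfl
    · exact (rebase_lt hD (two_pow_le_levelBase hR) i).trans ((levelBase_pow_le_width hR).trans_lt hw)

end Tables

/-! ### Searching for the two special blocks -/

section Search

/-- The labels `y` of two blocks of `R` points, all at least `B`, carry a dependence `c` of
weight at most `d`. -/
structure IsSpecial {F : Type*} [Field F] [DecidableEq F] {q : ℕ} (φ : F ≃ Fin q) (R δ d B : ℕ)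
    (y : ℕ → ℕ) (c : ℕ → F) : Prop where
  le : ∀ j < 2 * R, B ≤ y j
  inj : ∀ j < 2 * R, ∀ k < j, y j ≠ y k
  loc : ∀ a < δ - 1, ∑ j ∈ Finset.range R, c j * decode φ (y j) ^ a = 0
  glob : ∀ a < d - 1, ∑ j ∈ Finset.range (2 * R), c j * decode φ (y j) ^ a = 0
  weight_le : ((Finset.range (2 * R)).filter fun j => c j ≠ 0).card ≤ d
  one_le_weight : 1 ≤ ((Finset.range (2 * R)).filter fun j => c j ≠ 0).card

variable (R t δ d : ℕ)

/-- The candidate numbered `ix` has as its digits in base `q` the labels of zero and one, the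
`2 * R` points, and their coefficients. -/
def zeroX (ix : RamExpr) : RamExpr := digX (.var 0) 0 ix

def oneX (ix : RamExpr) : RamExpr := digX (.var 0) 1 ix

def pointX (ix : RamExpr) (j : ℕ) : RamExpr := digX (.var 0) (2 + j) ix

def coeffX (ix : RamExpr) (j : ℕ) : RamExpr := digX (.var 0) (2 + 2 * R + j) ix

def widthX : RamExpr := .lit ((t + 2) * R ^ t) * .var 5 * powX (.var 3) 3

def dependenceX (ix : RamExpr) (k a : ℕ) : RamExpr :=
  neX (fsumX (zeroX ix) k fun j => fmulX (coeffX R ix j) (fpowX (oneX ix) (pointX ix j) a))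
    (zeroX ix)

def weightX (ix : RamExpr) : RamExpr :=
  sumX (2 * R) fun j => 1 - eqX (coeffX R ix j) (zeroX ix)

/-- Zero precisely if the candidate numbered `ix` is suitable. -/
def defectX (ix : RamExpr) : RamExpr :=
  neX (faddX (zeroX ix) (zeroX ix)) (zeroX ix) + neX (fmulX (oneX ix) (oneX ix)) (oneX ix) +
  eqX (oneX ix) (zeroX ix) +
  sumX (2 * R) (fun j => .lit R * widthX R t - pointX ix j) +
  sumX (2 * R) (fun j => sumX j fun k => eqX (pointX ix j) (pointX ix k)) +
  sumX (δ - 1) (fun a => dependenceX R ix R a) +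
  sumX (d - 1) (fun a => dependenceX R ix (2 * R) a) +
  (weightX R ix - .lit d) + (1 - weightX R ix)

variable {F : Type*} [Field F] {q : ℕ}

/-- The candidate numbered `x` is suitable. -/
def IsCandidate [DecidableEq F] (φ : F ≃ Fin q) (B x : ℕ) : Prop :=
  decode φ (digit q 0 x) = 0 ∧ decode φ (digit q 1 x) = 1 ∧
  IsSpecial φ R δ d B (fun j => digit q (2 + j) x) fun j => decode φ (digit q (2 + 2 * R + j) x)

variable {R t δ d} {φ : F ≃ Fin q} {V m : ℕ} {σ : RamState}

theorem val_eq_val_iff {F : Type*} {q : ℕ} {φ : F ≃ Fin q} {x y : F} : (φ x : ℕ) = φ y ↔ x = y := by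
  rw [Fin.val_inj, φ.injective.eq_iff]

theorem LevelState.eval_widthX (h : LevelState R t φ V m σ) :
    (widthX R t).eval σ = levelWidth R t m := by
  rw [widthX, eval_mul, eval_mul, eval_lit, eval_var, eval_powX, eval_var, h.reg_three, h.reg_five,
    levelWidth]

theorem HasTables.eval_digX_zero (h : HasTables φ V σ) (hq : 0 < q) {ix : RamExpr} {x : ℕ}
    (hx : ix.eval σ = x) (i : ℕ) :
    (digX (.var 0) i ix).eval σ = φ (decode φ (digit q i x)) := by
  rw [eval_digX, eval_var, h.reg_zero, hx, val_decode (digit_lt hq _ _)]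

/-- The labelling of the field is arbitrary, so the labels of zero and one are part of the guess.
They are recognised by `ζ + ζ = ζ`, `ω * ω = ω` and `ω ≠ ζ`. -/
theorem eval_defectX [DecidableEq F] (hσ : LevelState R t φ V m σ) (hq : 0 < q) {ix : RamExpr} {x : ℕ}
    (hx : ix.eval σ = x) :
    (defectX R t δ d ix).eval σ = 0 ↔ IsCandidate R δ d φ (R * levelWidth R t m) x := by
  have hdig := hσ.eval_digX_zero hq hx
  set ζ := decode φ (digit q 0 x) with hζ
  set ω := decode φ (digit q 1 x) with hω
  set y : ℕ → ℕ := fun j => digit q (2 + j) x with hy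
  set c : ℕ → F := fun j => decode φ (digit q (2 + 2 * R + j) x) with hc
  have ez : (zeroX ix).eval σ = φ ζ := hdig 0
  have eo : (oneX ix).eval σ = φ ω := hdig 1
  have ep : ∀ j, (pointX ix j).eval σ = φ (decode φ (y j)) := fun j => hdig _
  have ep' : ∀ j, (pointX ix j).eval σ = y j := fun j => by
    rw [ep, val_decode (digit_lt hq _ _)]
  have ec : ∀ j, (coeffX R ix j).eval σ = φ (c j) := fun j => hdig _
  have edep : ∀ k a, (dependenceX R ix k a).eval σ = 0 ↔
      ζ + ∑ j ∈ Finset.range k, c j * (ω * decode φ (y j) ^ a) = ζ := fun k a => by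
    rw [dependenceX, eval_neX_eq_zero, ez, hσ.eval_fsumX ez
      (x := fun j => c j * (ω * decode φ (y j) ^ a)) fun j _ =>
        hσ.eval_fmulX (ec j) (hσ.eval_fpowX eo (ep j) a), val_eq_val_iff]
  have ew : (weightX R ix).eval σ = ((Finset.range (2 * R)).filter fun j => c j ≠ ζ).card := by
    rw [weightX, eval_sumX, Finset.card_filter]
    refine Finset.sum_congr rfl fun j _ => ?_
    rw [eval_sub, eval_one, eval_eqX, ec, ez]
    by_cases h : c j = ζ
    · rw [if_pos (val_eq_val_iff.2 h), if_neg (not_not.2 h)]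
    · rw [if_neg (fun h' => h (val_eq_val_iff.1 h')), if_pos h]
  have hall : (defectX R t δ d ix).eval σ = 0 ↔
      ζ + ζ = ζ ∧ ω * ω = ω ∧ ω ≠ ζ ∧ (∀ j < 2 * R, R * levelWidth R t m ≤ y j) ∧
      (∀ j < 2 * R, ∀ k < j, y j ≠ y k) ∧
      (∀ a < δ - 1, ζ + ∑ j ∈ Finset.range R, c j * (ω * decode φ (y j) ^ a) = ζ) ∧
      (∀ a < d - 1, ζ + ∑ j ∈ Finset.range (2 * R), c j * (ω * decode φ (y j) ^ a) = ζ) ∧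
      ((Finset.range (2 * R)).filter fun j => c j ≠ ζ).card ≤ d ∧
      1 ≤ ((Finset.range (2 * R)).filter fun j => c j ≠ ζ).card := by
    simp only [defectX, eval_add, Nat.add_eq_zero_iff, eval_neX_eq_zero, and_assoc]
    rw [hσ.eval_faddX ez ez, ez, val_eq_val_iff, hσ.eval_fmulX eo eo, eo, val_eq_val_iff]
    refine and_congr Iff.rfl (and_congr Iff.rfl (and_congr ?_ (and_congr ?_ (and_congr ?_
      (and_congr ?_ (and_congr ?_ (and_congr ?_ ?_)))))))
    · rw [eval_eqX, eo, ez]; simp [val_eq_val_iff]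
    · rw [eval_sumX, Finset.sum_eq_zero_iff]
      simp only [Finset.mem_range, eval_sub, eval_mul, eval_lit, hσ.eval_widthX, ep',
        Nat.sub_eq_zero_iff_le]
    · rw [eval_sumX, Finset.sum_eq_zero_iff]
      simp only [Finset.mem_range, eval_sumX, Finset.sum_eq_zero_iff, eval_eqX, ep']
      simp
    · rw [eval_sumX, Finset.sum_eq_zero_iff]
      simp only [Finset.mem_range, edep]
    · rw [eval_sumX, Finset.sum_eq_zero_iff]
      simp only [Finset.mem_range, edep]
    · rw [eval_sub, ew, eval_lit, Nat.sub_eq_zero_iff_le]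
    · rw [eval_sub, ew, eval_one, Nat.sub_eq_zero_iff_le]
  rw [hall]
  constructor
  · rintro ⟨h1, h2, h3, h4, h5, h6, h7, h8, h9⟩
    have hζ0 : ζ = 0 := by simpa using h1
    have hω1 : ω = 1 := by
      have : ω ≠ 0 := hζ0 ▸ h3
      exact mul_left_cancel₀ this (by rw [h2, mul_one])
    rw [hζ0] at h6 h7 h8 h9
    simp only [hω1, one_mul, zero_add] at h6 h7
    exact ⟨hζ0, hω1, h4, h5, h6, h7, h8, h9⟩
  · rintro ⟨hζ0, hω1, h⟩
    have hζ0 : ζ = 0 := hζ0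
    have hω1 : ω = 1 := hω1
    rw [hζ0, hω1]
    simp only [one_mul, zero_add]
    exact ⟨trivial, trivial, one_ne_zero, h.le, h.inj, h.loc, h.glob, h.weight_le, h.one_le_weight⟩

variable (R t δ d) in
/-- Puts the number of a suitable candidate into register `7`. -/
def searchProg : RamProg :=
  lp 6 (powX (.var 0) (4 * R + 2)) <|
    .ite (1 - defectX R t δ d (.var 6)) (asg 7 (.var 6)) .skip

theorem clamped_searchProg : Clamped (searchProg R t δ d) :=
  .loop _ _ (by omega) <| .ite _ (.assign _ _ (by omega)) .skip

/-- Register `7` is overwritten only by suitable candidates, so once one has been met its content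
stays suitable. -/
theorem searchProg_run [DecidableEq F] (hσ : TableState R t φ V m σ) (hq : 0 < q) (hV : q ^ (4 * R + 2) < V)
    (hex : ∃ x < q ^ (4 * R + 2), IsCandidate R δ d φ (R * levelWidth R t m) x) :
    TableState R t φ V m ((searchProg R t δ d).run σ).1 ∧
      IsCandidate R δ d φ (R * levelWidth R t m) (((searchProg R t δ d).run σ).1.reg 7) := by
  have h := hσ.run_lp (fun i τ => TableState R t φ V m τ ∧
    ((∃ x < i, IsCandidate R δ d φ (R * levelWidth R t m) x) →
      IsCandidate R δ d φ (R * levelWidth R t m) (τ.reg 7))) (x := 6)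
    (e := powX (.var 0) (4 * R + 2)) (N := q ^ (4 * R + 2))
    (p := .ite (1 - defectX R t δ d (.var 6)) (asg 7 (.var 6)) .skip)
    (by rw [eval_powX, eval_var, hσ.reg_zero]) hV
    ⟨hσ, fun ⟨_, h, _⟩ => absurd h (Nat.not_lt_zero _)⟩ ?_
  · exact ⟨h.1, h.2 hex⟩
  · rintro i hi τ' ⟨hτ', hI⟩
    have hτ := hτ'.setReg (x := 6) (v := i) le_rfl
    have hτ6 : (RamExpr.var 6).eval (τ'.setReg 6 i) = i := by simp
    have hτ7 : (τ'.setReg 6 i).reg 7 = τ'.reg 7 := setReg_reg_of_ne _ _ (by omega)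
    set τ := τ'.setReg 6 i with hτdef
    have hdef := eval_defectX (δ := δ) (d := d) hτ.1 hq hτ6
    have hcond : (1 - defectX R t δ d (.var 6)).eval τ ≠ 0 ↔
        IsCandidate R δ d φ (R * levelWidth R t m) i := by
      rw [← hdef, eval_sub, eval_one]
      omega
    rw [run_ite]
    split_ifs with hc
    · rw [hτ.run_asg 7 hτ6 (hi.trans hV)]
      refine ⟨hτ.setReg (by omega), fun _ => ?_⟩
      rw [setReg_reg_self]
      exact hcond.1 hc
    · refine ⟨hτ, fun ⟨x, hx, hcx⟩ => ?_⟩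
      have hne : x ≠ i := fun h => hc (hcond.2 (h ▸ hcx))
      have := hI ⟨x, by omega, hcx⟩
      rw [← hτ7] at this
      exact this

theorem exists_isCandidate [DecidableEq F] {y : ℕ → ℕ} {c : ℕ → F} {B : ℕ}
    (hy : ∀ j < 2 * R, y j < q) (h : IsSpecial φ R δ d B y c) :
    ∃ x < q ^ (4 * R + 2), IsCandidate R δ d φ B x := by
  obtain ⟨x, hx, hdig⟩ := exists_digit_eq (b := q) (k := 4 * R + 2) (fun i =>
    if i = 0 then (φ 0 : ℕ) else if i = 1 then (φ 1 : ℕ) else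
      if i < 2 + 2 * R then y (i - 2) else (φ (c (i - 2 - 2 * R)) : ℕ)) (by
    intro i hi
    split_ifs with h1 h2 h3
    · exact (φ _).2
    · exact (φ _).2
    · exact hy _ (by omega)
    · exact (φ _).2)
  have hdy : ∀ j < 2 * R, digit q (2 + j) x = y j := fun j hj => by
    rw [hdig _ (by omega), if_neg (by omega), if_neg (by omega), if_pos (by omega),
      Nat.add_sub_cancel_left]
  have hdc : ∀ j < 2 * R, decode φ (digit q (2 + 2 * R + j) x) = c j := fun j hj => by
    rw [hdig _ (by omega), if_neg (by omega), if_neg (by omega), if_neg (by omega), decode_val]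
    congr 1
    omega
  have hw : ((Finset.range (2 * R)).filter fun j => decode φ (digit q (2 + 2 * R + j) x) ≠ 0) =
      (Finset.range (2 * R)).filter fun j => c j ≠ 0 :=
    Finset.filter_congr fun j hj => by rw [hdc j (Finset.mem_range.1 hj)]
  have hsum : ∀ k ≤ 2 * R, ∀ a, ∑ j ∈ Finset.range k, decode φ (digit q (2 + 2 * R + j) x) *
      decode φ (digit q (2 + j) x) ^ a = ∑ j ∈ Finset.range k, c j * decode φ (y j) ^ a :=
    fun k hk a => Finset.sum_congr rfl fun j hj => by
      have := Finset.mem_range.1 hj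
      rw [hdc j (by omega), hdy j (by omega)]
  refine ⟨x, hx, ?_, ?_, ?_, ?_, ?_, ?_, ?_, ?_⟩
  · rw [hdig 0 (by omega), if_pos rfl, decode_val]
  · rw [hdig 1 (by omega), if_neg one_ne_zero, if_pos rfl, decode_val]
  · intro j hj; rw [hdy j hj]; exact h.le j hj
  · intro j hj k hk; rw [hdy j hj, hdy k (by omega)]; exact h.inj j hj k hk
  · intro a ha; rw [hsum R (by omega)]; exact h.loc a ha
  · intro a ha; rw [hsum _ le_rfl]; exact h.glob a ha
  · rw [hw]; exact h.weight_le
  · rw [hw]; exact h.one_le_weight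

end Search

/-! ### Writing the parity-check matrix -/

section Fill

variable (R t δ d : ℕ)

def blocksX : RamExpr := powX (.var 4) (t + 1)

/-- The label of point `p` of block `b`. -/
def labelX (b p : RamExpr) : RamExpr :=
  ltX b (blocksX t) * (p * widthX R t +
    ((.get 3 (digX (.var 4) 0 b) + .get 4 (digX (.var 4) 0 b) * .var 5) * powX p t +
      sumX t fun j => digX (.var 4) (j + 1) b * powX p j)) +
  (1 - ltX b (blocksX t)) * selX (2 * R) ((b - blocksX t) * .lit R + p) fun j => pointX (.var 7) j

def colsX : RamExpr := (blocksX t + .lit 2) * .lit R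

def rowsX : RamExpr := (blocksX t + .lit 2 + 1) * .lit (d - 1)

/-- Writes the matrix into array `2`. -/
def fillProg : RamProg :=
  lp 6 (rowsX t d * colsX R t) <|
    .ite (eqX (.var 6 / colsX R t / .lit (d - 1)) (.var 6 % colsX R t / .lit R) *
        ltX (.var 6 / colsX R t % .lit (d - 1)) (.lit (δ - 1)) +
        eqX (.var 6 / colsX R t / .lit (d - 1)) (blocksX t + .lit 2))
      (sto 2 (.var 6) (selX (d - 1) (.var 6 / colsX R t % .lit (d - 1)) fun a =>
        fpowX (oneX (.var 7))
          (labelX R t (.var 6 % colsX R t / .lit R) (.var 6 % colsX R t % .lit R)) a))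
      (sto 2 (.var 6) (zeroX (.var 7)))

theorem clamped_fillProg : Clamped (fillProg R t δ d) :=
  .loop _ _ (by omega) <| .ite _ (.store _ _ _) (.store _ _ _)

variable {F : Type*} [Field F] {q : ℕ}

/-- The points of the blocks, the special blocks being given by the candidate numbered `x`. -/
def blockPoints (φ : F ≃ Fin q) (m x b p : ℕ) : F :=
  decode φ (blockLabel R t m (2 ^ m) (levelBase R t m) (levelWidth R t m)
    (fun j => digit q (2 + j) x) b p)

variable {R t δ d} {φ : F ≃ Fin q} {V m x : ℕ} {σ : RamState}

theorem blockValue_lt_levelWidth {R t m : ℕ} : ∀ e, ∀ p < R,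
    blockValue t m (2 ^ m) (levelBase R t m) e p < levelWidth R t m := fun _ _ hp =>
  blockValue_lt (Nat.two_pow_pos m) Nat.lt_two_pow_self.le (two_pow_le_levelBase (by omega)) hp

theorem blockLabel_lt_card (hq : 0 < q) (hm : 2 * (R * levelWidth R t m) ≤ q) {b p : ℕ}
    (hp : p < R) : blockLabel R t m (2 ^ m) (levelBase R t m) (levelWidth R t m)
      (fun j => digit q (2 + j) x) b p < q := by
  rcases lt_or_ge b (((2 ^ m) ^ m) ^ (t + 1)) with h | h
  · have := blockLabel_lt (y := fun j => digit q (2 + j) x) blockValue_lt_levelWidth hp h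
    omega
  · rw [blockLabel, if_neg (by omega)]
    exact digit_lt hq _ _

theorem TableState.eval_blocksX (h : TableState R t φ V m σ) :
    (blocksX t).eval σ = levelBlocks t m := by
  rw [blocksX, eval_powX, eval_var, h.reg_four, levelBlocks]

theorem TableState.eval_labelX (h : TableState R t φ V m σ) (h7 : σ.reg 7 = x) {bX pX : RamExpr} {b p : ℕ} (hb : bX.eval σ = b) (hp : pX.eval σ = p)
    (hbl : b < levelBlocks t m + 2) (hpl : p < R) :
    (labelX R t bX pX).eval σ = blockLabel R t m (2 ^ m) (levelBase R t m) (levelWidth R t m)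
      (fun j => digit q (2 + j) x) b p := by
  have hP : 0 < (2 ^ m) ^ m := by positivity
  simp only [labelX, eval_add, eval_mul, eval_sub, eval_one, eval_ltX, h.eval_blocksX, hb, hp,
    h.eval_widthX, eval_get, eval_digX, eval_var, h.reg_four, h.reg_five, eval_powX, eval_sumX]
  rw [h.arr_three _ (digit_lt hP _ _), h.arr_four _ (digit_lt hP _ _)]
  have hlb : levelBlocks t m = ((2 ^ m) ^ m) ^ (t + 1) := rfl
  by_cases hlt : b < levelBlocks t m
  · rw [if_pos hlt, blockLabel, if_pos (hlb ▸ hlt)]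
    simp [blockValue, behrend]
  · rw [if_neg hlt, blockLabel, if_neg (hlb ▸ hlt), zero_mul, zero_add, Nat.sub_zero, one_mul,
      eval_selX]
    · simp only [eval_add, eval_mul, eval_sub, h.eval_blocksX, hb, hp, eval_lit, pointX, eval_digX,
        eval_var, h.reg_zero, h7]
      rfl
    · simp only [eval_add, eval_mul, eval_sub, h.eval_blocksX, hb, hp, eval_lit]
      exact mul_add_lt_two_mul (by omega) hpl

theorem TableState.eval_colsX (h : TableState R t φ V m σ) :
    (colsX R t).eval σ = (levelBlocks t m + 2) * R := by
  rw [colsX, eval_mul, eval_add, h.eval_blocksX, eval_lit, eval_lit]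

theorem TableState.eval_rowsX (h : TableState R t φ V m σ) :
    (rowsX t d).eval σ = (levelBlocks t m + 2 + 1) * (d - 1) := by
  rw [rowsX, eval_mul, eval_add, eval_add, h.eval_blocksX, eval_lit, eval_lit, eval_one]

theorem fillProg_run [DecidableEq F] (hσ : TableState R t φ V m σ) (hq : 0 < q) (hR : 0 < R) (hd : 2 ≤ d)
    (hm : 2 * (R * levelWidth R t m) ≤ q) (hqV : q ≤ V) (h7 : σ.reg 7 = x)
    (hz : decode φ (digit q 0 x) = 0) (ho : decode φ (digit q 1 x) = 1)
    (hV : (levelBlocks t m + 2 + 1) * (d - 1) * ((levelBlocks t m + 2) * R) < V) :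
    TableState R t φ V m ((fillProg R t δ d).run σ).1 ∧
    ∀ (i : Fin ((levelBlocks t m + 2 + 1) * (d - 1))) (j : Fin ((levelBlocks t m + 2) * R)),
      ((fillProg R t δ d).run σ).1.arr 2 ((i : ℕ) * ((levelBlocks t m + 2) * R) + (j : ℕ)) =
        (φ (parityMatrix R δ d (levelBlocks t m + 2) (blockPoints R t φ m x) i j) : ℕ) := by
  set L := levelBlocks t m + 2 with hL
  have h := hσ.run_lp (fun k τ => TableState R t φ V m τ ∧ τ.reg 7 = x ∧
    ∀ (i : Fin ((L + 1) * (d - 1))) (j : Fin (L * R)), (i : ℕ) * (L * R) + (j : ℕ) < k →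
      τ.arr 2 ((i : ℕ) * (L * R) + (j : ℕ)) =
        (φ (parityMatrix R δ d L (blockPoints R t φ m x) i j) : ℕ)) (x := 6)
    (e := rowsX t d * colsX R t) (N := (L + 1) * (d - 1) * (L * R))
    (p := .ite (eqX (.var 6 / colsX R t / .lit (d - 1)) (.var 6 % colsX R t / .lit R) *
        ltX (.var 6 / colsX R t % .lit (d - 1)) (.lit (δ - 1)) +
        eqX (.var 6 / colsX R t / .lit (d - 1)) (blocksX t + .lit 2))
      (sto 2 (.var 6) (selX (d - 1) (.var 6 / colsX R t % .lit (d - 1)) fun a =>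
        fpowX (oneX (.var 7))
          (labelX R t (.var 6 % colsX R t / .lit R) (.var 6 % colsX R t % .lit R)) a))
      (sto 2 (.var 6) (zeroX (.var 7))))
    (by rw [eval_mul, hσ.eval_colsX, hσ.eval_rowsX]) hV
    ⟨hσ, h7, fun _ _ h => absurd h (Nat.not_lt_zero _)⟩ ?_
  · refine ⟨h.1, fun i j => h.2.2 i j ?_⟩
    calc (i : ℕ) * (L * R) + j < i * (L * R) + L * R := Nat.add_lt_add_left j.2 _
      _ = (i + 1) * (L * R) := by ring
      _ ≤ _ := Nat.mul_le_mul_right _ i.2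
  · rintro k hk τ' ⟨hτ', h7', hI⟩
    have hτ := hτ'.setReg (x := 6) (v := k) le_rfl
    have hτ6 : (RamExpr.var 6).eval (τ'.setReg 6 k) = k := by simp
    have hτ7 : (τ'.setReg 6 k).reg 7 = x := by rw [setReg_reg_of_ne _ _ (by omega), h7']
    have hI' : ∀ (i : Fin ((L + 1) * (d - 1))) (j : Fin (L * R)), (i : ℕ) * (L * R) + (j : ℕ) < k →
      (τ'.setReg 6 k).arr 2 ((i : ℕ) * (L * R) + (j : ℕ)) =
        (φ (parityMatrix R δ d L (blockPoints R t φ m x) i j) : ℕ) := hI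
    set τ := τ'.setReg 6 k with hτdef
    have hn : 0 < L * R := Nat.mul_pos (by omega) hR
    have hcol : k % (L * R) < L * R := Nat.mod_lt _ hn
    have hrow : k / (L * R) < (L + 1) * (d - 1) := Nat.div_lt_of_lt_mul (by rwa [mul_comm])
    have hb : k % (L * R) / R < L := Nat.div_lt_of_lt_mul (by rwa [mul_comm R])
    have ha : k / (L * R) % (d - 1) < d - 1 := Nat.mod_lt _ (by omega)
    have ebx : (RamExpr.var 6 % colsX R t / .lit R).eval τ = k % (L * R) / R := by
      rw [eval_div, eval_mod, hτ6, hτ.eval_colsX, eval_lit]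
    have epx : (RamExpr.var 6 % colsX R t % .lit R).eval τ = k % (L * R) % R := by
      rw [eval_mod, eval_mod, hτ6, hτ.eval_colsX, eval_lit]
    have erx : (RamExpr.var 6 / colsX R t / .lit (d - 1)).eval τ = k / (L * R) / (d - 1) := by
      rw [eval_div, eval_div, hτ6, hτ.eval_colsX, eval_lit]
    have eax : (RamExpr.var 6 / colsX R t % .lit (d - 1)).eval τ = k / (L * R) % (d - 1) := by
      rw [eval_mod, eval_div, hτ6, hτ.eval_colsX, eval_lit]
    have hlab : (labelX R t (.var 6 % colsX R t / .lit R) (.var 6 % colsX R t % .lit R)).eval τ =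
        φ (blockPoints R t φ m x (k % (L * R) / R) (k % (L * R) % R)) := by
      rw [hτ.eval_labelX hτ7 ebx epx hb (Nat.mod_lt _ hR), blockPoints,
        val_decode (blockLabel_lt_card hq hm (Nat.mod_lt _ hR))]
    have hτ7' : (RamExpr.var 7).eval τ = x := hτ7
    have eone : (oneX (.var 7)).eval τ = φ 1 := by
      rw [oneX, hτ.eval_digX_zero hq hτ7', ho]
    have ezero : (zeroX (.var 7)).eval τ = φ 0 := by
      rw [zeroX, hτ.eval_digX_zero hq hτ7', hz]
    set w := parityMatrix R δ d L (blockPoints R t φ m x) ⟨k / (L * R), hrow⟩ ⟨k % (L * R), hcol⟩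
      with hw
    have hrun : ((RamProg.ite (eqX (.var 6 / colsX R t / .lit (d - 1))
          (.var 6 % colsX R t / .lit R) *
        ltX (.var 6 / colsX R t % .lit (d - 1)) (.lit (δ - 1)) +
        eqX (.var 6 / colsX R t / .lit (d - 1)) (blocksX t + .lit 2))
      (sto 2 (.var 6) (selX (d - 1) (.var 6 / colsX R t % .lit (d - 1)) fun a =>
        fpowX (oneX (.var 7))
          (labelX R t (.var 6 % colsX R t / .lit R) (.var 6 % colsX R t % .lit R)) a))
      (sto 2 (.var 6) (zeroX (.var 7)))).run τ).1 = τ.setArr 2 k (φ w) := by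
      have hwV : (φ w : ℕ) < V := (φ w).2.trans_le hqV
      rw [run_ite]
      have hcond : (eqX (.var 6 / colsX R t / .lit (d - 1)) (.var 6 % colsX R t / .lit R) *
        ltX (.var 6 / colsX R t % .lit (d - 1)) (.lit (δ - 1)) +
        eqX (.var 6 / colsX R t / .lit (d - 1)) (blocksX t + .lit 2)).eval τ ≠ 0 ↔
          (k / (L * R) / (d - 1) = k % (L * R) / R ∧ k / (L * R) % (d - 1) < δ - 1) ∨
            k / (L * R) / (d - 1) = L := by
        rw [eval_add, eval_mul, eval_eqX, eval_ltX, eval_eqX, ebx, erx, eax, eval_lit, eval_add,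
          hτ.eval_blocksX, eval_lit, ← hL]
        split_ifs <;> simp_all
      by_cases hc : (k / (L * R) / (d - 1) = k % (L * R) / R ∧ k / (L * R) % (d - 1) < δ - 1) ∨
            k / (L * R) / (d - 1) = L
      · rw [if_pos (hcond.2 hc)]
        refine hτ.run_sto 2 hτ6 ?_ hwV
        have hlt : (RamExpr.var 6 / colsX R t % .lit (d - 1)).eval τ < d - 1 := by rw [eax]; exact ha
        rw [eval_selX _ _ hlt, eax, hτ.eval_fpowX eone hlab, one_mul, hw,
          parityMatrix, if_pos hc]
      · rw [if_neg (fun h => hc (hcond.1 h))]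
        refine hτ.run_sto 2 hτ6 ?_ hwV
        rw [ezero, hw, parityMatrix, if_neg hc]
    rw [hrun]
    refine ⟨hτ.setArr, hτ7, fun i j hij => ?_⟩
    rw [setArr_arr]
    split_ifs with he
    · have h1 : (i : ℕ) = k / (L * R) := by
        rw [← he.2, mul_comm (i : ℕ), Nat.mul_add_div hn, Nat.div_eq_of_lt j.2, add_zero]
      have h2 : (j : ℕ) = k % (L * R) := by
        rw [← he.2, mul_comm (i : ℕ), Nat.mul_add_mod, Nat.mod_eq_of_lt j.2]
      rw [hw]
      congr 3
      · exact Fin.ext h1.symm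
      · exact Fin.ext h2.symm
    · exact hI' i j (by
        have : ¬ (i : ℕ) * (L * R) + j = k := fun h => he ⟨rfl, h⟩
        omega)

end Fill

/-! ### The codes are optimal -/

section Optimality

variable {F : Type*} [Field F] [DecidableEq F] {q : ℕ} {φ : F ≃ Fin q} {R δ d r m x : ℕ}

/-- With `t = δ / 2` rounded down, sharing at most `t` points is the pair condition. For odd `δ` the
equality case defining a triangle cannot occur; for even `δ` it means sides of exactly `t` points.
-/
theorem isOptimalLRC_blockPoints (hδ : 2 ≤ δ) (hd₁ : 3 * δ + 1 ≤ d) (hd₂ : d ≤ 4 * δ)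
    (hr : d ≤ r + δ) (hR : R = r + δ - 1) (hq : 0 < q)
    (hm : 2 * (R * levelWidth R (δ / 2) m) ≤ q)
    (hx : IsCandidate R δ d φ (R * levelWidth R (δ / 2) m) x) :
    IsOptimalLRC (codeOf (parityMatrix R δ d (levelBlocks (δ / 2) m + 2)
      (blockPoints R (δ / 2) φ m x))) d r δ := by
  have hR0 : 0 < R := by omega
  have hD : 0 < 2 ^ m := Nat.two_pow_pos m
  have hsp := hx.2.2
  set y : ℕ → ℕ := fun j => digit q (2 + j) x with hy
  set t := δ / 2 with ht
  set M := levelWidth R t m with hMdef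
  have hyinj : ∀ j < 2 * R, ∀ k < 2 * R, y j = y k → j = k := by
    intro j hj k hk h
    rcases lt_trichotomy j k with h' | h' | h'
    · exact absurd h.symm (hsp.inj k hk j h')
    · exact h'
    · exact absurd h (hsp.inj j hj k h')
  have hM : ∀ e, ∀ p < R, blockValue t m (2 ^ m) (levelBase R t m) e p < M :=
    blockValue_lt_levelWidth
  have hW : 2 * R ^ t * 2 ^ m ≤ levelBase R t m := le_rfl
  have hlab : ∀ b, ∀ p < R, blockLabel R t m (2 ^ m) (levelBase R t m) M y b p < q :=
    fun b p hp => blockLabel_lt_card hq hm hp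
  have hco : ∀ b b', coincidences R (blockPoints R t φ m x) b b' =
      coincidences R (blockLabel R t m (2 ^ m) (levelBase R t m) M y) b b' := fun b b' =>
    coincidences_comp decode_injOn (hlab b) (hlab b')
  refine isOptimalLRC_parityMatrix hδ hd₁ hd₂ hr hR (by omega) ?_ ?_ ?_ ?_
  · intro b hb p hp p' hp' h
    exact injective_blockLabel hM hyinj b hb p hp p' hp'
      (decode_injOn _ (hlab b p hp) _ (hlab b p' hp') h)
  · intro b hb b' hb' hne
    rw [hco]
    have := card_coincidences_blockLabel_le hR0 hD hW hM hyinj hsp.le hb hb' hne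
    omega
  · intro b₁ h₁ b₂ h₂ b₃ h₃ h12 h13 h23 c12 c13 c23
    rw [hco] at c12 c13 c23 ⊢
    rw [hco]
    exact not_disjoint_coincidences_blockLabel (by omega) hD hW hM hyinj hsp.le h₁ h₂ h₃ h12 h13
      (by omega) (by omega) (by omega)
  · refine exists_codeword_of_last_blocks (by omega) (by omega) hR0 (fun j => decode φ (y j))
      (fun j => decode φ (digit q (2 + 2 * R + j) x)) ?_ hsp.loc hsp.glob hsp.weight_le
      hsp.one_le_weight
    intro k hk
    have e1 : (levelBlocks t m * R + k) / R = levelBlocks t m + k / R := by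
      rw [add_comm, Nat.add_mul_div_right _ _ hR0, add_comm]
    rw [e1, Nat.mul_add_mod', blockPoints, levelBlocks, blockLabel_add, Nat.div_add_mod']

end Optimality

/-! ### Existence of the special blocks over large fields -/

/-- Here `n + 1 - w ≥ q / 4`, so the binomial coefficient is at least `(q / 4) ^ w / w!`, which
exceeds `q ^ (w - 1)` once `q > 4 ^ w * w!`. -/
theorem pow_lt_choose {q n w : ℕ} (hw : 1 ≤ w) (hn : q ≤ 2 * n) (hqw : 4 * w ≤ q)
    (hq : 4 ^ w * w.factorial < q) : q ^ (w - 1) < n.choose w := by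
  have h1 : (n + 1 - w) ^ w ≤ w.factorial * n.choose w := by
    rw [← Nat.descFactorial_eq_factorial_mul_choose]
    exact Nat.pow_sub_le_descFactorial n w
  have h2 : q ^ w ≤ 4 ^ w * (n + 1 - w) ^ w := by
    rw [← mul_pow]
    exact Nat.pow_le_pow_left (by omega) w
  have h3 : q ^ w = q * q ^ (w - 1) := by rw [← pow_succ', Nat.sub_add_cancel hw]
  have h4 : 0 < q ^ (w - 1) := pow_pos (by omega) _
  by_contra! hle
  have h5 : q * q ^ (w - 1) ≤ 4 ^ w * w.factorial * q ^ (w - 1) := by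
    calc q * q ^ (w - 1) ≤ 4 ^ w * (n + 1 - w) ^ w := h3 ▸ h2
      _ ≤ 4 ^ w * (w.factorial * n.choose w) := Nat.mul_le_mul_left _ h1
      _ ≤ 4 ^ w * (w.factorial * q ^ (w - 1)) := by gcongr
      _ = _ := by ring
  exact absurd (Nat.le_of_mul_le_mul_right h5 h4) (by omega)

/-- The labels from `B` on make up at least half of the field, which leaves enough points both for
two blocks and for the pigeonhole argument. -/
theorem exists_isCandidate_of_le {F : Type*} [Field F] [DecidableEq F] {q : ℕ} {φ : F ≃ Fin q}
    {R δ d B : ℕ} (hδ : 1 ≤ δ) (hd : 2 * δ + 1 ≤ d) (hR : d ≤ R + 1) (hB : 2 * B ≤ q)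
    (hqR : 4 * R ≤ q) (hq : 4 ^ (d - δ) * (d - δ).factorial < q) :
    ∃ x < q ^ (4 * R + 2), IsCandidate R δ d φ B x := by
  let _ : Fintype F := Fintype.ofEquiv _ φ.symm
  have hcard : Fintype.card F = q := by rw [Fintype.card_congr φ, Fintype.card_fin]
  set Y : Finset F := (Finset.univ.filter fun i : Fin q => B ≤ (i : ℕ)).map φ.symm.toEmbedding
    with hY
  have hYc : Y.card = q - B := by
    rw [hY, Finset.card_map]
    have h1 := Finset.card_filter_add_card_filter_not (s := (Finset.univ : Finset (Fin q)))
      (fun i : Fin q => B ≤ (i : ℕ))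
    have h2 : (Finset.univ.filter fun i : Fin q => ¬ B ≤ (i : ℕ)).card = B := by
      rw [show (Finset.univ.filter fun i : Fin q => ¬ B ≤ (i : ℕ)) =
        Finset.univ.filter fun i : Fin q => (i : ℕ) < B from
        Finset.filter_congr fun i _ => not_le, Fin.card_filter_val_lt]
      omega
    rw [Finset.card_univ, Fintype.card_fin] at h1
    omega
  obtain ⟨y, c, h1, h2, h3, h4, h5, h6⟩ := exists_special_blocks (δ := δ) (d := d) (R := R) hδ hd hR
    Y (by omega) (by rw [hcard]; exact pow_lt_choose (by omega) (by omega) (by omega) hq)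
  have hyB : ∀ j < 2 * R, B ≤ (φ (y j) : ℕ) := fun j hj => by
    obtain ⟨i, hi, he⟩ := Finset.mem_map.1 (h1 j hj)
    have : φ (y j) = i := by rw [← he]; exact φ.apply_symm_apply i
    rw [this]
    exact (Finset.mem_filter.1 hi).2
  refine exists_isCandidate (y := fun j => φ (y j)) (c := c) (fun j _ => (φ (y j)).2)
    ⟨hyB, ?_, ?_, ?_, h5, h6⟩
  · intro j hj k hk h
    exact hk.ne' (h2 j hj k (by omega) (val_eq_val_iff.1 h))
  · simpa only [decode_val] using h3
  · simpa only [decode_val] using h4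

/-! ### The program -/

section Program

variable (R t δ d : ℕ)

/-- Large enough for the clamp to be harmless: it exceeds the exponent `4 * R + 2` of the number of
candidates and the exponent `2 * t + 6` bounding the number of matrix entries. -/
def clampExponent : ℕ := 4 * R + 2 * t + 7

def buildProg : RamProg :=
  .seq (levelProg R t) <| .seq (tableProg R t) <| .seq (searchProg R t δ d) <|
    .seq (fillProg R t δ d) <| .seq (asg 1 (colsX R t)) (asg 0 (rowsX t d))

/-- The program writing the parity-check matrix. -/
def matrixProg : RamProg := .seq (.assign 2 (powX (.var 0) (clampExponent R t))) (buildProg R t δ d)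

theorem clamped_buildProg : Clamped (buildProg R t δ d) :=
  .seq clamped_levelProg <| .seq (clamped_tableProg R t) <| .seq clamped_searchProg <|
    .seq (clamped_fillProg R t δ d) <| .seq (.assign _ _ (by omega)) (.assign _ _ (by omega))

theorem memBounded_fieldInput {F : Type*} [Field F] {q : ℕ} (φ : F ≃ Fin q) :
    MemBounded q (fieldInput φ) := by
  constructor
  · intro x
    simp only [fieldInput]
    split_ifs <;> omega
  · intro a i
    simp only [fieldInput]
    split_ifs
    · exact (φ _).2.le
    · exact (φ _).2.le
    · omega
    · omega

theorem matrixProg_cost : ∃ K, ∀ {F : Type} [Field F] {q : ℕ} (φ : F ≃ Fin q), 2 ≤ q →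
    ((matrixProg R t δ d).run (fieldInput φ)).2 ≤ K * q ^ K := by
  obtain ⟨K₁, h₁⟩ := polyBounded_cost (powX (.var 0) (clampExponent R t))
  obtain ⟨K₂, h₂⟩ := (clamped_buildProg R t δ d).run_bound
  refine ⟨4 + K₁ + clampExponent R t * K₂, fun φ hq => ?_⟩
  rename_i F _ q
  set κ := clampExponent R t with hκ
  have hκ1 : 1 ≤ κ := by rw [hκ, clampExponent]; omega
  have e1 : (powX (.var 0) κ).cost (fieldInput φ) ≤ q ^ K₁ := h₁ q hq _ (memBounded_fieldInput φ)
  have hqκ : q ≤ q ^ κ := Nat.le_self_pow (by omega) q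
  have hV : MemBounded (q ^ κ) ((fieldInput φ).setReg 2 (q ^ κ)) := by
    refine MemBounded.setReg ⟨fun x => ?_, fun a i => ?_⟩ 2 le_rfl
    · exact ((memBounded_fieldInput φ).1 x).trans hqκ
    · exact ((memBounded_fieldInput φ).2 a i).trans hqκ
  have e2 := (h₂ (q ^ κ) (hq.trans hqκ) _ hV (setReg_reg_self _ _ _)).2.2
  have e3 : ((matrixProg R t δ d).run (fieldInput φ)).2 =
      1 + (1 + (powX (.var 0) κ).cost (fieldInput φ)) +
        ((buildProg R t δ d).run ((fieldInput φ).setReg 2 (q ^ κ))).2 := by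
    have : (powX (.var 0) κ).eval (fieldInput φ) = q ^ κ := by
      rw [eval_powX, eval_var]; rfl
    rw [← this]
    rfl
  rw [← pow_mul] at e2
  have e4 : q ^ K₁ ≤ q ^ (4 + K₁ + κ * K₂) := Nat.pow_le_pow_right (by omega) (by omega)
  have e5 : q ^ (κ * K₂) ≤ q ^ (4 + K₁ + κ * K₂) := Nat.pow_le_pow_right (by omega) (by omega)
  have e6 : 1 ≤ q ^ (4 + K₁ + κ * K₂) := Nat.one_le_pow _ _ (by omega)
  have e7 : 4 * q ^ (4 + K₁ + κ * K₂) ≤ (4 + K₁ + κ * K₂) * q ^ (4 + K₁ + κ * K₂) :=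
    Nat.mul_le_mul_right _ (by omega)
  rw [e3]
  omega

variable {R t δ d}

theorem levelBlocks_le {q m : ℕ} (hR : 0 < R) (hm : 2 * (R * levelWidth R t m) ≤ q) :
    levelBlocks t m ≤ q ^ (t + 1) :=
  Nat.pow_le_pow_left ((two_pow_pow_le_width hR).trans (levelWidth_lt hR hm).le) _

theorem matrixProg_run {F : Type*} [Field F] [DecidableEq F] {q : ℕ} (φ : F ≃ Fin q) (hδ : 1 ≤ δ)
    (hd : 2 * δ + 1 ≤ d) (hR : d ≤ R + 1) (h0 : 2 * (R * levelWidth R t 0) ≤ q)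
    (hqR : 4 * R ≤ q) (hq : 4 ^ (d - δ) * (d - δ).factorial < q) :
    ∃ x, IsCandidate R δ d φ (R * levelWidth R t (level R t q q)) x ∧
      HoldsMatrix φ ((matrixProg R t δ d).run (fieldInput φ)).1
        (parityMatrix R δ d (levelBlocks t (level R t q q) + 2)
          (blockPoints R t φ (level R t q q) x)) := by
  have hR0 : 0 < R := by omega
  have hq4 : 4 ≤ q := by omega
  set κ := clampExponent R t with hκ
  set V := q ^ κ with hV
  set m := level R t q q with hm
  have hmq : 2 * (R * levelWidth R t m) ≤ q := level_spec h0 q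
  have hqV : q < V := by
    calc q = q ^ 1 := (pow_one q).symm
      _ < q ^ κ := Nat.pow_lt_pow_right (by omega) (by rw [hκ, clampExponent]; omega)
  have hsV : q ^ (4 * R + 2) < V :=
    Nat.pow_lt_pow_right (by omega) (by rw [hκ, clampExponent]; omega)
  have hrows : (levelBlocks t m + 2 + 1) * (d - 1) ≤ q ^ (t + 3) := by
    have h1 := levelBlocks_le (t := t) hR0 hmq
    have h2 : 1 ≤ q ^ (t + 1) := Nat.one_le_pow _ _ (by omega)
    calc (levelBlocks t m + 2 + 1) * (d - 1) ≤ (4 * q ^ (t + 1)) * q :=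
          Nat.mul_le_mul (by omega) (by omega)
      _ ≤ (q * q ^ (t + 1)) * q := by gcongr
      _ = q ^ (t + 3) := by ring
  have hcols : (levelBlocks t m + 2) * R ≤ q ^ (t + 3) := by
    have h1 := levelBlocks_le (t := t) hR0 hmq
    have h2 : 1 ≤ q ^ (t + 1) := Nat.one_le_pow _ _ (by omega)
    calc (levelBlocks t m + 2) * R ≤ (4 * q ^ (t + 1)) * q :=
          Nat.mul_le_mul (by omega) (by omega)
      _ ≤ (q * q ^ (t + 1)) * q := by gcongr
      _ = q ^ (t + 3) := by ring
  have hlt : ∀ k ≤ 2 * t + 6, q ^ k < V := fun k hk =>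
    Nat.pow_lt_pow_right (by omega) (by rw [hκ, clampExponent]; omega)
  have hmV : (levelBlocks t m + 2 + 1) * (d - 1) * ((levelBlocks t m + 2) * R) < V := by
    refine (Nat.mul_le_mul hrows hcols).trans_lt ?_
    rw [← pow_add]
    exact hlt _ (by omega)
  have s0 : HasTables φ V ((fieldInput φ).setReg 2 V) := hasTables_fieldInput φ V
  have hrun : ((matrixProg R t δ d).run (fieldInput φ)).1 =
      ((buildProg R t δ d).run ((fieldInput φ).setReg 2 V)).1 := by
    have : (powX (.var 0) κ).eval (fieldInput φ) = V := by
      rw [eval_powX, eval_var]; rfl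
    rw [← this]
    rfl
  have hz : ∀ a, 2 ≤ a → ∀ i, ((fieldInput φ).setReg 2 V).arr a i = 0 := fun a ha i => by
    rw [setReg_arr]
    simp only [fieldInput]
    split_ifs <;> omega
  obtain ⟨s1, z3, z4⟩ := levelProg_run hR0 s0 hqV h0 (hz 3 (by omega) 0) (hz 4 (by omega) 0)
  have s2 := tableProg_run hR0 s1 hqV hmq z3 z4
  obtain ⟨s3, hx⟩ := searchProg_run s2 (by omega) hsV
    (exists_isCandidate_of_le hδ hd hR hmq hqR hq)
  obtain ⟨s4, hH⟩ := fillProg_run s3 (by omega) hR0 (by omega) hmq hqV.le rfl hx.1 hx.2.1 hmV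
  refine ⟨_, hx, ?_⟩
  rw [hrun, buildProg, run_seq, run_seq, run_seq, run_seq, run_seq,
    s4.run_asg 1 s4.eval_colsX (hcols.trans_lt (hlt _ (by omega)))]
  have s5 := s4.1.1.setReg (x := 1) (v := (levelBlocks t m + 2) * R) (by omega) (by omega)
  rw [s5.run_asg 0 (v := (levelBlocks t m + 2 + 1) * (d - 1)) ?_
    (hrows.trans_lt (hlt _ (by omega)))]
  · refine ⟨by simp, by simp [setReg_reg], fun i j => ?_⟩
    rw [setReg_arr, setReg_arr]
    exact hH i j
  · simp only [rowsX, blocksX, eval_mul, eval_add, eval_powX, eval_var, eval_lit, eval_one,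
      setReg_reg]
    rw [if_neg (by omega), s4.reg_four]
    rfl

end Program

/-! ### The rate of growth of the length -/

section Growth
variable {R t : ℕ}

/-- Level `m + 1` no longer fits, and its width is `2 ^ (m²)` times a factor exponential in `m`;
hence `log q` is at most `m² log 2 + O(m)`. -/
theorem lt_pow_mul_two_pow_level (hR : 0 < R) (q : ℕ) :
    q < (2 * R * (t + 2) * R ^ t * (2 * R ^ t) * 2 ^ 5) ^ (level R t q q + 1) *
      2 ^ (level R t q q ^ 2) := by
  refine (lt_level_succ (t := t) hR q).trans_le ?_
  set m := level R t q q
  set c := 2 * R * (t + 2) * R ^ t with hc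
  set b := 2 * R ^ t with hb
  have hc0 : 0 < c := by positivity
  calc 2 * (R * levelWidth R t (m + 1))
      = c * (b ^ (m + 1) * (2 ^ (5 * m + 4) * 2 ^ m ^ 2)) := by
        rw [levelWidth, levelBase, ← hb, mul_pow b, ← pow_mul, ← pow_mul, ← pow_add, hc,
          show 5 * m + 4 + m ^ 2 = (m + 1) * (m + 1) + (m + 1) * 3 by ring, pow_add]
        ring
    _ ≤ c ^ (m + 1) * (b ^ (m + 1) * (2 ^ (5 * (m + 1)) * 2 ^ m ^ 2)) := by
        gcongr
        · exact Nat.le_self_pow (by omega) c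
        · omega
        · omega
    _ = (c * b * 2 ^ 5) ^ (m + 1) * 2 ^ m ^ 2 := by
        rw [mul_pow (c * b), mul_pow c, ← pow_mul]
        ring

theorem two_pow_sq_level_le {q : ℕ} (hR : 0 < R) (h0 : 2 * (R * levelWidth R t 0) ≤ q) :
    2 ^ (level R t q q ^ 2) ≤ q := by
  rw [sq, pow_mul]
  exact (two_pow_pow_le_width hR).trans (levelWidth_lt hR (level_spec h0 q)).le

/-- The loss in the exponent of the number of blocks. -/
noncomputable def exponentLoss (R t q : ℕ) : ℝ :=
  (t + 1) - Real.log (levelBlocks t (level R t q q) + 2 : ℕ) / Real.log q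

theorem rpow_sub_exponentLoss {q : ℕ} (hq : 2 ≤ q) :
    (q : ℝ) ^ ((t + 1 : ℝ) - exponentLoss R t q) = (levelBlocks t (level R t q q) + 2 : ℕ) := by
  have hq1 : (1 : ℝ) < q := by exact_mod_cast hq
  have hL : (0 : ℝ) < (levelBlocks t (level R t q q) + 2 : ℕ) := by positivity
  rw [exponentLoss, sub_sub_cancel, Real.rpow_def_of_pos (by linarith),
    mul_div_cancel₀ _ (Real.log_pos hq1).ne', Real.exp_log hL]

/-- The two special blocks may make the loss slightly negative; the total is still at most `3 * q ^
(t + 1)`. -/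
theorem neg_log_div_log_le_exponentLoss {q : ℕ} (hR : 0 < R) (hq : 2 ≤ q)
    (h0 : 2 * (R * levelWidth R t 0) ≤ q) :
    -(Real.log 3 / Real.log q) ≤ exponentLoss R t q := by
  have hq1 : (1 : ℝ) < q := by exact_mod_cast hq
  have hlog := Real.log_pos hq1
  have h1 := levelBlocks_le (t := t) hR (level_spec h0 q)
  have h2 : 1 ≤ q ^ (t + 1) := Nat.one_le_pow _ _ (by omega)
  have h3 : ((levelBlocks t (level R t q q) + 2 : ℕ) : ℝ) ≤ 3 * (q : ℝ) ^ (t + 1) := by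
    exact_mod_cast (show levelBlocks t (level R t q q) + 2 ≤ 3 * q ^ (t + 1) by omega)
  have h4 := Real.log_le_log (by positivity) h3
  rw [Real.log_mul (by norm_num) (by positivity), Real.log_pow] at h4
  have h5 := div_le_div_of_nonneg_right h4 hlog.le
  rw [add_div, mul_div_cancel_right₀ _ hlog.ne'] at h5
  push_cast at h5
  rw [exponentLoss]
  push_cast
  linarith

/-- There are more than `2 ^ ((t + 1) m²)` blocks and `log q ≤ (m + 1) log D + m² log 2`, so the
loss is at most `(t + 1) (m + 1) log D / log q`. Since `m ≤ √(log q / log 2)`, this is of order `1 /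
√(log q)`. -/
theorem exponentLoss_le {q : ℕ} (hR : 0 < R) (hq : 2 ≤ q)
    (h0 : 2 * (R * levelWidth R t 0) ≤ q) :
    exponentLoss R t q ≤
      (t + 1) * Real.log ((2 * R * (t + 2) * R ^ t * (2 * R ^ t) * 2 ^ 5 : ℕ) : ℝ) *
        ((Real.log q)⁻¹ + (Real.sqrt (Real.log 2))⁻¹ * (Real.sqrt (Real.log q))⁻¹) := by
  have hq1 : (1 : ℝ) < q := by exact_mod_cast hq
  have hlog := Real.log_pos hq1
  have hlog2 : 0 < Real.log 2 := Real.log_pos one_lt_two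
  set D := 2 * R * (t + 2) * R ^ t * (2 * R ^ t) * 2 ^ 5 with hD
  set m := level R t q q with hm
  have hD0 : 0 < D := by positivity
  have hlogD : 0 ≤ Real.log (D : ℝ) := Real.log_natCast_nonneg D
  have h1 : (q : ℝ) ≤ (D : ℝ) ^ (m + 1) * 2 ^ (m ^ 2) := by
    exact_mod_cast (lt_pow_mul_two_pow_level (t := t) hR q).le
  have h2 : Real.log q ≤ (m + 1) * Real.log D + m ^ 2 * Real.log 2 := by
    have := Real.log_le_log (by linarith) h1
    rw [Real.log_mul (by positivity) (by positivity), Real.log_pow, Real.log_pow] at this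
    exact_mod_cast this
  have h3 : (m : ℝ) ^ 2 * Real.log 2 ≤ Real.log q := by
    have : (2 : ℝ) ^ (m ^ 2) ≤ q := by exact_mod_cast two_pow_sq_level_le (t := t) hR h0
    have := Real.log_le_log (by positivity) this
    rw [Real.log_pow] at this
    exact_mod_cast this
  have h4 : (t + 1) * (m ^ 2 * Real.log 2) ≤ Real.log (levelBlocks t m + 2 : ℕ) := by
    have : (((2 : ℝ) ^ m) ^ m) ^ (t + 1) ≤ (levelBlocks t m + 2 : ℕ) := by
      exact_mod_cast (Nat.le_add_right (levelBlocks t m) 2)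
    have := Real.log_le_log (by positivity) this
    rw [Real.log_pow, Real.log_pow, Real.log_pow] at this
    push_cast at this ⊢
    linarith
  have h5 : (m : ℝ) * Real.sqrt (Real.log 2) ≤ Real.sqrt (Real.log q) := by
    refine Real.le_sqrt_of_sq_le ?_
    rw [mul_pow, Real.sq_sqrt hlog2.le]
    exact h3
  have hs2 := Real.sqrt_pos.2 hlog2
  have hsq := Real.sqrt_pos.2 hlog
  have h6 : ((m : ℝ) + 1) / Real.log q ≤
      (Real.log q)⁻¹ + (Real.sqrt (Real.log 2))⁻¹ * (Real.sqrt (Real.log q))⁻¹ := by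
    have : (m : ℝ) / Real.log q ≤ (Real.sqrt (Real.log 2))⁻¹ * (Real.sqrt (Real.log q))⁻¹ := by
      rw [← mul_inv, ← one_div, div_le_div_iff₀ hlog (by positivity)]
      calc (m : ℝ) * (Real.sqrt (Real.log 2) * Real.sqrt (Real.log q))
          = m * Real.sqrt (Real.log 2) * Real.sqrt (Real.log q) := by ring
        _ ≤ Real.sqrt (Real.log q) * Real.sqrt (Real.log q) := by gcongr
        _ = 1 * Real.log q := by rw [Real.mul_self_sqrt hlog.le, one_mul]
    rw [add_div, one_div]
    linarith
  calc exponentLoss R t q ≤ (t + 1) - (t + 1) * (m ^ 2 * Real.log 2) / Real.log q := by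
        rw [exponentLoss, ← hm]
        gcongr
    _ = (t + 1) * ((Real.log q - m ^ 2 * Real.log 2) / Real.log q) := by field_simp
    _ ≤ (t + 1) * (((m + 1) * Real.log D) / Real.log q) := by
        gcongr
        linarith
    _ = (t + 1) * Real.log D * ((m + 1) / Real.log q) := by ring
    _ ≤ _ := by gcongr

theorem tendsto_exponentLoss (hR : 0 < R) : Tendsto (exponentLoss R t) atTop (𝓝 0) := by
  have hlog : Tendsto (fun q : ℕ => Real.log (q : ℝ)) atTop atTop :=
    Real.tendsto_log_atTop.comp tendsto_natCast_atTop_atTop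
  have hinv := tendsto_inv_atTop_zero.comp hlog
  have hsqrt := tendsto_inv_atTop_zero.comp (Real.tendsto_sqrt_atTop.comp hlog)
  have hlow : Tendsto (fun q : ℕ => -(Real.log 3 / Real.log (q : ℝ))) atTop (𝓝 0) := by
    simpa [div_eq_mul_inv] using (hinv.const_mul (Real.log 3)).neg
  have hup := (hinv.add (hsqrt.const_mul (Real.sqrt (Real.log 2))⁻¹)).const_mul
    ((t + 1) * Real.log ((2 * R * (t + 2) * R ^ t * (2 * R ^ t) * 2 ^ 5 : ℕ) : ℝ))
  rw [mul_zero, add_zero, mul_zero] at hup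
  refine tendsto_of_tendsto_of_tendsto_of_le_of_le' hlow hup ?_ ?_
  · filter_upwards [eventually_ge_atTop 2, eventually_ge_atTop (2 * (R * levelWidth R t 0))]
      with q hq h0 using neg_log_div_log_le_exponentLoss hR hq h0
  · filter_upwards [eventually_ge_atTop 2, eventually_ge_atTop (2 * (R * levelWidth R t 0))]
      with q hq h0 using exponentLoss_le hR hq h0

end Growth

end LRC

/-! ### The main theorem -/

open LRC

theorem corollary5p2 (δ d r : ℕ) (hδ : 2 ≤ δ) (hd₁ : 3 * δ + 1 ≤ d) (hd₂ : d ≤ 4 * δ)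
    (hr : d ≤ r + δ) :
    ∃ (P : RamProg) (K : ℕ) (ε : ℕ → ℝ), Tendsto ε atTop (𝓝 0) ∧
      ∀ᶠ q : ℕ in atTop,
        ∀ (F : Type) [Field F] [DecidableEq F] (φ : F ≃ Fin q),
          ∃ (s n : ℕ) (H : Matrix (Fin s) (Fin n) F),
            (P.run (fieldInput φ)).2 ≤ K * q ^ K ∧
            HoldsMatrix φ (P.run (fieldInput φ)).1 H ∧
            IsOptimalLRC (codeOf H) d r δ ∧
            (r + δ - 1) ∣ n ∧
            (n : ℝ) = ((r : ℝ) + (δ : ℝ) - 1) *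
              (q : ℝ) ^ ((if Even δ then (δ : ℝ) / 2 + 1 else ((δ : ℝ) + 1) / 2) - ε q) := by
  obtain ⟨R, hR⟩ : ∃ R, R = r + δ - 1 := ⟨_, rfl⟩
  have hR0 : 0 < R := by omega
  obtain ⟨K, hK⟩ := matrixProg_cost R (δ / 2) δ d
  refine ⟨matrixProg R (δ / 2) δ d, K, exponentLoss R (δ / 2), tendsto_exponentLoss hR0, ?_⟩
  -- The thresholds ensure, in turn, that `log q` is positive, that level `0` fits in half of the
  -- labels, that two blocks fit in the other half, and that the pigeonhole count succeeds.
  filter_upwards [eventually_ge_atTop 2, eventually_ge_atTop (2 * (R * levelWidth R (δ / 2) 0)),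
    eventually_ge_atTop (4 * R), eventually_gt_atTop (4 ^ (d - δ) * (d - δ).factorial)]
    with q hq2 h0 hqR hq F _ _ φ
  obtain ⟨x, hx, hH⟩ := matrixProg_run (t := δ / 2) φ (by omega : 1 ≤ δ) (by omega) (by omega)
    h0 hqR hq
  refine ⟨_, _, _, hK φ hq2, hH,
    isOptimalLRC_blockPoints hδ hd₁ hd₂ hr hR (by omega) (level_spec h0 q) hx,
    hR ▸ Dvd.intro_left _ rfl, ?_⟩
  -- Both exponents of the statement equal `⌊δ/2⌋ + 1`.
  have hexp : (if Even δ then (δ : ℝ) / 2 + 1 else ((δ : ℝ) + 1) / 2) = ((δ / 2 : ℕ) : ℝ) + 1 := by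
    split_ifs with h
    · rw [Nat.cast_div h.two_dvd two_ne_zero, Nat.cast_ofNat]
    · obtain ⟨k, rfl⟩ := Nat.not_even_iff_odd.1 h
      rw [show (2 * k + 1) / 2 = k by omega]
      push_cast
      ring
  have hRr : (r : ℝ) + (δ : ℝ) - 1 = (R : ℝ) := by
    rw [hR, Nat.cast_sub (by omega), Nat.cast_add, Nat.cast_one]
  rw [hexp, hRr, rpow_sub_exponentLoss hq2, ← Nat.cast_mul, mul_comm]
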